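/- **Theorem (energy estimate).** Let $(\Sigma, j)$ be a closed (compact, connected) Riemann surface with a smooth Riemannian metric $ds^2_\Sigma$ conformal to $j$, and let $(M, J, h)$ be a compact Hermitian surface (a compact complex manifold of complex dimension $2$ with a smooth Hermitian metric $h$). A smooth map $f:\Sigma\to M$ is called Chern-harmonic if $\operatorname{tr}\nabla df=0$, where $\nabla$ is the connection on $T^*\Sigma\otimes f^{-1}TM$ induced by the Levi-Civita connection of $ds^2_\Sigma$ and the Chern connection of $h$ on $TM$ (the unique connection that preserves $J$ and $h$ and has torsion with vanishing $(1,1)$-part), and the trace is taken with respect to $ds^2_\Sigma$. Let $e(f)=\tfrac12|df|^2$ be the energy density of $f$, let $dA$ be the area element of $ds^2_\Sigma$, and for $p\in\Sigma$, $R>0$ let $D_R(p)=\{x\in\Sigma : d(p,x)<R\}$ be the geodesic disk for the Riemannian distance $d$ of $ds^2_\Sigma$. Then there are constants $C_3>0$ and $\epsilon_1>0$, depending only on $(\Sigma,j,ds^2_\Sigma)$ and $(M,J,h)$, such that for every Chern-harmonic map $f:\Sigma\to M$, every $p\in\Sigma$ and every $r>0$ with $$E(2r):=\int_{D_{2r}(p)}e(f)\,dA\le\epsilon_1,$$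 one has $$\sup_{D_r(p)}e(f)\le C_3\,\frac{E(2r)}{r^2}.$$ -/

import Mathlib

open scoped Manifold ContDiff Topology
open Bundle MeasureTheory Set

noncomputable section

namespace ChernHarmonic

/-! ### Components of vector fields in a chart -/

section Coordinates

variable {E : Type*} [NormedAddCommGroup E] [NormedSpace ℝ E]
  {M : Type*} [TopologicalSpace M] [ChartedSpace E M] [IsManifold 𝓘(ℝ, E) ∞ M]

/-- The components of a vector field in the coordinates of the preferred chart at `p`. -/
def coords (p : M) (σ : Π y : M, TangentSpace 𝓘(ℝ, E) y) (y : M) : E :=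
  (trivializationAt E (fun y : M => TangentSpace 𝓘(ℝ, E) y) p).continuousLinearMapAt ℝ y (σ y)

theorem eventually_mem_baseSet (x : M) :
    ∀ᶠ y in 𝓝 x, y ∈ (trivializationAt E (TangentSpace 𝓘(ℝ, E) : M → Type _) x).baseSet :=
  (trivializationAt E (TangentSpace 𝓘(ℝ, E) : M → Type _) x).open_baseSet.mem_nhds
    (FiberBundle.mem_baseSet_trivializationAt' x)

theorem mdifferentiableAt_coords {x : M} {σ : Π y : M, TangentSpace 𝓘(ℝ, E) y}
    (h : MDiffAt (T% σ) x) : MDiffAt (coords x σ) x := by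
  rw [mdifferentiableAt_section] at h
  refine h.congr_of_eventuallyEq ?_
  filter_upwards [eventually_mem_baseSet (E := E) x] with y hy
  simp only [coords]
  rw [Trivialization.continuousLinearMapAt_apply, Trivialization.coe_linearMapAt_of_mem _ hy]

variable (M) in
/-- The covariant derivative which at a point `x` differentiates the components of a vector field in
the preferred chart at `x`. An affine connection is obtained from it by adding, at each `x`, the
Christoffel symbols at `x` in the preferred chart at `x`. -/
def chartDerivative :
    CovariantDerivative 𝓘(ℝ, E) E (fun x : M => TangentSpace 𝓘(ℝ, E) x) where
  toFun σ x :=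
    (trivializationAt E (fun x : M => TangentSpace 𝓘(ℝ, E) x) x).symmL ℝ x ∘L d% (coords x σ) x
  isCovariantDerivativeOnUniv :=
    { add := by
        intro σ σ' x hσ hσ' _
        have e : coords x (σ + σ') = coords x σ + coords x σ' := by
          funext y; simp [coords]
        rw [e, mvfderiv_add (mdifferentiableAt_coords hσ) (mdifferentiableAt_coords hσ'),
          ContinuousLinearMap.comp_add]
      leibniz := by
        intro σ g x hσ hg _
        have e : coords x (g • σ) = g • coords x σ := by
          funext y; simp [coords]
        rw [e, mvfderiv_smul hg (mdifferentiableAt_coords hσ)]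
        ext v
        simp only [ContinuousLinearMap.comp_apply, _root_.add_apply, _root_.smul_apply, map_add,
          map_smul, ContinuousLinearMap.smulRight_apply]
        congr 2
        exact Trivialization.symmL_continuousLinearMapAt _
          (FiberBundle.mem_baseSet_trivializationAt' x) (σ x) }

/-- `FiberBundle.extend E u` is the vector field with constant components in the preferred chart at
the base point `x` of `u`, that is a constant combination of coordinate vector fields. -/
theorem extend_eq (x y : M)
    (hy : y ∈ (trivializationAt E (fun y : M => TangentSpace 𝓘(ℝ, E) y) x).baseSet) (u : TangentSpace 𝓘(ℝ, E) x) :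
    (FiberBundle.extend E u : Π y : M, TangentSpace 𝓘(ℝ, E) y) y =
      (trivializationAt E (fun y : M => TangentSpace 𝓘(ℝ, E) y) x).symmL ℝ y
        ((trivializationAt E (fun y : M => TangentSpace 𝓘(ℝ, E) y) x).continuousLinearMapAt
          ℝ x u) := by
  rw [Trivialization.continuousLinearMapAt_apply, Trivialization.linearMapAt_apply,
    if_pos (FiberBundle.mem_baseSet_trivializationAt' x), Trivialization.symmL_apply _ hy]
  rfl

theorem chartDerivative_extend (x : M) (u : TangentSpace 𝓘(ℝ, E) x) :
    chartDerivative M (FiberBundle.extend E u) x = 0 := by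
  have h : coords x (FiberBundle.extend E u) =ᶠ[𝓝 x] fun _ =>
      (trivializationAt E (fun y : M => TangentSpace 𝓘(ℝ, E) y) x).continuousLinearMapAt ℝ x u := by
    filter_upwards [eventually_mem_baseSet (E := E) x] with y hy
    simp only [coords]
    rw [extend_eq x y hy, Trivialization.continuousLinearMapAt_symmL _ hy]
  have h2 : d% (coords x (FiberBundle.extend E u)) x = 0 := by
    unfold mvfderiv
    rw [h.mfderiv_eq]
    exact mvfderiv_const _
  change _ ∘L d% (coords x (FiberBundle.extend E u)) x = 0
  rw [h2, ContinuousLinearMap.comp_zero]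

/-- Coordinate vector fields commute. -/
theorem mlieBracket_extend (x : M) (u v : TangentSpace 𝓘(ℝ, E) x) :
    VectorField.mlieBracket 𝓘(ℝ, E) (FiberBundle.extend E u) (FiberBundle.extend E v) x = 0 := by
  have key : ∀ u : TangentSpace 𝓘(ℝ, E) x,
      (VectorField.mpullbackWithin 𝓘(ℝ, E) 𝓘(ℝ, E) (extChartAt 𝓘(ℝ, E) x).symm
        (FiberBundle.extend E u) (range 𝓘(ℝ, E)) : E → E)
      =ᶠ[𝓝 (extChartAt 𝓘(ℝ, E) x x)] fun _ =>
      (trivializationAt E (fun y : M => TangentSpace 𝓘(ℝ, E) y) x).continuousLinearMapAt ℝ x u := by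
    intro u
    filter_upwards [extChartAt_target_mem_nhds (I := 𝓘(ℝ, E)) x] with z hz
    have hy : (extChartAt 𝓘(ℝ, E) x).symm z ∈ (chartAt E x).source := by
      simpa using (extChartAt 𝓘(ℝ, E) x).map_target hz
    rw [VectorField.mpullbackWithin_apply, extend_eq x _ hy]
    have h := TangentBundle.symmL_trivializationAt (I := 𝓘(ℝ, E)) hy
    rw [(extChartAt 𝓘(ℝ, E) x).right_inv hz] at h
    have hb : (extChartAt 𝓘(ℝ, E) x).symm z ∈
      (trivializationAt E (fun y : M => TangentSpace 𝓘(ℝ, E) y) x).baseSet := hy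
    have h3 : (trivializationAt E (fun y : M => TangentSpace 𝓘(ℝ, E) y) x).symmL ℝ
        ((extChartAt 𝓘(ℝ, E) x).symm z) =
        (((trivializationAt E (fun y : M => TangentSpace 𝓘(ℝ, E) y) x).continuousLinearEquivAt ℝ
          ((extChartAt 𝓘(ℝ, E) x).symm z) hb).symm : E →L[ℝ] _) := by
      ext w
      exact (congrFun (Trivialization.symm_continuousLinearEquivAt_eq (R := ℝ) _ hb) w).symm
    have h4 : ∀ w : E, ((trivializationAt E (fun y : M => TangentSpace 𝓘(ℝ, E) y) x).symmL ℝ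
        ((extChartAt 𝓘(ℝ, E) x).symm z)).inverse ((trivializationAt E
          (fun y : M => TangentSpace 𝓘(ℝ, E) y) x).symmL ℝ ((extChartAt 𝓘(ℝ, E) x).symm z) w) = w := by
      intro w
      rw [h3, ContinuousLinearMap.inverse_equiv]
      exact ContinuousLinearEquiv.apply_symm_apply _ w
    have h5 := h4 ((trivializationAt E (fun y : M => TangentSpace 𝓘(ℝ, E) y) x).continuousLinearMapAt
      ℝ x u)
    rw [← h]
    exact h5
  rw [VectorField.mlieBracket, VectorField.mlieBracketWithin_apply]
  have h2 := (key u).lieBracket_vectorField_eq (𝕜 := ℝ) (key v)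
  have h3 : VectorField.lieBracketWithin ℝ
      (VectorField.mpullbackWithin 𝓘(ℝ, E) 𝓘(ℝ, E) (extChartAt 𝓘(ℝ, E) x).symm
        (FiberBundle.extend E u) (range 𝓘(ℝ, E)) : E → E)
      (VectorField.mpullbackWithin 𝓘(ℝ, E) 𝓘(ℝ, E) (extChartAt 𝓘(ℝ, E) x).symm
        (FiberBundle.extend E v) (range 𝓘(ℝ, E)) : E → E)
      ((extChartAt 𝓘(ℝ, E) x).symm ⁻¹' univ ∩ range 𝓘(ℝ, E)) (extChartAt 𝓘(ℝ, E) x x) = 0 := by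
    have h4 : ((extChartAt 𝓘(ℝ, E) x).symm ⁻¹' univ ∩ range 𝓘(ℝ, E)) = univ := by simp
    rw [h4]
    refine (congrFun (VectorField.lieBracketWithin_univ (𝕜 := ℝ)) _).trans (h2.trans ?_)
    simp [VectorField.lieBracket]
  exact (congrArg _ h3).trans (map_zero _)

theorem extend_add (x y : M)
    (hy : y ∈ (trivializationAt E (fun y : M => TangentSpace 𝓘(ℝ, E) y) x).baseSet) (u v : TangentSpace 𝓘(ℝ, E) x) :
    (FiberBundle.extend E (u + v) : Π y : M, TangentSpace 𝓘(ℝ, E) y) y =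
      FiberBundle.extend E u y + FiberBundle.extend E v y := by
  rw [extend_eq x y hy, extend_eq x y hy, extend_eq x y hy, ContinuousLinearMap.map_add,
    ContinuousLinearMap.map_add]

theorem extend_smul (x y : M)
    (hy : y ∈ (trivializationAt E (fun y : M => TangentSpace 𝓘(ℝ, E) y) x).baseSet) (c : ℝ) (v : TangentSpace 𝓘(ℝ, E) x) :
    (FiberBundle.extend E (c • v) : Π y : M, TangentSpace 𝓘(ℝ, E) y) y =
      c • FiberBundle.extend E v y := by
  rw [extend_eq x y hy, extend_eq x y hy, ContinuousLinearMap.map_smul, ContinuousLinearMap.map_smul]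

end Coordinates

/-! ### Derivatives of the metric coefficients -/

section MetricDerivative

variable {E : Type*} [NormedAddCommGroup E] [NormedSpace ℝ E]
  {M : Type*} [TopologicalSpace M] [ChartedSpace E M] [IsManifold 𝓘(ℝ, E) ∞ M]
  [RiemannianBundle (fun x : M => TangentSpace 𝓘(ℝ, E) x)]

/-- The derivative at `x` in the direction `v` of the metric coefficient `⟪u, w⟫`, where `u` and `w`
are extended with constant components in the preferred chart at `x`; in classical notation
`v ^ k * u ^ i * w ^ j * ∂ₖ gᵢⱼ (x)`. -/
def metricDeriv (x : M) (u w v : TangentSpace 𝓘(ℝ, E) x) : ℝ :=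
  d% (fun y => inner ℝ (FiberBundle.extend E u y) (FiberBundle.extend E w y)) x v

theorem metricDeriv_symm (x : M) (u w v : TangentSpace 𝓘(ℝ, E) x) :
    metricDeriv x u w v = metricDeriv x w u v := by
  unfold metricDeriv
  simp only [real_inner_comm]

theorem metricDeriv_add₃ (x : M) (u w v v' : TangentSpace 𝓘(ℝ, E) x) :
    metricDeriv x u w (v + v') = metricDeriv x u w v + metricDeriv x u w v' := map_add _ _ _

theorem metricDeriv_smul₃ (x : M) (c : ℝ) (u w v : TangentSpace 𝓘(ℝ, E) x) :
    metricDeriv x u w (c • v) = c * metricDeriv x u w v := map_smul _ _ _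

variable [IsContMDiffRiemannianBundle 𝓘(ℝ, E) ∞ E (fun x : M => TangentSpace 𝓘(ℝ, E) x)]

theorem mdifferentiableAt_inner_extend (x : M) (u w : TangentSpace 𝓘(ℝ, E) x) :
    MDiffAt (fun y => inner ℝ (FiberBundle.extend E u y) (FiberBundle.extend E w y)) x :=
  MDifferentiableAt.inner_bundle (F := E) (E := fun y : M => TangentSpace 𝓘(ℝ, E) y)
    (b := fun y => y) (v := FiberBundle.extend E u) (w := FiberBundle.extend E w)
    (FiberBundle.mdifferentiableAt_extend 𝓘(ℝ, E) E u)
    (FiberBundle.mdifferentiableAt_extend 𝓘(ℝ, E) E w)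

theorem metricDeriv_add₁ (x : M) (u u' w v : TangentSpace 𝓘(ℝ, E) x) :
    metricDeriv x (u + u') w v = metricDeriv x u w v + metricDeriv x u' w v := by
  have h : (fun y => inner ℝ (FiberBundle.extend E (u + u') y) (FiberBundle.extend E w y)) =ᶠ[𝓝 x]
      (fun y => inner ℝ (FiberBundle.extend E u y) (FiberBundle.extend E w y)) + fun y =>
        inner ℝ (FiberBundle.extend E u' y) (FiberBundle.extend E w y) := by
    filter_upwards [eventually_mem_baseSet (E := E) x] with y hy
    rw [extend_add x y hy, inner_add_left, Pi.add_apply]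
  have h2 := mvfderiv_add (mdifferentiableAt_inner_extend x u w) (mdifferentiableAt_inner_extend x u' w)
  have h3 := h.mfderiv_eq (I := 𝓘(ℝ, E)) (I' := 𝓘(ℝ, ℝ))
  exact congrArg (fun L : TangentSpace 𝓘(ℝ, E) x →L[ℝ] ℝ => L v) (Eq.trans h3 h2)

theorem metricDeriv_smul₁ (x : M) (c : ℝ) (u w v : TangentSpace 𝓘(ℝ, E) x) :
    metricDeriv x (c • u) w v = c * metricDeriv x u w v := by
  have h : (fun y => inner ℝ (FiberBundle.extend E (c • u) y) (FiberBundle.extend E w y)) =ᶠ[𝓝 x]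
      (fun _ : M => c) • (fun y : M => inner ℝ (FiberBundle.extend E u y) (FiberBundle.extend E w y)) := by
    filter_upwards [eventually_mem_baseSet (E := E) x] with y hy
    rw [extend_smul x y hy, real_inner_smul_left]
    rfl
  have h2 := mvfderiv_smul (mdifferentiableAt_const (c := c)) (mdifferentiableAt_inner_extend x u w)
  have h3 := h.mfderiv_eq (I := 𝓘(ℝ, E)) (I' := 𝓘(ℝ, ℝ))
  have h4 := congrArg (fun L : TangentSpace 𝓘(ℝ, E) x →L[ℝ] ℝ => L v) (Eq.trans h3 h2)
  refine h4.trans ?_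
  rw [mvfderiv_const]
  simp [metricDeriv]

theorem metricDeriv_add₂ (x : M) (u w w' v : TangentSpace 𝓘(ℝ, E) x) :
    metricDeriv x u (w + w') v = metricDeriv x u w v + metricDeriv x u w' v := by
  simp only [metricDeriv_symm x u, metricDeriv_add₁]

theorem metricDeriv_smul₂ (x : M) (c : ℝ) (u w v : TangentSpace 𝓘(ℝ, E) x) :
    metricDeriv x u (c • w) v = c * metricDeriv x u w v := by
  simp only [metricDeriv_symm x u, metricDeriv_smul₁]

end MetricDerivative

/-! ### Connections given by Christoffel symbols, and the Levi-Civita connection -/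

section Connections

/-- The bilinear map `Γ` determined by `⟪Γ u v, w⟫ = B u v w`. -/
def ofTrilinear {V : Type*} [NormedAddCommGroup V] [InnerProductSpace ℝ V] [FiniteDimensional ℝ V]
    (B : V →ₗ[ℝ] V →ₗ[ℝ] V →ₗ[ℝ] ℝ) : V →L[ℝ] V →L[ℝ] V :=
  haveI : CompleteSpace V := FiniteDimensional.complete ℝ _
  LinearMap.toContinuousLinearMap
    { toFun := fun u => LinearMap.toContinuousLinearMap
        { toFun := fun v =>
            (InnerProductSpace.toDual ℝ V).symm (LinearMap.toContinuousLinearMap (B u v))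
          map_add' := by simp
          map_smul' := by simp }
      map_add' := by intros; ext; simp
      map_smul' := by intros; ext; simp }

theorem inner_ofTrilinear {V : Type*} [NormedAddCommGroup V] [InnerProductSpace ℝ V]
    [FiniteDimensional ℝ V] (B : V →ₗ[ℝ] V →ₗ[ℝ] V →ₗ[ℝ] ℝ) (u v w : V) :
    inner ℝ (ofTrilinear B u v) w = B u v w := by
  simp [ofTrilinear]

variable {E : Type*} [NormedAddCommGroup E] [NormedSpace ℝ E] [FiniteDimensional ℝ E]
  {M : Type*} [TopologicalSpace M] [ChartedSpace E M] [IsManifold 𝓘(ℝ, E) ∞ M]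

instance finiteDimensional_tangentSpace (x : M) :
    FiniteDimensional ℝ (TangentSpace 𝓘(ℝ, E) x) :=
  inferInstanceAs (FiniteDimensional ℝ E)

variable [RiemannianBundle (fun x : M => TangentSpace 𝓘(ℝ, E) x)]

/-- The connection whose Christoffel symbols at `x`, in the preferred chart at `x`, are given by
`⟪Γ(v, u), w⟫ = A x u v w`, that is `(∇_v û)(x) = Γ(v, u)` if `û` has constant components. -/
def connectionOfForm
    (A : Π x : M, TangentSpace 𝓘(ℝ, E) x →ₗ[ℝ] TangentSpace 𝓘(ℝ, E) x →ₗ[ℝ]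
      TangentSpace 𝓘(ℝ, E) x →ₗ[ℝ] ℝ) :
    CovariantDerivative 𝓘(ℝ, E) E (fun x : M => TangentSpace 𝓘(ℝ, E) x) :=
  (chartDerivative M).addOneForm fun x => ofTrilinear (A x)

theorem connectionOfForm_apply
    (A : Π x : M, TangentSpace 𝓘(ℝ, E) x →ₗ[ℝ] TangentSpace 𝓘(ℝ, E) x →ₗ[ℝ]
      TangentSpace 𝓘(ℝ, E) x →ₗ[ℝ] ℝ)
    (σ : Π x : M, TangentSpace 𝓘(ℝ, E) x) (x : M) (v : TangentSpace 𝓘(ℝ, E) x) :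
    connectionOfForm A σ x v = chartDerivative M σ x v + ofTrilinear (A x) (σ x) v := rfl

theorem connectionOfForm_extend
    (A : Π x : M, TangentSpace 𝓘(ℝ, E) x →ₗ[ℝ] TangentSpace 𝓘(ℝ, E) x →ₗ[ℝ]
      TangentSpace 𝓘(ℝ, E) x →ₗ[ℝ] ℝ) (x : M) (u v : TangentSpace 𝓘(ℝ, E) x) :
    connectionOfForm A (FiberBundle.extend E u) x v = ofTrilinear (A x) u v := by
  rw [connectionOfForm_apply, chartDerivative_extend, FiberBundle.extend_apply_self]
  exact zero_add _

theorem torsion_connectionOfForm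
    (A : Π x : M, TangentSpace 𝓘(ℝ, E) x →ₗ[ℝ] TangentSpace 𝓘(ℝ, E) x →ₗ[ℝ]
      TangentSpace 𝓘(ℝ, E) x →ₗ[ℝ] ℝ) (x : M) (u v : TangentSpace 𝓘(ℝ, E) x) :
    (connectionOfForm A).torsion x u v = ofTrilinear (A x) v u - ofTrilinear (A x) u v := by
  rw [CovariantDerivative.torsion_apply_eq_extend, mlieBracket_extend,
    FiberBundle.extend_apply_self, FiberBundle.extend_apply_self, connectionOfForm_extend,
    connectionOfForm_extend, sub_zero]

variable [IsContMDiffRiemannianBundle 𝓘(ℝ, E) ∞ E (fun x : M => TangentSpace 𝓘(ℝ, E) x)]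

theorem isMetricCompatible_connectionOfForm
    (A : Π x : M, TangentSpace 𝓘(ℝ, E) x →ₗ[ℝ] TangentSpace 𝓘(ℝ, E) x →ₗ[ℝ]
      TangentSpace 𝓘(ℝ, E) x →ₗ[ℝ] ℝ)
    (hA : ∀ x u w v, A x u v w + A x w v u = metricDeriv x u w v) :
    CovariantDerivative.IsMetricCompatible (I := 𝓘(ℝ, E))
      (V := fun x : M => TangentSpace 𝓘(ℝ, E) x) (connectionOfForm A) := by
  unfold CovariantDerivative.IsMetricCompatible
  ext x u w v
  rw [CovariantDerivative.derivMetricTensor_apply_eq_extend]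
  change metricDeriv x u w v - _ - _ = 0
  have h : ∀ u : TangentSpace 𝓘(ℝ, E) x,
      connectionOfForm A (FiberBundle.extend E u) x v = ofTrilinear (A x) u v :=
    fun u => connectionOfForm_extend A x u v
  rw [← hA, h, h, inner_ofTrilinear, real_inner_comm, inner_ofTrilinear]
  ring

/-- The Christoffel symbols of the first kind of the Levi-Civita connection,
`⟪Γ(v, u), w⟫ = (∂_v ⟪u, w⟫ + ∂_u ⟪v, w⟫ - ∂_w ⟪u, v⟫) / 2`. -/
def leviCivitaForm (x : M) : TangentSpace 𝓘(ℝ, E) x →ₗ[ℝ] TangentSpace 𝓘(ℝ, E) x →ₗ[ℝ]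
    TangentSpace 𝓘(ℝ, E) x →ₗ[ℝ] ℝ where
  toFun u :=
    { toFun := fun v =>
        { toFun := fun w =>
            (1 / 2 : ℝ) * (metricDeriv x u w v + metricDeriv x v w u - metricDeriv x u v w)
          map_add' := by
            intros; simp only [metricDeriv_add₂, metricDeriv_add₃]; ring
          map_smul' := by
            intros
            simp only [metricDeriv_smul₂, metricDeriv_smul₃, smul_eq_mul, RingHom.id_apply]; ring }
      map_add' := by
        intros; ext
        simp only [metricDeriv_add₁, metricDeriv_add₂, metricDeriv_add₃, LinearMap.coe_mk,
          AddHom.coe_mk, LinearMap.add_apply]; ring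
      map_smul' := by
        intros; ext
        simp only [metricDeriv_smul₁, metricDeriv_smul₂, metricDeriv_smul₃, LinearMap.coe_mk,
          AddHom.coe_mk, LinearMap.smul_apply, smul_eq_mul, RingHom.id_apply]; ring }
  map_add' := by
    intros; ext
    simp only [metricDeriv_add₁, metricDeriv_add₃, LinearMap.coe_mk,
          AddHom.coe_mk, LinearMap.add_apply]; ring
  map_smul' := by
    intros; ext
    simp only [metricDeriv_smul₁, metricDeriv_smul₃, LinearMap.coe_mk,
      AddHom.coe_mk, LinearMap.smul_apply, smul_eq_mul, RingHom.id_apply]; ring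

variable (M) in
/-- The Levi-Civita connection, the metric torsion-free connection. -/
def leviCivita : CovariantDerivative 𝓘(ℝ, E) E (fun x : M => TangentSpace 𝓘(ℝ, E) x) :=
  connectionOfForm leviCivitaForm

theorem leviCivita_isMetricCompatible :
    CovariantDerivative.IsMetricCompatible (I := 𝓘(ℝ, E))
      (V := fun x : M => TangentSpace 𝓘(ℝ, E) x) (leviCivita M) := by
  apply isMetricCompatible_connectionOfForm
  intro x u w v
  simp only [leviCivitaForm, LinearMap.coe_mk, AddHom.coe_mk]
  rw [metricDeriv_symm x w u v, metricDeriv_symm x v w u, metricDeriv_symm x v u w]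
  ring

theorem leviCivita_torsion (x : M) (u v : TangentSpace 𝓘(ℝ, E) x) :
    (leviCivita M).torsion x u v = 0 := by
  rw [leviCivita, torsion_connectionOfForm, sub_eq_zero]
  refine ext_inner_right ℝ fun w => ?_
  rw [inner_ofTrilinear, inner_ofTrilinear]
  simp only [leviCivitaForm, LinearMap.coe_mk, AddHom.coe_mk]
  rw [metricDeriv_symm x v u w]
  ring

end Connections

/-! ### Complex manifolds, Hermitian metrics and the Chern connection -/

section Complex
variable {E : Type*} [NormedAddCommGroup E] [NormedSpace ℂ E] [NormedSpace ℝ E]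
  [IsScalarTower ℝ ℂ E]
  {M : Type*} [TopologicalSpace M] [ChartedSpace E M]

/-- A complex manifold is a real manifold. -/
instance isManifold_real {n : ℕ∞ω} [IsManifold 𝓘(ℂ, E) n M] : IsManifold 𝓘(ℝ, E) n M := by
  apply isManifold_of_contDiffOn
  intro e e' he he'
  have h := (contDiffGroupoid n 𝓘(ℂ, E)).compatible he he'
  rw [contDiffGroupoid, mem_groupoid_of_pregroupoid] at h
  have h1 := h.1
  simp only [contDiffPregroupoid] at h1
  have h2 : ContDiffOn ℝ n _ _ := h1.restrict_scalars ℝ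
  simpa using! h2

/-- The complex structure of a complex manifold, acting on real tangent vectors. (The real tangent
space at `x` is the model space, through the preferred chart at `x`, which is holomorphic.) -/
def tangentJ (x : M) : TangentSpace 𝓘(ℝ, E) x →L[ℝ] TangentSpace 𝓘(ℝ, E) x :=
  (Complex.I • ContinuousLinearMap.id ℝ E : E →L[ℝ] E)

theorem tangentJ_tangentJ (x : M) (v : TangentSpace 𝓘(ℝ, E) x) :
    tangentJ x (tangentJ x v) = -v := by
  have h : ∀ w : E, Complex.I • Complex.I • w = -w := fun w => by
    rw [smul_smul, Complex.I_mul_I, neg_one_smul]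
  exact h v

variable (E M) in
/-- The Riemannian metric is Hermitian, `⟪Jv, Jw⟫ = ⟪v, w⟫`. In complex dimension one this says that
the metric is conformal to (compatible with) the complex structure. -/
def IsHermitianMetric [IsManifold 𝓘(ℝ, E) ∞ M]
    [RiemannianBundle (fun x : M => TangentSpace 𝓘(ℝ, E) x)] : Prop :=
  ∀ (x : M) (v w : TangentSpace 𝓘(ℝ, E) x),
    inner ℝ (tangentJ x v) (tangentJ x w) = (inner ℝ v w : ℝ)

theorem inner_tangentJ_left [IsManifold 𝓘(ℝ, E) ∞ M]
    [RiemannianBundle (fun x : M => TangentSpace 𝓘(ℝ, E) x)]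
    (h : IsHermitianMetric E M) (x : M) (v w : TangentSpace 𝓘(ℝ, E) x) :
    (inner ℝ (tangentJ x v) w : ℝ) = -inner ℝ v (tangentJ x w) := by
  rw [← h x v (tangentJ x w), tangentJ_tangentJ, inner_neg_right, neg_neg]

variable [IsManifold 𝓘(ℂ, E) ω M]

theorem coords_tangentJ (x y : M) (hy : y ∈ (chartAt E x).source) (v : TangentSpace 𝓘(ℝ, E) y) :
    (trivializationAt E (fun y : M => TangentSpace 𝓘(ℝ, E) y) x).continuousLinearMapAt ℝ y
      (tangentJ y v) = Complex.I •
    ((trivializationAt E (fun y : M => TangentSpace 𝓘(ℝ, E) y) x).continuousLinearMapAt ℝ y v : E) := by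
  rw [TangentBundle.continuousLinearMapAt_trivializationAt_eq_core hy]
  have hy' : y ∈ (extChartAt 𝓘(ℝ, E) y).source ∩ (extChartAt 𝓘(ℝ, E) x).source := by
    simpa using hy
  have h1 := hasFDerivWithinAt_tangentCoordChange (I := 𝓘(ℝ, E)) hy'
  have hy2 : y ∈ (extChartAt 𝓘(ℂ, E) y).source ∩ (extChartAt 𝓘(ℂ, E) x).source := by
    simpa using hy
  have h2 := (hasFDerivWithinAt_tangentCoordChange (I := 𝓘(ℂ, E)) hy2).restrictScalars ℝ
  simp only [modelWithCornersSelf_coe, range_id, hasFDerivWithinAt_univ] at h1 h2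
  have h3 := h1.unique h2
  have h4 : ∀ w : E, tangentCoordChange 𝓘(ℝ, E) y x y w = tangentCoordChange 𝓘(ℂ, E) y x y w :=
    fun w => congrArg (fun L : E →L[ℝ] E => L w) h3
  have h5 : ∀ w : E, tangentCoordChange 𝓘(ℝ, E) y x y (Complex.I • w) =
      Complex.I • tangentCoordChange 𝓘(ℝ, E) y x y w := fun w => by rw [h4, h4, map_smul]
  exact h5 v

theorem extend_tangentJ (x y : M) (hy : y ∈ (chartAt E x).source) (u : TangentSpace 𝓘(ℝ, E) x) :
    (FiberBundle.extend E (tangentJ x u) : Π y : M, TangentSpace 𝓘(ℝ, E) y) y =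
      tangentJ y (FiberBundle.extend E u y) := by
  have hb : y ∈ (trivializationAt E (fun y : M => TangentSpace 𝓘(ℝ, E) y) x).baseSet := hy
  rw [extend_eq x y hy, extend_eq x y hy, coords_tangentJ x x (mem_chart_source E x)]
  rw [← Trivialization.symmL_continuousLinearMapAt (R := ℝ) _ hb (tangentJ y _),
    coords_tangentJ x y hy, Trivialization.continuousLinearMapAt_symmL _ hb]

theorem chartDerivative_tangentJ (x : M) {σ : Π y : M, TangentSpace 𝓘(ℝ, E) y}
    (hσ : MDifferentiableAt 𝓘(ℝ, E) 𝓘(ℝ, E).tangent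
      (fun y => (⟨y, σ y⟩ : TangentBundle 𝓘(ℝ, E) M)) x) (v : TangentSpace 𝓘(ℝ, E) x) :
    chartDerivative M (fun y => tangentJ y (σ y)) x v = tangentJ x (chartDerivative M σ x v) := by
  have h : coords x (fun y => tangentJ y (σ y)) =ᶠ[𝓝 x] fun y => Complex.I • coords x σ y := by
    filter_upwards [(chartAt E x).open_source.mem_nhds (mem_chart_source E x)] with y hy
    exact coords_tangentJ x y hy (σ y)
  have hc : HasMFDerivAt 𝓘(ℝ, E) 𝓘(ℝ, E) (coords x σ) x (mfderiv 𝓘(ℝ, E) 𝓘(ℝ, E) (coords x σ) x) :=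
    (mdifferentiableAt_coords hσ).hasMFDerivAt
  have hL : HasMFDerivAt 𝓘(ℝ, E) 𝓘(ℝ, E) (fun w : E => Complex.I • w) (coords x σ x)
      (Complex.I • ContinuousLinearMap.id ℝ E : E →L[ℝ] E) :=
    (Complex.I • ContinuousLinearMap.id ℝ E : E →L[ℝ] E).hasFDerivAt.hasMFDerivAt
  have h1 : mfderiv 𝓘(ℝ, E) 𝓘(ℝ, E) (coords x (fun y => tangentJ y (σ y))) x =
      (Complex.I • ContinuousLinearMap.id ℝ E : E →L[ℝ] E).comp
        (mfderiv 𝓘(ℝ, E) 𝓘(ℝ, E) (coords x σ) x) :=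
    ((hL.comp x hc).congr_of_eventuallyEq h).mfderiv
  have h2 : mvfderiv 𝓘(ℝ, E) (coords x (fun y => tangentJ y (σ y))) x v =
      Complex.I • mvfderiv 𝓘(ℝ, E) (coords x σ) x v :=
    congrArg (fun L : TangentSpace 𝓘(ℝ, E) x →L[ℝ] E => L v) h1
  have hb := FiberBundle.mem_baseSet_trivializationAt' (F := E)
    (E := fun y : M => TangentSpace 𝓘(ℝ, E) y) x
  change (trivializationAt E (fun y : M => TangentSpace 𝓘(ℝ, E) y) x).symmL ℝ x
      (mvfderiv 𝓘(ℝ, E) (coords x (fun y => tangentJ y (σ y))) x v) =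
    tangentJ x ((trivializationAt E (fun y : M => TangentSpace 𝓘(ℝ, E) y) x).symmL ℝ x
      (mvfderiv 𝓘(ℝ, E) (coords x σ) x v))
  rw [h2, ← Trivialization.symmL_continuousLinearMapAt (R := ℝ) _ hb (tangentJ x _),
    coords_tangentJ x x (mem_chart_source E x), Trivialization.continuousLinearMapAt_symmL _ hb]

section Chern

variable [RiemannianBundle (fun x : M => TangentSpace 𝓘(ℝ, E) x)]

theorem metricDeriv_tangentJ_tangentJ (h : IsHermitianMetric E M) (x : M)
    (u w v : TangentSpace 𝓘(ℝ, E) x) :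
    metricDeriv x (tangentJ x u) (tangentJ x w) v = metricDeriv x u w v := by
  have h1 : (fun y => (inner ℝ (FiberBundle.extend E (tangentJ x u) y)
      (FiberBundle.extend E (tangentJ x w) y) : ℝ)) =ᶠ[𝓝 x]
      fun y => inner ℝ (FiberBundle.extend E u y) (FiberBundle.extend E w y) := by
    filter_upwards [(chartAt E x).open_source.mem_nhds (mem_chart_source E x)] with y hy
    rw [extend_tangentJ x y hy, extend_tangentJ x y hy]
    exact h y _ _
  exact congrArg (fun L : TangentSpace 𝓘(ℝ, E) x →L[ℝ] ℝ => L v)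
    (h1.mfderiv_eq (I := 𝓘(ℝ, E)) (I' := 𝓘(ℝ, ℝ)))

variable [IsContMDiffRiemannianBundle 𝓘(ℝ, E) ∞ E (fun x : M => TangentSpace 𝓘(ℝ, E) x)]

theorem metricDeriv_tangentJ_left (h : IsHermitianMetric E M) (x : M)
    (u w v : TangentSpace 𝓘(ℝ, E) x) :
    metricDeriv x (tangentJ x u) w v = -metricDeriv x u (tangentJ x w) v := by
  rw [← metricDeriv_tangentJ_tangentJ h x u (tangentJ x w) v, tangentJ_tangentJ,
    ← neg_one_smul ℝ w, metricDeriv_smul₂]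
  ring

variable [FiniteDimensional ℝ E]

/-- The Christoffel symbols of the Chern connection in holomorphic coordinates, in real notation.
If `H(u, w) = ⟪u, w⟫ + i ⟪u, Jw⟫` is the Hermitian form (complex linear in `u`), then the classical
formula `Γ = ∂H · H⁻¹` reads `H(Γ(v, u), w) = (∂_v H(u, w) - i ∂_{Jv} H(u, w)) / 2`, and its
real part is `⟪Γ(v, u), w⟫ = (∂_v ⟪u, w⟫ + ∂_{Jv} ⟪u, Jw⟫) / 2`. -/
def chernForm (x : M) : TangentSpace 𝓘(ℝ, E) x →ₗ[ℝ] TangentSpace 𝓘(ℝ, E) x →ₗ[ℝ]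
    TangentSpace 𝓘(ℝ, E) x →ₗ[ℝ] ℝ where
  toFun u :=
    { toFun := fun v =>
        { toFun := fun w =>
            (1 / 2 : ℝ) * (metricDeriv x u w v + metricDeriv x u (tangentJ x w) (tangentJ x v))
          map_add' := by
            intros
            simp only [ContinuousLinearMap.map_add, metricDeriv_add₂]; ring
          map_smul' := by
            intros
            simp only [ContinuousLinearMap.map_smul, metricDeriv_smul₂, smul_eq_mul,
              RingHom.id_apply]; ring }
      map_add' := by
        intros; ext
        simp only [ContinuousLinearMap.map_add, metricDeriv_add₃, LinearMap.coe_mk, AddHom.coe_mk,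
          LinearMap.add_apply]; ring
      map_smul' := by
        intros; ext
        simp only [ContinuousLinearMap.map_smul, metricDeriv_smul₃, LinearMap.coe_mk,
          AddHom.coe_mk, LinearMap.smul_apply, smul_eq_mul, RingHom.id_apply]; ring }
  map_add' := by
    intros; ext
    simp only [metricDeriv_add₁, LinearMap.coe_mk, AddHom.coe_mk, LinearMap.add_apply]; ring
  map_smul' := by
    intros; ext
    simp only [metricDeriv_smul₁, LinearMap.coe_mk, AddHom.coe_mk, LinearMap.smul_apply,
      smul_eq_mul, RingHom.id_apply]; ring

variable (M) in
/-- The Chern connection of a Hermitian metric: the connection preserving the metric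
(`chernConnection_isMetricCompatible`) and the complex structure (`chernConnection_tangentJ`) whose
torsion has vanishing `(1,1)`-part (`chernConnection_torsion`). -/
def chernConnection : CovariantDerivative 𝓘(ℝ, E) E (fun x : M => TangentSpace 𝓘(ℝ, E) x) :=
  connectionOfForm chernForm

theorem chernConnection_isMetricCompatible (h : IsHermitianMetric E M) :
    CovariantDerivative.IsMetricCompatible (I := 𝓘(ℝ, E))
      (V := fun x : M => TangentSpace 𝓘(ℝ, E) x) (chernConnection M) := by
  apply isMetricCompatible_connectionOfForm
  intro x u w v
  simp only [chernForm, LinearMap.coe_mk, AddHom.coe_mk]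
  rw [metricDeriv_symm x w u v, metricDeriv_symm x w (tangentJ x u), metricDeriv_tangentJ_left h]
  ring

theorem chernConnection_tangentJ (h : IsHermitianMetric E M) (x : M)
    {σ : Π y : M, TangentSpace 𝓘(ℝ, E) y}
    (hσ : MDifferentiableAt 𝓘(ℝ, E) 𝓘(ℝ, E).tangent
      (fun y => (⟨y, σ y⟩ : TangentBundle 𝓘(ℝ, E) M)) x) (v : TangentSpace 𝓘(ℝ, E) x) :
    chernConnection M (fun y => tangentJ y (σ y)) x v = tangentJ x (chernConnection M σ x v) := by
  have key : ofTrilinear (chernForm x) (tangentJ x (σ x)) v =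
      tangentJ x (ofTrilinear (chernForm x) (σ x) v) := by
    refine ext_inner_right ℝ fun w => ?_
    rw [inner_tangentJ_left h, inner_ofTrilinear, inner_ofTrilinear]
    simp only [chernForm, LinearMap.coe_mk, AddHom.coe_mk]
    rw [metricDeriv_tangentJ_left h, metricDeriv_tangentJ_tangentJ h, tangentJ_tangentJ,
      ← neg_one_smul ℝ w, metricDeriv_smul₂]
    ring
  rw [chernConnection, connectionOfForm_apply, connectionOfForm_apply, chartDerivative_tangentJ x hσ,
    key, ContinuousLinearMap.map_add]

/-- The `(1,1)`-part of the torsion vanishes: extended complex bilinearly, `T(Z, W̄) = 0` for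
`Z = u - i Ju` and `W̄ = v + i Jv`, which is `T(Ju, Jv) = -T(u, v)` for all real `u`, `v`. -/
theorem chernConnection_torsion (h : IsHermitianMetric E M) (x : M)
    (u v : TangentSpace 𝓘(ℝ, E) x) :
    (chernConnection M).torsion x (tangentJ x u) (tangentJ x v) =
      -(chernConnection M).torsion x u v := by
  rw [chernConnection, torsion_connectionOfForm, torsion_connectionOfForm]
  refine ext_inner_right ℝ fun w => ?_
  rw [inner_neg_left, inner_sub_left, inner_sub_left]
  simp only [inner_ofTrilinear]
  simp only [chernForm, LinearMap.coe_mk, AddHom.coe_mk]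
  simp only [metricDeriv_tangentJ_left h, tangentJ_tangentJ, ← neg_one_smul ℝ (_ : TangentSpace 𝓘(ℝ, E) x),
    metricDeriv_smul₂, metricDeriv_smul₃]
  ring

end Chern

end Complex

/-! ### Maps: second fundamental form, Chern-harmonic maps and energy -/

section Maps

variable {E : Type*} [NormedAddCommGroup E] [NormedSpace ℝ E]
  {N : Type*} [TopologicalSpace N] [ChartedSpace E N] [IsManifold 𝓘(ℝ, E) ∞ N]
  {F : Type*} [NormedAddCommGroup F] [NormedSpace ℝ F]
  {M : Type*} [TopologicalSpace M] [ChartedSpace F M] [IsManifold 𝓘(ℝ, F) ∞ M]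

/-- The second fundamental form `∇df`, `(a, b) ↦ (∇_a df)(b)`, of a map `f : N → M` for connections
`D` on `TN` and `D'` on `TM`; here `∇` is the connection on `T*N ⊗ f⁻¹TM` induced by `D` and `D'`.
Extend `b` to a vector field `b̂` with constant components in the chart at `x`. Then
`(∇_a df)(b) = (f⁻¹D')_a (df b̂) - df (D_a b̂)`, and the Leibniz rule for the pull-back connection,
applied to `df b̂ = ∑ᵢ (∂_b̂ fⁱ) (∂ᵢ ∘ f)`, gives
`(f⁻¹D')_a (df b̂) = ∑ᵢ (∂_a ∂_b fⁱ) ∂ᵢ + ∑ᵢ (∂_b fⁱ) D'_{df a} ∂ᵢ`. -/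
def secondFundamentalForm
    (D : CovariantDerivative 𝓘(ℝ, E) E (fun x : N => TangentSpace 𝓘(ℝ, E) x))
    (D' : CovariantDerivative 𝓘(ℝ, F) F (fun y : M => TangentSpace 𝓘(ℝ, F) y))
    (f : N → M) (x : N) (a b : TangentSpace 𝓘(ℝ, E) x) : TangentSpace 𝓘(ℝ, F) (f x) :=
  letI df : TangentSpace 𝓘(ℝ, E) x →L[ℝ] TangentSpace 𝓘(ℝ, F) (f x) :=
    mfderiv 𝓘(ℝ, E) 𝓘(ℝ, F) f x
  letI hess : TangentSpace 𝓘(ℝ, F) (f x) :=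
    fderiv ℝ (fderiv ℝ (writtenInExtChartAt 𝓘(ℝ, E) 𝓘(ℝ, F) x f)) (extChartAt 𝓘(ℝ, E) x x) a b
  hess + D' (FiberBundle.extend F (df b)) (f x) (df a) - df (D (FiberBundle.extend E b) x a)

variable (E F) in
/-- The energy density `e(f) = |df|² / 2`, for a surface `N`. If `φ` is a unitary coframe of `N`,
`ωⁱ` one of `M` and `f^* ωⁱ = aⁱ φ + bⁱ φ̄`, this is `∑ᵢ (|aⁱ|² + |bⁱ|²)`. -/
def energyDensity [FiniteDimensional ℝ E]
    [RiemannianBundle (fun x : N => TangentSpace 𝓘(ℝ, E) x)]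
    [RiemannianBundle (fun y : M => TangentSpace 𝓘(ℝ, F) y)] (f : N → M) (x : N) : ℝ :=
  (1 / 2) * ∑ i, ‖mfderiv 𝓘(ℝ, E) 𝓘(ℝ, F) f x
    (stdOrthonormalBasis ℝ (TangentSpace 𝓘(ℝ, E) x) i)‖ ^ 2

end Maps

section ChernHarmonicMaps

variable {S : Type*} [TopologicalSpace S] [ChartedSpace ℂ S] [IsManifold 𝓘(ℂ, ℂ) ω S]
  [RiemannianBundle (fun x : S => TangentSpace 𝓘(ℝ, ℂ) x)]
  [IsContMDiffRiemannianBundle 𝓘(ℝ, ℂ) ∞ ℂ (fun x : S => TangentSpace 𝓘(ℝ, ℂ) x)]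
  {F : Type*} [NormedAddCommGroup F] [NormedSpace ℂ F] [NormedSpace ℝ F] [IsScalarTower ℝ ℂ F]
  [FiniteDimensional ℝ F]
  {M : Type*} [TopologicalSpace M] [ChartedSpace F M] [IsManifold 𝓘(ℂ, F) ω M]
  [RiemannianBundle (fun y : M => TangentSpace 𝓘(ℝ, F) y)]
  [IsContMDiffRiemannianBundle 𝓘(ℝ, F) ∞ F (fun y : M => TangentSpace 𝓘(ℝ, F) y)]

variable (F) in
/-- A smooth map `f` from a Riemann surface with a conformal metric to a Hermitian manifold is
Chern-harmonic if `tr ∇df = 0`, where `∇` is induced by the Levi-Civita connection of the surface and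
the Chern connection of the target, and the trace is that of the metric of the surface. -/
def IsChernHarmonic (f : S → M) : Prop :=
  ContMDiff 𝓘(ℝ, ℂ) 𝓘(ℝ, F) ∞ f ∧
    ∀ x, ∑ i, secondFundamentalForm (leviCivita (E := ℂ) S) (chernConnection (E := F) M) f x
      (stdOrthonormalBasis ℝ (TangentSpace 𝓘(ℝ, ℂ) x) i)
      (stdOrthonormalBasis ℝ (TangentSpace 𝓘(ℝ, ℂ) x) i) = 0

end ChernHarmonicMaps

section Surfaces

variable {S : Type*} [TopologicalSpace S] [ChartedSpace ℂ S] [IsManifold 𝓘(ℂ, ℂ) ω S]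
  [RiemannianBundle (fun x : S => TangentSpace 𝓘(ℝ, ℂ) x)]

/-- The coordinate vector fields `∂/∂x` (for `u = 1`) and `∂/∂y` (for `u = i`) of the preferred
chart at `p`. -/
def coordField (p : S) (u : ℂ) (y : S) : TangentSpace 𝓘(ℝ, ℂ) y :=
  FiberBundle.extend ℂ (show TangentSpace 𝓘(ℝ, ℂ) p from u) y

/-- The area density `√(g₁₁ g₂₂ - g₁₂²)` in the preferred chart at `p`. -/
def areaDensity (p : S) (z : ℂ) : ℝ :=
  letI y := (chartAt ℂ p).symm z
  √(inner ℝ (coordField p 1 y) (coordField p 1 y) *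
      inner ℝ (coordField p Complex.I y) (coordField p Complex.I y) -
    inner ℝ (coordField p 1 y) (coordField p Complex.I y) ^ 2)

variable (S) in
/-- The area measure `dA` of the metric. Each chart gives a measure on its domain, with density
`√(det g)` in coordinates. These agree on overlaps, and the area measure is their supremum, that is
the measure which restricts to each of them. -/
def areaMeasure [MeasurableSpace S] : Measure S :=
  ⨆ p : S, (((volume : Measure ℂ).restrict (chartAt ℂ p).target).withDensity
    fun z => ENNReal.ofReal (areaDensity p z)).map (chartAt ℂ p).symm

/-- The geodesic disk of radius `R` about `p`, for the Riemannian distance. -/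
def geodesicDisk (p : S) (R : ℝ) : Set S :=
  {x | Manifold.riemannianEDist 𝓘(ℝ, ℂ) p x < ENNReal.ofReal R}

/-- The energy of `f` on `s`, the integral of the energy density with respect to area. -/
def energy [MeasurableSpace S] (F : Type*) [NormedAddCommGroup F] [NormedSpace ℝ F]
    {M : Type*} [TopologicalSpace M] [ChartedSpace F M] [IsManifold 𝓘(ℝ, F) ∞ M]
    [RiemannianBundle (fun y : M => TangentSpace 𝓘(ℝ, F) y)] (f : S → M) (s : Set S) : ℝ :=
  ∫ x in s, energyDensity ℂ F f x ∂(areaMeasure S)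

end Surfaces

end ChernHarmonic

end

/-! The theorem is an ε-regularity estimate for an elliptic equation whose right side is quadratic
in the gradient. In a holomorphic coordinate of Σ and holomorphic coordinates of M the equation
reads Δu + Γ(u_x, u_x) + Γ(u_y, u_y) = 0. The metric of Σ enters only as a factor, since the
Christoffel symbols of a conformal metric have zero trace (`leviCivitaForm_trace`), and the
expression is covariant under holomorphic changes of both coordinates (`flatTension_comp_left`,
`flatTension_comp_right`, `flatTension_eq_zero`). Hence |Δu| ≤ C|du|² (`norm_flatLaplacian_le`),
with C uniform by compactness (`exists_uniform_charts`). The energy density times the conformal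
factor, ε = (|f_x|² + |f_y|²)/2, and its integral do not see the metric of Σ, so the estimate can be
proved on disks in the plane.

The analytic core needs no Bochner formula. The radial derivative of a circle mean of u_x is bounded
by sup|Δu|, up to an angular derivative, which integrates to zero. If ε ≤ 4m on a disk of radius t,
ε = m at its centre and t√m is small, the error s·sup|Δu| is absorbed and the energy of the disk is
at least a constant times mt² (`ofReal_le_lintegral_of_laplacian_le`). On such a disk the image
moves by O(t√m), so it lies in a single chart of M, although nothing is known beforehand about the
continuity of f (`ofReal_le_lintegral_conformalEnergy`). Point picking then removes the assumption ε
≤ 4m: when the total energy is small, ε at the centre is bounded by the energy over R²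
(`mul_sq_le_of_small_energy`).

Comparing coordinate and geodesic disks gives the estimate for radii up to some ρ₀
(`exists_energyDensity_le`), and radii up to a bound D for the diameter of Σ cost only a constant.
For r > D the disk is all of Σ while r² is unbounded, so e(f) has to vanish. This is the gap theorem
`exists_energyDensity_eq_zero`: small energy makes df uniformly small, the image lies in a small
coordinate ball, the squared distance to a point is subharmonic there, and the maximum principle
makes f constant. -/

noncomputable section

namespace ChernHarmonic

/-! ### Circle averages and the Cauchy-Riemann operator -/

section CircleAverages

variable {F : Type*} [NormedAddCommGroup F] [NormedSpace ℂ F] [NormedSpace ℝ F]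
  [IsScalarTower ℝ ℂ F]

/-- Twice the Cauchy-Riemann operator `∂/∂z̄`, applied to a real linear map. -/
def dbar (L : ℂ →L[ℝ] F) : F := L 1 + Complex.I • L Complex.I

omit [NormedSpace ℂ F] [IsScalarTower ℝ ℂ F] in
theorem clm_complex_apply (L : ℂ →L[ℝ] F) (ζ : ℂ) : L ζ = ζ.re • L 1 + ζ.im • L Complex.I := by
  conv_lhs => rw [← Complex.re_add_im ζ]
  rw [map_add, ← map_smul, ← map_smul]
  simp

/-- For ζ = e^{iθ} the direction ζi is tangent to the circle, so a radial derivative is a ∂̄-term up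
to an angular derivative, which disappears on integration. -/
theorem clm_complex_eq_dbar (L : ℂ →L[ℝ] F) (ζ : ℂ) :
    L ζ = (starRingEnd ℂ ζ) • dbar L - Complex.I • L (ζ * Complex.I) := by
  have e : ∀ (x : ℝ) (v : F), x • v = (x : ℂ) • v := fun x v => by
    rw [← smul_one_smul ℂ x v]; simp
  have hc : starRingEnd ℂ ζ = (ζ.re : ℂ) - ζ.im * Complex.I := by
    apply Complex.ext <;> simp
  rw [clm_complex_apply L ζ, clm_complex_apply L (ζ * Complex.I), dbar, hc]
  simp only [e, Complex.mul_re, Complex.mul_im, Complex.I_re, Complex.I_im]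
  simp only [mul_zero, mul_one, zero_sub, add_zero, Complex.ofReal_neg]
  match_scalars
  · ring
  · linear_combination (ζ.im : ℂ) * Complex.I_mul_I

theorem circleMap_mem_ball' {c : ℂ} {s t : ℝ} (hs : |s| < t) (θ : ℝ) :
    circleMap c s θ ∈ Metric.ball c t := by
  rw [Metric.mem_ball, Complex.dist_eq]; simpa [circleMap] using hs

theorem continuous_circleMap_uncurry (c : ℂ) :
    Continuous (fun p : ℝ × ℝ => circleMap c p.1 p.2) := by
  unfold circleMap; fun_prop

theorem hasDerivAt_circleMap_radius (c : ℂ) (s θ : ℝ) :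
    HasDerivAt (fun s : ℝ => circleMap c s θ) (circleMap 0 1 θ) s := by
  have h : HasDerivAt (fun s : ℝ => (s : ℂ)) 1 s := Complex.ofRealCLM.hasDerivAt
  have := (h.mul_const (Complex.exp (θ * Complex.I))).const_add c
  simpa [circleMap] using this

-- Differentiation under the integral sign. The radius is signed, so that s = 0 is an interior
-- point.
omit [NormedSpace ℂ F] [IsScalarTower ℝ ℂ F] in
theorem hasDerivAt_integral_circle {W : ℂ → F} {W' : ℂ → ℂ →L[ℝ] F} {c : ℂ} {t s : ℝ}
    (hW : ∀ z ∈ Metric.ball c t, HasFDerivAt W (W' z) z)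
    (hW' : ContinuousOn W' (Metric.ball c t)) (hs : |s| < t) :
    HasDerivAt (fun s => ∫ θ in (0 : ℝ)..2 * Real.pi, W (circleMap c s θ))
      (∫ θ in (0 : ℝ)..2 * Real.pi, W' (circleMap c s θ) (circleMap 0 1 θ)) s := by
  obtain ⟨r, hsr, hrt⟩ := exists_between hs
  have hcb : IsCompact (Metric.closedBall c r) := isCompact_closedBall c r
  have hsub : Metric.closedBall c r ⊆ Metric.ball c t := Metric.closedBall_subset_ball hrt
  obtain ⟨K, hK⟩ := hcb.exists_bound_of_continuousOn (hW'.mono hsub)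
  have hnear : {x : ℝ | |x| < r} ∈ 𝓝 s :=
    (isOpen_lt continuous_abs continuous_const).mem_nhds hsr
  have hWc : ContinuousOn W (Metric.ball c t) := fun z hz =>
    (hW z hz).continuousAt.continuousWithinAt
  have hcont : ∀ x : ℝ, |x| < r → Continuous (fun θ => W (circleMap c x θ)) := fun x hx =>
    hWc.comp_continuous (continuous_circleMap c x) fun θ => circleMap_mem_ball' (hx.trans hrt) θ
  have hcont' : Continuous (fun θ => W' (circleMap c s θ) (circleMap 0 1 θ)) :=
    (hW'.comp_continuous (continuous_circleMap c s) fun θ =>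
      circleMap_mem_ball' hs θ).clm_apply (continuous_circleMap 0 1)
  refine (intervalIntegral.hasDerivAt_integral_of_dominated_loc_of_deriv_le (bound := fun _ => K)
    (F' := fun x θ => W' (circleMap c x θ) (circleMap 0 1 θ)) hnear ?_ ?_ ?_ ?_ ?_ ?_).2
  · filter_upwards [hnear] with x hx
    exact (hcont x hx).aestronglyMeasurable
  · exact (hcont s hsr).intervalIntegrable _ _
  · exact hcont'.aestronglyMeasurable
  · refine Filter.Eventually.of_forall fun θ _ x hx => ?_
    have h1 := hK _ (Metric.ball_subset_closedBall (circleMap_mem_ball' hx θ))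
    refine ((W' (circleMap c x θ)).le_opNorm _).trans ?_
    simpa [circleMap] using h1
  · exact intervalIntegrable_const
  · refine Filter.Eventually.of_forall fun θ _ x hx => ?_
    exact (hW _ (circleMap_mem_ball' (lt_trans hx hrt) θ)).comp_hasDerivAt x
      (hasDerivAt_circleMap_radius c x θ)

-- For s ≠ 0, s times the integrand is the θ-derivative of the periodic function W(c + se^{iθ}). At
-- s = 0 this says nothing, but there the integrand is the θ-derivative of W'(c)(e^{iθ}).
omit [NormedSpace ℂ F] [IsScalarTower ℝ ℂ F] in
theorem integral_circle_angular [CompleteSpace F] {W : ℂ → F} {W' : ℂ → ℂ →L[ℝ] F} {c : ℂ}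
    {t s : ℝ}
    (hW : ∀ z ∈ Metric.ball c t, HasFDerivAt W (W' z) z)
    (hW' : ContinuousOn W' (Metric.ball c t)) (hs : |s| < t) :
    ∫ θ in (0 : ℝ)..2 * Real.pi, W' (circleMap c s θ) (circleMap 0 1 θ * Complex.I) = 0 := by
  have hcont : Continuous (fun θ => W' (circleMap c s θ) (circleMap 0 1 θ * Complex.I)) :=
    (hW'.comp_continuous (continuous_circleMap c s) fun θ =>
      circleMap_mem_ball' hs θ).clm_apply ((continuous_circleMap 0 1).mul continuous_const)
  rcases eq_or_ne s 0 with rfl | h0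
  · have e : ∀ θ, circleMap c 0 θ = c := fun θ => by simp [circleMap]
    simp only [e]
    rw [intervalIntegral.integral_eq_sub_of_hasDerivAt (f := fun θ => W' c (circleMap 0 1 θ))]
    · simp [circleMap, Complex.exp_two_pi_mul_I]
    · intro θ _
      exact (W' c).hasFDerivAt.comp_hasDerivAt θ (hasDerivAt_circleMap 0 1 θ)
    · simpa only [e] using hcont.intervalIntegrable 0 (2 * Real.pi)
  · have h : ∫ θ in (0 : ℝ)..2 * Real.pi,
        s • W' (circleMap c s θ) (circleMap 0 1 θ * Complex.I) = 0 := by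
      rw [intervalIntegral.integral_eq_sub_of_hasDerivAt (f := fun θ => W (circleMap c s θ))]
      · simp [circleMap, Complex.exp_two_pi_mul_I]
      · intro θ _
        have := (hW _ (circleMap_mem_ball' hs θ)).comp_hasDerivAt θ (hasDerivAt_circleMap c s θ)
        have e2 : circleMap 0 s θ * Complex.I = s • (circleMap 0 1 θ * Complex.I) := by
          simp [circleMap, mul_assoc]
        rwa [e2, map_smul] at this
      · exact (hcont.const_smul s).intervalIntegrable 0 (2 * Real.pi)
    rw [intervalIntegral.integral_smul, smul_eq_zero] at h
    exact h.resolve_left h0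

/-- The radial derivative of the circle integral of `W` is given by `∂W/∂z̄`. -/
theorem hasDerivAt_integral_circle_dbar [CompleteSpace F] {W : ℂ → F} {W' : ℂ → ℂ →L[ℝ] F} {c : ℂ}
    {t s : ℝ}
    (hW : ∀ z ∈ Metric.ball c t, HasFDerivAt W (W' z) z)
    (hW' : ContinuousOn W' (Metric.ball c t)) (hs : |s| < t) :
    HasDerivAt (fun s => ∫ θ in (0 : ℝ)..2 * Real.pi, W (circleMap c s θ))
      (∫ θ in (0 : ℝ)..2 * Real.pi,
        (starRingEnd ℂ (circleMap 0 1 θ)) • dbar (W' (circleMap c s θ))) s := by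
  convert hasDerivAt_integral_circle hW hW' hs using 1
  have hc := hW'.comp_continuous (continuous_circleMap c s) fun θ => circleMap_mem_ball' hs θ
  have hcont : Continuous (fun θ => W' (circleMap c s θ) (circleMap 0 1 θ * Complex.I)) :=
    hc.clm_apply ((continuous_circleMap 0 1).mul continuous_const)
  have hcont2 : Continuous fun θ =>
      (starRingEnd ℂ (circleMap 0 1 θ)) • dbar (W' (circleMap c s θ)) := by
    refine (Complex.continuous_conj.comp (continuous_circleMap 0 1)).smul ?_
    exact (hc.clm_apply continuous_const).add ((hc.clm_apply continuous_const).const_smul _)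
  have h : ∀ θ, W' (circleMap c s θ) (circleMap 0 1 θ) =
      (starRingEnd ℂ (circleMap 0 1 θ)) • dbar (W' (circleMap c s θ)) -
        Complex.I • W' (circleMap c s θ) (circleMap 0 1 θ * Complex.I) :=
    fun θ => clm_complex_eq_dbar _ _
  simp only [h]
  have hcont3 : Continuous fun θ =>
      Complex.I • W' (circleMap c s θ) (circleMap 0 1 θ * Complex.I) := hcont.const_smul _
  rw [intervalIntegral.integral_sub (hcont2.intervalIntegrable _ _)
    (hcont3.intervalIntegrable _ _), intervalIntegral.integral_smul,
    integral_circle_angular hW hW' hs, smul_zero, sub_zero]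

omit [NormedSpace ℂ F] [IsScalarTower ℝ ℂ F] in
/-- If the radial derivatives of `W` differ by at most `B` from angular derivatives of another
function, then the value of `W` at the centre is close to its circle averages. -/
theorem norm_le_integral_circle_add [CompleteSpace F] {W V : ℂ → F} {W' V' : ℂ → ℂ →L[ℝ] F} {c : ℂ}
    {t s B : ℝ}
    (hW : ∀ z ∈ Metric.ball c t, HasFDerivAt W (W' z) z)
    (hW' : ContinuousOn W' (Metric.ball c t))
    (hV : ∀ z ∈ Metric.ball c t, HasFDerivAt V (V' z) z)
    (hV' : ContinuousOn V' (Metric.ball c t))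
    (hB : ∀ z ∈ Metric.ball c t, ∀ ζ : ℂ, ‖ζ‖ = 1 → ‖W' z ζ - V' z (ζ * Complex.I)‖ ≤ B)
    (hs0 : 0 ≤ s) (hs : s < t) :
    2 * Real.pi * ‖W c‖ ≤
      (∫ θ in (0 : ℝ)..2 * Real.pi, ‖W (circleMap c s θ)‖) + 2 * Real.pi * B * s := by
  have hlt : ∀ x ∈ Icc 0 s, |x| < t := fun x hx => by
    rw [abs_of_nonneg hx.1]; exact hx.2.trans_lt hs
  have h := norm_image_sub_le_of_norm_deriv_le_segment' (C := 2 * Real.pi * B)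
    (fun x hx => (hasDerivAt_integral_circle hW hW' (hlt x hx)).hasDerivWithinAt) (by
      intro x hx
      have hx' := hlt x (Ico_subset_Icc_self hx)
      have hcW : Continuous fun θ => W' (circleMap c x θ) (circleMap 0 1 θ) :=
        (hW'.comp_continuous (continuous_circleMap c x) fun θ =>
          circleMap_mem_ball' hx' θ).clm_apply (continuous_circleMap 0 1)
      have hcV : Continuous fun θ => V' (circleMap c x θ) (circleMap 0 1 θ * Complex.I) :=
        (hV'.comp_continuous (continuous_circleMap c x) fun θ =>
          circleMap_mem_ball' hx' θ).clm_apply ((continuous_circleMap 0 1).mul continuous_const)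
      -- The angular term of V may be subtracted because its circle integral is zero.
      have := intervalIntegral.norm_integral_le_of_norm_le_const (a := (0 : ℝ))
        (b := 2 * Real.pi) (C := B) (f := fun θ => W' (circleMap c x θ) (circleMap 0 1 θ) -
          V' (circleMap c x θ) (circleMap 0 1 θ * Complex.I))
        fun θ _ => hB _ (circleMap_mem_ball' hx' θ) _ (by simp [circleMap])
      rw [intervalIntegral.integral_sub (hcW.intervalIntegrable _ _) (hcV.intervalIntegrable _ _),
        integral_circle_angular hV hV' hx', sub_zero, sub_zero, abs_of_pos Real.two_pi_pos] at this
      linarith) s (right_mem_Icc.2 hs0)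
  have e : ∀ θ, circleMap c 0 θ = c := fun θ => by simp [circleMap]
  simp only [e, intervalIntegral.integral_const, sub_zero] at h
  have h2 : ‖(2 * Real.pi) • W c‖ = 2 * Real.pi * ‖W c‖ := by
    rw [norm_smul, Real.norm_of_nonneg Real.two_pi_pos.le]
  have h3 : ‖∫ θ in (0 : ℝ)..2 * Real.pi, W (circleMap c s θ)‖ ≤
      ∫ θ in (0 : ℝ)..2 * Real.pi, ‖W (circleMap c s θ)‖ :=
    intervalIntegral.norm_integral_le_integral_norm Real.two_pi_pos.le
  have h4 := norm_sub_norm_le ((2 * Real.pi) • W c) (∫ θ in (0 : ℝ)..2 * Real.pi, W (circleMap c s θ))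
  rw [norm_sub_rev] at h4
  linarith

end CircleAverages

/-! ### Subharmonic functions in the plane and the maximum principle -/

section MaximumPrinciple

/-- The circle integrals of a subharmonic function of class `C²` are at least the value at the
centre. -/
theorem le_integral_circle_of_laplacian_nonneg {h : ℂ → ℝ} {c : ℂ} {t s : ℝ}
    (hh : ContDiffOn ℝ 2 h (Metric.ball c t))
    (hΔ : ∀ z ∈ Metric.ball c t, 0 ≤ fderiv ℝ (fderiv ℝ h) z 1 1 +
      fderiv ℝ (fderiv ℝ h) z Complex.I Complex.I)
    (hs0 : 0 ≤ s) (hs : s < t) :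
    2 * Real.pi * h c ≤ ∫ θ in (0 : ℝ)..2 * Real.pi, h (circleMap c s θ) := by
  have ho : IsOpen (Metric.ball c t) := Metric.isOpen_ball
  have hh1 : ContDiffOn ℝ 1 (fderiv ℝ h) (Metric.ball c t) := hh.fderiv_of_isOpen ho (by norm_num)
  have hd0 : ∀ z ∈ Metric.ball c t, HasFDerivAt h (fderiv ℝ h z) z := fun z hz =>
    ((hh.differentiableOn (by norm_num)).differentiableAt (ho.mem_nhds hz)).hasFDerivAt
  have hd1 : ∀ z ∈ Metric.ball c t,
      HasFDerivAt (fderiv ℝ h) (fderiv ℝ (fderiv ℝ h) z) z := fun z hz =>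
    ((hh1.differentiableOn (by norm_num)).differentiableAt (ho.mem_nhds hz)).hasFDerivAt
  have hc1 : ContinuousOn (fderiv ℝ h) (Metric.ball c t) := hh1.continuousOn
  have hc2 : ContinuousOn (fderiv ℝ (fderiv ℝ h)) (Metric.ball c t) :=
    hh1.continuousOn_fderiv_of_isOpen ho le_rfl
  -- G(dh) = h_x − i h_y = 2 ∂h/∂z and W = (z − c) G(dh). Since z − c is holomorphic, `dbar` of W is
  -- z − c times a factor with real part Δh. Thus the circle integral of Re W is nondecreasing in
  -- the radius and starts at 0.
  let G : (ℂ →L[ℝ] ℝ) →L[ℝ] ℂ :=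
    Complex.ofRealCLM ∘L ContinuousLinearMap.apply ℝ ℝ (1 : ℂ) -
      (Complex.I • Complex.ofRealCLM) ∘L ContinuousLinearMap.apply ℝ ℝ Complex.I
  have hG : ∀ L : ℂ →L[ℝ] ℝ, G L = (L 1 : ℂ) - Complex.I * (L Complex.I : ℂ) := fun L => rfl
  let W : ℂ → ℂ := fun z => (z - c) * G (fderiv ℝ h z)
  let W' : ℂ → ℂ →L[ℝ] ℂ := fun z =>
    (z - c) • (G ∘L fderiv ℝ (fderiv ℝ h) z) + G (fderiv ℝ h z) • ContinuousLinearMap.id ℝ ℂ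
  have hW : ∀ z ∈ Metric.ball c t, HasFDerivAt W (W' z) z := fun z hz => by
    have h1 : HasFDerivAt (fun z : ℂ => z - c) (ContinuousLinearMap.id ℝ ℂ) z :=
      (hasFDerivAt_id z).sub_const c
    have h2 : HasFDerivAt (fun z => G (fderiv ℝ h z)) (G ∘L fderiv ℝ (fderiv ℝ h) z) z :=
      G.hasFDerivAt.comp z (hd1 z hz)
    refine (h1.mul h2).congr_fderiv ?_
    ext v; simp [W', mul_comm]
  have hW' : ContinuousOn W' (Metric.ball c t) := by
    refine ((continuousOn_id.sub continuousOn_const).smul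
      (continuousOn_const.clm_comp hc2)).add ?_
    exact (G.continuous.comp_continuousOn hc1).smul continuousOn_const
  have hdb : ∀ z, dbar (W' z) = (z - c) * (dbar (G ∘L fderiv ℝ (fderiv ℝ h) z)) := fun z => by
    simp only [dbar, W', _root_.add_apply, _root_.smul_apply, ContinuousLinearMap.id_apply, smul_eq_mul]
    linear_combination (G (fderiv ℝ h z)) * Complex.I_mul_I
  have hdb2 : ∀ z, (dbar (G ∘L fderiv ℝ (fderiv ℝ h) z)).re =
      fderiv ℝ (fderiv ℝ h) z 1 1 + fderiv ℝ (fderiv ℝ h) z Complex.I Complex.I := fun z => by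
    simp [dbar, hG]
  have hQd : ∀ x : ℝ, |x| < t → HasDerivAt
      (fun s => (∫ θ in (0 : ℝ)..2 * Real.pi, W (circleMap c s θ)).re) _ x := fun x hx =>
    Complex.reCLM.hasFDerivAt.comp_hasDerivAt x (hasDerivAt_integral_circle_dbar hW hW' hx)
  have hQ : ∀ x, 0 ≤ x → x < t → 0 ≤ (∫ θ in (0 : ℝ)..2 * Real.pi, W (circleMap c x θ)).re := by
    intro x hx0 hxt
    have hlt : ∀ y ∈ Icc 0 x, |y| < t := fun y hy => by
      rw [abs_of_nonneg hy.1]; exact hy.2.trans_lt hxt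
    have hmono : MonotoneOn
        (fun s => (∫ θ in (0 : ℝ)..2 * Real.pi, W (circleMap c s θ)).re) (Icc 0 x) := by
      apply monotoneOn_of_deriv_nonneg (convex_Icc 0 x)
      · exact fun y hy => (hQd y (hlt y hy)).continuousAt.continuousWithinAt
      · exact fun y hy => (hQd y (hlt y (interior_subset hy))).differentiableAt.differentiableWithinAt
      · intro y hy
        have hy' := interior_subset hy
        rw [(hQd y (hlt y hy')).deriv]
        have hcont : Continuous fun θ => (starRingEnd ℂ (circleMap 0 1 θ)) •
            dbar (W' (circleMap c y θ)) := by
          have hc : Continuous fun θ => W' (circleMap c y θ) :=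
            hW'.comp_continuous (continuous_circleMap c y) fun θ =>
            circleMap_mem_ball' (hlt y hy') θ
          have hc3 : Continuous fun θ => Complex.I • W' (circleMap c y θ) Complex.I :=
            Continuous.const_smul (hc.clm_apply continuous_const) Complex.I
          exact (Complex.continuous_conj.comp (continuous_circleMap 0 1)).smul
            ((hc.clm_apply continuous_const).add hc3)
        rw [← ContinuousLinearMap.intervalIntegral_comp_comm _ (hcont.intervalIntegrable _ _)]
        refine intervalIntegral.integral_nonneg Real.two_pi_pos.le fun θ _ => ?_
        have e : starRingEnd ℂ (circleMap 0 1 θ) • dbar (W' (circleMap c y θ)) =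
            (y : ℂ) * dbar (G ∘L fderiv ℝ (fderiv ℝ h) (circleMap c y θ)) := by
          rw [hdb, smul_eq_mul, ← mul_assoc]
          congr 1
          have h1 : circleMap c y θ - c = y * circleMap 0 1 θ := by simp [circleMap]
          have h2 : starRingEnd ℂ (circleMap 0 1 θ) * circleMap 0 1 θ = 1 := by
            rw [mul_comm, Complex.mul_conj, Complex.normSq_eq_norm_sq]; simp
          rw [h1]
          linear_combination (y : ℂ) * h2
        rw [e, Complex.reCLM_apply, Complex.re_ofReal_mul, hdb2]
        exact mul_nonneg hy'.1 (hΔ _ (circleMap_mem_ball' (hlt y hy') θ))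
    have h0 := hmono (left_mem_Icc.2 hx0) (right_mem_Icc.2 hx0) hx0
    have e : ∀ θ, circleMap c 0 θ = c := fun θ => by simp [circleMap]
    simpa [e, W] using h0
  have hHd : ∀ x : ℝ, |x| < t → HasDerivAt
      (fun s => ∫ θ in (0 : ℝ)..2 * Real.pi, h (circleMap c s θ)) _ x := fun x hx =>
    hasDerivAt_integral_circle hd0 hc1 hx
  have hlt : ∀ y ∈ Icc 0 s, |y| < t := fun y hy => by
    rw [abs_of_nonneg hy.1]; exact hy.2.trans_lt hs
  have hmono : MonotoneOn
      (fun s => ∫ θ in (0 : ℝ)..2 * Real.pi, h (circleMap c s θ)) (Icc 0 s) := by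
    apply monotoneOn_of_deriv_nonneg (convex_Icc 0 s)
    · exact fun y hy => (hHd y (hlt y hy)).continuousAt.continuousWithinAt
    · exact fun y hy => (hHd y (hlt y (interior_subset hy))).differentiableAt.differentiableWithinAt
    · intro y hy
      have hy' := interior_subset hy
      rw [interior_Icc] at hy
      rw [(hHd y (hlt y hy')).deriv]
      have hWc : Continuous fun θ => W (circleMap c y θ) :=
        ContinuousOn.comp_continuous (fun z hz => (hW z hz).continuousAt.continuousWithinAt)
          (continuous_circleMap c y) fun θ => circleMap_mem_ball' (hlt y hy') θ
      -- On the circle of radius y, Re W is y times the radial derivative of h.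
      have h1 : (∫ θ in (0 : ℝ)..2 * Real.pi, W (circleMap c y θ)).re =
          y * ∫ θ in (0 : ℝ)..2 * Real.pi, fderiv ℝ h (circleMap c y θ) (circleMap 0 1 θ) := by
        rw [← intervalIntegral.integral_const_mul, ← Complex.reCLM_apply,
          ← ContinuousLinearMap.intervalIntegral_comp_comm _ (hWc.intervalIntegrable _ _)]
        refine intervalIntegral.integral_congr fun θ _ => ?_
        have h1 : circleMap c y θ - c = y * circleMap 0 1 θ := by simp [circleMap]
        simp only [W, h1, hG, Complex.reCLM_apply, mul_assoc, Complex.re_ofReal_mul]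
        rw [clm_complex_apply (fderiv ℝ h (circleMap c y θ)) (circleMap 0 1 θ)]
        simp
      have h2 := hQ y hy'.1 (hy'.2.trans_lt hs)
      rw [h1] at h2
      exact nonneg_of_mul_nonneg_right h2 hy.1
  have h0 := hmono (left_mem_Icc.2 hs0) (right_mem_Icc.2 hs0) hs0
  have e : ∀ θ, circleMap c 0 θ = c := fun θ => by simp [circleMap]
  simpa [e] using h0

/-- The strong maximum principle on a disk, for a maximum at the centre. -/
theorem eq_of_laplacian_nonneg_of_max {h : ℂ → ℝ} {c : ℂ} {t : ℝ}
    (hh : ContDiffOn ℝ 2 h (Metric.ball c t))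
    (hΔ : ∀ z ∈ Metric.ball c t, 0 ≤ fderiv ℝ (fderiv ℝ h) z 1 1 +
      fderiv ℝ (fderiv ℝ h) z Complex.I Complex.I)
    (hmax : ∀ z ∈ Metric.ball c t, h z ≤ h c) {z : ℂ} (hz : z ∈ Metric.ball c t) : h z = h c := by
  by_contra hne
  have hlt := lt_of_le_of_ne (hmax z hz) hne
  have hs : ‖z - c‖ < t := by rwa [Metric.mem_ball, Complex.dist_eq] at hz
  have hm := le_integral_circle_of_laplacian_nonneg hh hΔ (norm_nonneg _) hs
  have habs : |‖z - c‖| < t := by rwa [abs_norm]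
  have hcont : Continuous fun θ => h (circleMap c ‖z - c‖ θ) :=
    hh.continuousOn.comp_continuous (continuous_circleMap c _) fun θ => circleMap_mem_ball' habs θ
  have hlt2 := intervalIntegral.integral_lt_integral_of_continuousOn_of_le_of_exists_lt
    (f := fun θ => h (circleMap c ‖z - c‖ θ)) (g := fun _ => h c) Real.two_pi_pos
    hcont.continuousOn continuousOn_const
    (fun θ _ => hmax _ (circleMap_mem_ball' habs θ)) (by
      obtain ⟨θ, hθ, h2⟩ := (image_circleMap_Ioc c ‖z - c‖).symm ▸
        (show z ∈ Metric.sphere c |‖z - c‖| by simp)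
      exact ⟨θ, Ioc_subset_Icc_self hθ, by simpa [h2] using hlt⟩)
  simp only [intervalIntegral.integral_const, sub_zero, smul_eq_mul] at hlt2
  linarith

end MaximumPrinciple

/-! ### From circle integrals to disk integrals -/

section Polar

/-- A lower bound for circle integrals gives one for the integral over the disk. -/
theorem ofReal_le_lintegral_ball {g : ℂ → ℝ} {c : ℂ} {t κ : ℝ} (ht : 0 < t)
    (hg : ContinuousOn g (Metric.ball c t)) (hg0 : ∀ z ∈ Metric.ball c t, 0 ≤ g z)
    (hκ : ∀ s, 0 < s → s < t → κ ≤ ∫ θ in (0 : ℝ)..2 * Real.pi, g (circleMap c s θ)) :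
    ENNReal.ofReal (κ * (t ^ 2 / 2)) ≤ ∫⁻ z in Metric.ball c t, ENNReal.ofReal (g z) := by
  have hmeas : Measurable ((Metric.ball c t).indicator fun z => ENNReal.ofReal (g z)) := by
    classical
    have h1 := (hg.measurable_piecewise (g := fun _ => (0 : ℝ)) continuousOn_const
      Metric.isOpen_ball.measurableSet).ennreal_ofReal
    convert h1 using 1
    funext z
    by_cases hz : z ∈ Metric.ball c t <;> simp [hz]
  set G := (Metric.ball c t).indicator fun z => ENNReal.ofReal (g z) with hG
  have h1 : ∫⁻ z in Metric.ball c t, ENNReal.ofReal (g z) = ∫⁻ z, G (c + z) := by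
    rw [lintegral_add_left_eq_self (μ := (volume : Measure ℂ)) G c, hG,
      lintegral_indicator Metric.isOpen_ball.measurableSet]
  have hps : ∀ s θ : ℝ, c + Complex.polarCoord.symm (s, θ) = circleMap c s θ := fun s θ => by
    rw [Complex.polarCoord_symm_apply, circleMap, Complex.exp_mul_I]; simp
  have hm2 : Measurable fun p : ℝ × ℝ => ENNReal.ofReal p.1 • G (circleMap c p.1 p.2) :=
    measurable_fst.ennreal_ofReal.mul (hmeas.comp (continuous_circleMap_uncurry c).measurable)
  rw [h1, ← Complex.lintegral_comp_polarCoord_symm]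
  have h2 : ∀ p : ℝ × ℝ, ENNReal.ofReal p.1 • G (c + Complex.polarCoord.symm p) =
      ENNReal.ofReal p.1 • G (circleMap c p.1 p.2) := fun p => by rw [← hps]
  simp only [h2]
  rw [polarCoord_target, Measure.volume_eq_prod, ← Measure.prod_restrict,
    lintegral_prod _ hm2.aemeasurable]
  have hs : ∀ s ∈ Ioo 0 t, ENNReal.ofReal (s * κ) ≤
      ∫⁻ θ in Ioo (-Real.pi) Real.pi, ENNReal.ofReal s • G (circleMap c s θ) := by
    intro s hs
    have habs : |s| < t := by rw [abs_of_pos hs.1]; exact hs.2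
    have hmem : ∀ θ, circleMap c s θ ∈ Metric.ball c t := fun θ => circleMap_mem_ball' habs θ
    have hcont : Continuous fun θ => g (circleMap c s θ) :=
      hg.comp_continuous (continuous_circleMap c s) hmem
    have e : ∀ θ, G (circleMap c s θ) = ENNReal.ofReal (g (circleMap c s θ)) := fun θ =>
      indicator_of_mem (hmem θ) _
    simp only [e, smul_eq_mul]
    rw [lintegral_const_mul _ hcont.measurable.ennreal_ofReal, ENNReal.ofReal_mul hs.1.le]
    gcongr
    -- Polar coordinates use angles in (−π, π), the hypothesis uses (0, 2π).
    have hper : Function.Periodic (fun θ => g (circleMap c s θ)) (2 * Real.pi) := fun θ => by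
      simp only [periodic_circleMap c s θ]
    have h3 := hper.intervalIntegral_add_eq 0 (-Real.pi)
    rw [zero_add, show -Real.pi + 2 * Real.pi = Real.pi by ring] at h3
    refine (ENNReal.ofReal_le_ofReal (hκ s hs.1 hs.2)).trans ?_
    rw [h3, intervalIntegral.integral_of_le (by linarith [Real.pi_pos]),
      integral_Ioc_eq_integral_Ioo, ofReal_integral_eq_lintegral_ofReal]
    · exact (hcont.integrableOn_Icc).mono_set Ioo_subset_Icc_self
    · exact Filter.Eventually.of_forall fun θ => hg0 _ (hmem θ)
  calc ENNReal.ofReal (κ * (t ^ 2 / 2)) ≤ ∫⁻ s in Ioo 0 t, ENNReal.ofReal (s * κ) := by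
        by_cases hk : 0 ≤ κ
        · rw [← ofReal_integral_eq_lintegral_ofReal, ← integral_Ioc_eq_integral_Ioo,
            ← intervalIntegral.integral_of_le ht.le, intervalIntegral.integral_mul_const,
            integral_id]
          · apply le_of_eq; congr 1; ring
          · exact ((continuous_id.mul continuous_const).integrableOn_Icc).mono_set
              Ioo_subset_Icc_self
          · filter_upwards [ae_restrict_mem measurableSet_Ioo] with s hs
            exact mul_nonneg hs.1.le hk
        · rw [ENNReal.ofReal_of_nonpos (by nlinarith [sq_nonneg t])]
          exact bot_le
    _ ≤ ∫⁻ s in Ioo 0 t, ∫⁻ θ in Ioo (-Real.pi) Real.pi,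
          ENNReal.ofReal s • G (circleMap c s θ) := setLIntegral_mono' measurableSet_Ioo hs
    _ ≤ _ := lintegral_mono_set Ioo_subset_Ioi_self

end Polar

/-! ### Mean value inequality for the gradient when |Δu| ≤ C|du|² -/

section GradientEstimate

variable {F : Type*} [NormedAddCommGroup F] [NormedSpace ℝ F]

/-- The flat Laplacian of a function on the plane. -/
def flatLaplacian (u : ℂ → F) (z : ℂ) : F :=
  fderiv ℝ (fderiv ℝ u) z 1 1 + fderiv ℝ (fderiv ℝ u) z Complex.I Complex.I

/-- The derivative of u_x in a direction ζ is (Re ζ)Δu plus the derivative of −u_y in the direction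
ζi, and that of u_y is (Im ζ)Δu plus the derivative of u_x in the direction ζi. So the error
involves Δu only, not the full second derivative. -/
theorem norm_fderiv_le_integral_circle [CompleteSpace F] {u : ℂ → F} {c : ℂ} {t s B : ℝ}
    (hu : ContDiffOn ℝ 2 u (Metric.ball c t))
    (hB : ∀ z ∈ Metric.ball c t, ‖flatLaplacian u z‖ ≤ B) (hs0 : 0 ≤ s) (hs : s < t) :
    2 * Real.pi * ‖fderiv ℝ u c 1‖ ≤
      (∫ θ in (0 : ℝ)..2 * Real.pi, ‖fderiv ℝ u (circleMap c s θ) 1‖) + 2 * Real.pi * B * s ∧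
    2 * Real.pi * ‖fderiv ℝ u c Complex.I‖ ≤
      (∫ θ in (0 : ℝ)..2 * Real.pi, ‖fderiv ℝ u (circleMap c s θ) Complex.I‖) +
        2 * Real.pi * B * s := by
  have ho : IsOpen (Metric.ball c t) := Metric.isOpen_ball
  have hh1 : ContDiffOn ℝ 1 (fderiv ℝ u) (Metric.ball c t) := hu.fderiv_of_isOpen ho (by norm_num)
  have hd1 : ∀ z ∈ Metric.ball c t,
      HasFDerivAt (fderiv ℝ u) (fderiv ℝ (fderiv ℝ u) z) z := fun z hz =>
    ((hh1.differentiableOn (by norm_num)).differentiableAt (ho.mem_nhds hz)).hasFDerivAt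
  have hc2 : ContinuousOn (fderiv ℝ (fderiv ℝ u)) (Metric.ball c t) :=
    hh1.continuousOn_fderiv_of_isOpen ho le_rfl
  have hsymm : ∀ z ∈ Metric.ball c t, ∀ a b, fderiv ℝ (fderiv ℝ u) z a b =
      fderiv ℝ (fderiv ℝ u) z b a := fun z hz =>
    (hu.contDiffAt (ho.mem_nhds hz)).isSymmSndFDerivAt (by simp)
  let P : ℂ → (ℂ →L[ℝ] F) →L[ℝ] F := fun e => ContinuousLinearMap.apply ℝ F e
  have hP : ∀ e, ∀ z ∈ Metric.ball c t,
      HasFDerivAt (fun z => fderiv ℝ u z e) (P e ∘L fderiv ℝ (fderiv ℝ u) z) z := fun e z hz =>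
    (P e).hasFDerivAt.comp z (hd1 z hz)
  have hPc : ∀ e, ContinuousOn (fun z => P e ∘L fderiv ℝ (fderiv ℝ u) z) (Metric.ball c t) :=
    fun e => continuousOn_const.clm_comp hc2
  have hPa : ∀ e z ζ, (P e ∘L fderiv ℝ (fderiv ℝ u) z) ζ = fderiv ℝ (fderiv ℝ u) z ζ e :=
    fun _ _ _ => rfl
  constructor
  · refine norm_le_integral_circle_add (V := fun z => -fderiv ℝ u z Complex.I)
      (V' := fun z => -(P Complex.I ∘L fderiv ℝ (fderiv ℝ u) z)) (hP 1) (hPc 1)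
      (fun z hz => (hP Complex.I z hz).neg) (hPc Complex.I).neg ?_ hs0 hs
    intro z hz ζ hζ
    have e : (P 1 ∘L fderiv ℝ (fderiv ℝ u) z) ζ -
        (-(P Complex.I ∘L fderiv ℝ (fderiv ℝ u) z)) (ζ * Complex.I) =
        ζ.re • flatLaplacian u z := by
      rw [clm_complex_apply (P 1 ∘L fderiv ℝ (fderiv ℝ u) z) ζ,
        clm_complex_apply (-(P Complex.I ∘L fderiv ℝ (fderiv ℝ u) z)) (ζ * Complex.I)]
      simp only [_root_.neg_apply, hPa, hsymm z hz Complex.I 1, flatLaplacian, Complex.mul_re,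
        Complex.mul_im, Complex.I_re, Complex.I_im]
      module
    rw [e, norm_smul]
    calc ‖ζ.re‖ * ‖flatLaplacian u z‖ ≤ 1 * B := by
          gcongr
          · exact hζ ▸ Complex.abs_re_le_norm ζ
          · exact hB z hz
      _ = B := one_mul B
  · refine norm_le_integral_circle_add (V := fun z => fderiv ℝ u z 1)
      (V' := fun z => (P 1 ∘L fderiv ℝ (fderiv ℝ u) z)) (hP Complex.I) (hPc Complex.I)
      (fun z hz => (hP 1 z hz)) (hPc 1) ?_ hs0 hs
    intro z hz ζ hζ
    have e : (P Complex.I ∘L fderiv ℝ (fderiv ℝ u) z) ζ -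
        (P 1 ∘L fderiv ℝ (fderiv ℝ u) z) (ζ * Complex.I) =
        ζ.im • flatLaplacian u z := by
      rw [clm_complex_apply (P Complex.I ∘L fderiv ℝ (fderiv ℝ u) z) ζ,
        clm_complex_apply (P 1 ∘L fderiv ℝ (fderiv ℝ u) z) (ζ * Complex.I)]
      simp only [hPa, hsymm z hz Complex.I 1, flatLaplacian, Complex.mul_re,
        Complex.mul_im, Complex.I_re, Complex.I_im]
      module
    rw [e, norm_smul]
    calc ‖ζ.im‖ * ‖flatLaplacian u z‖ ≤ 1 * B := by
          gcongr
          · exact hζ ▸ Complex.abs_im_le_norm ζ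
          · exact hB z hz
      _ = B := one_mul B

-- Here x is the sum of the norms of the two partial derivatives at the centre, I the circle
-- integral of ε and 4C²m the bound for Δu. After multiplication by Cq the left side is at least
-- 2πm, while the first and last terms on the right take up at most πm/2 + πm/4; this leaves 5πm/4 ≤
-- 4C³I.
omit [NormedSpace ℝ F] in
theorem circle_mean_arith {m C q x s I : ℝ} (hm : 0 < m) (hC0 : 0 < C) (hq0 : 0 < q)
    (hqm : q ^ 2 = m) (hqx : q ≤ C * x) (hst : 64 * C ^ 3 * (s * q) ≤ 1)
    (sum : 2 * Real.pi * x ≤ 2 * (2 * Real.pi * (q / (8 * C)) + 2 * C ^ 2 / q * I) +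
        2 * (2 * Real.pi * (4 * C ^ 2 * m) * s)) : m / (4 * C ^ 3) ≤ I := by
  have hI2 : 2 * C ^ 2 / q * I * (C * q) = 2 * C ^ 3 * I := by field_simp
  have hq8 : q / (8 * C) * (C * q) = m / 8 := by rw [← hqm]; field_simp
  have hpi := mul_le_mul_of_nonneg_right Real.pi_gt_three.le hm.le
  have hpi2 := Real.pi_pos
  have sum2 := mul_le_mul_of_nonneg_right sum (by positivity : 0 ≤ C * q)
  have e1 : (2 * (2 * Real.pi * (q / (8 * C)) + 2 * C ^ 2 / q * I) +
      2 * (2 * Real.pi * (4 * C ^ 2 * m) * s)) * (C * q) =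
      4 * Real.pi * (q / (8 * C) * (C * q)) + 2 * (2 * C ^ 2 / q * I * (C * q)) +
        16 * Real.pi * m * (C ^ 3 * (s * q)) := by ring
  rw [e1, hI2, hq8] at sum2
  have e2 : 2 * Real.pi * m ≤ 2 * Real.pi * x * (C * q) := by
    have := mul_le_mul_of_nonneg_left hqx (by positivity : 0 ≤ 2 * Real.pi * q)
    calc 2 * Real.pi * m = 2 * Real.pi * q * q := by rw [← hqm]; ring
      _ ≤ 2 * Real.pi * q * (C * x) := this
      _ = _ := by ring
  have e3 : 16 * Real.pi * m * (C ^ 3 * (s * q)) ≤ Real.pi * m / 4 := by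
    have := mul_le_mul_of_nonneg_left hst (by positivity : 0 ≤ Real.pi * m / 4)
    calc 16 * Real.pi * m * (C ^ 3 * (s * q)) = Real.pi * m / 4 * (64 * C ^ 3 * (s * q)) := by ring
      _ ≤ _ := this
      _ = _ := by ring
  rw [div_le_iff₀ (by positivity)]
  linarith

/-- A lower bound for the energy on a disk by the energy density at its centre, on the scale given
by the energy density, for maps whose Laplacian is bounded by the square of the gradient. -/
theorem ofReal_le_lintegral_of_laplacian_le [CompleteSpace F] {u : ℂ → F} {ε : ℂ → ℝ} {c : ℂ}
    {t m C : ℝ} (ht : 0 < t) (hm : 0 < m) (hC : 1 ≤ C)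
    (hu : ContDiffOn ℝ 2 u (Metric.ball c t)) (hε : ContinuousOn ε (Metric.ball c t))
    (h1 : ∀ z ∈ Metric.ball c t, ‖fderiv ℝ u z 1‖ ^ 2 + ‖fderiv ℝ u z Complex.I‖ ^ 2 ≤ C * ε z)
    (h2 : m ≤ C * (‖fderiv ℝ u c 1‖ ^ 2 + ‖fderiv ℝ u c Complex.I‖ ^ 2))
    (hΔ : ∀ z ∈ Metric.ball c t, ‖flatLaplacian u z‖ ≤
      C * (‖fderiv ℝ u z 1‖ ^ 2 + ‖fderiv ℝ u z Complex.I‖ ^ 2))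
    (h4 : ∀ z ∈ Metric.ball c t, ε z ≤ 4 * m) (htm : t * √m ≤ 1 / (64 * C ^ 3)) :
    ENNReal.ofReal (m * t ^ 2 / (8 * C ^ 3)) ≤
      ∫⁻ z in Metric.ball c t, ENNReal.ofReal (ε z) := by
  have hC0 : 0 < C := by linarith
  have hε0 : ∀ z ∈ Metric.ball c t, 0 ≤ ε z := fun z hz =>
    nonneg_of_mul_nonneg_right (le_trans (by positivity) (h1 z hz)) hC0
  set q := √m with hq
  have hq0 : 0 < q := Real.sqrt_pos.2 hm
  have hqm : q ^ 2 = m := Real.sq_sqrt hm.le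
  have hcd : ContinuousOn (fderiv ℝ u) (Metric.ball c t) :=
    hu.continuousOn_fderiv_of_isOpen Metric.isOpen_ball (by norm_num)
  have key : ∀ s, 0 < s → s < t → m / (4 * C ^ 3) ≤
      ∫ θ in (0 : ℝ)..2 * Real.pi, ε (circleMap c s θ) := by
    intro s hs0 hst
    have habs : |s| < t := by rwa [abs_of_pos hs0]
    have hmem : ∀ θ, circleMap c s θ ∈ Metric.ball c t := fun θ => circleMap_mem_ball' habs θ
    have hcε : Continuous fun θ => ε (circleMap c s θ) :=
      hε.comp_continuous (continuous_circleMap c s) hmem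
    have hcD : ∀ e : ℂ, Continuous fun θ => ‖fderiv ℝ u (circleMap c s θ) e‖ := fun e =>
      ((hcd.comp_continuous (continuous_circleMap c s) hmem).clm_apply continuous_const).norm
    have hB : ∀ z ∈ Metric.ball c t, ‖flatLaplacian u z‖ ≤ 4 * C ^ 2 * m := fun z hz => by
      refine (hΔ z hz).trans ?_
      have := (h1 z hz).trans (mul_le_mul_of_nonneg_left (h4 z hz) hC0.le)
      nlinarith
    set I := ∫ θ in (0 : ℝ)..2 * Real.pi, ε (circleMap c s θ) with hI
    -- A weighted arithmetic-geometric mean inequality, a ≤ q/(8C) + 2Ca²/q, combined with a² ≤ Cε.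
    -- The weight keeps the constant term a small fraction of the gradient at the centre, which is
    -- at least of order q/C.
    have hpt : ∀ e : ℂ, (∀ z ∈ Metric.ball c t, ‖fderiv ℝ u z e‖ ^ 2 ≤ C * ε z) →
        (∫ θ in (0 : ℝ)..2 * Real.pi, ‖fderiv ℝ u (circleMap c s θ) e‖) ≤
          2 * Real.pi * (q / (8 * C)) + 2 * C ^ 2 / q * I := by
      intro e he
      have hmono : (∫ θ in (0 : ℝ)..2 * Real.pi, ‖fderiv ℝ u (circleMap c s θ) e‖) ≤
          ∫ θ in (0 : ℝ)..2 * Real.pi, (q / (8 * C) + 2 * C ^ 2 / q * ε (circleMap c s θ)) := by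
        refine intervalIntegral.integral_mono_on Real.two_pi_pos.le
          ((hcD e).intervalIntegrable _ _) ?_ fun θ _ => ?_
        · exact (continuous_const.add (continuous_const.mul hcε)).intervalIntegrable _ _
        · have h5 := he _ (hmem θ)
          set a := ‖fderiv ℝ u (circleMap c s θ) e‖
          have h6 : q / (8 * C) + 2 * C ^ 2 / q * ε (circleMap c s θ) - a ≥
              (q - 4 * C * a) ^ 2 / (8 * C * q) := by
            rw [ge_iff_le, div_le_iff₀ (by positivity)]
            have : (q / (8 * C) + 2 * C ^ 2 / q * ε (circleMap c s θ) - a) * (8 * C * q) =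
                q ^ 2 + 16 * C ^ 2 * (C * ε (circleMap c s θ)) - 8 * C * a * q := by
              field_simp
              ring
            rw [this]
            nlinarith [mul_le_mul_of_nonneg_left h5 (by positivity : (0 : ℝ) ≤ 16 * C ^ 2)]
          have h7 : 0 ≤ (q - 4 * C * a) ^ 2 / (8 * C * q) := by positivity
          linarith
      refine hmono.trans (le_of_eq ?_)
      have hcε2 : Continuous fun θ => 2 * C ^ 2 / q * ε (circleMap c s θ) :=
        continuous_const.mul hcε
      rw [intervalIntegral.integral_add (intervalIntegrable_const)
        (hcε2.intervalIntegrable _ _), intervalIntegral.integral_const_mul]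
      simp only [intervalIntegral.integral_const, sub_zero, smul_eq_mul, hI]
    obtain ⟨g1, g2⟩ := norm_fderiv_le_integral_circle hu hB hs0.le hst
    have p1 := hpt 1 fun z hz => by
      have := h1 z hz; nlinarith [sq_nonneg ‖fderiv ℝ u z Complex.I‖]
    have p2 := hpt Complex.I fun z hz => by
      have := h1 z hz; nlinarith [sq_nonneg ‖fderiv ℝ u z 1‖]
    set a := ‖fderiv ℝ u c 1‖
    set b := ‖fderiv ℝ u c Complex.I‖
    have ha : 0 ≤ a := norm_nonneg _
    have hb : 0 ≤ b := norm_nonneg _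
    have hqab : q ≤ C * (a + b) := by
      refine Real.sqrt_le_iff.2 ⟨by positivity, ?_⟩
      have : C * (a ^ 2 + b ^ 2) ≤ C ^ 2 * (a + b) ^ 2 := by
        have : a ^ 2 + b ^ 2 ≤ (a + b) ^ 2 := by nlinarith
        have : C ≤ C ^ 2 := by nlinarith
        gcongr
      nlinarith
    have hst2 : 64 * C ^ 3 * (s * q) ≤ 1 := by
      have : s * q ≤ 1 / (64 * C ^ 3) := le_trans (by gcongr) htm
      rw [le_div_iff₀ (by positivity)] at this
      linarith
    exact circle_mean_arith hm hC0 hq0 hqm hqab hst2 (by linarith)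
  -- The bound m/(4C³) on each circle, integrated against s ds over (0, t), gives mt²/(8C³).
  refine le_trans (ENNReal.ofReal_le_ofReal (le_of_eq ?_)) (ofReal_le_lintegral_ball ht hε hε0 key)
  field_simp
  ring

end GradientEstimate

/-! ### Point picking -/

section PointPicking

/-- Point picking: a density with a lower energy bound on the scale given by the density, and with
small energy on a disk, is bounded at the centre by the energy. -/
theorem mul_sq_le_of_small_energy {ε : ℂ → ℝ} {c : ℂ} {R δ K E : ℝ} (hR : 0 < R) (hδ : 0 < δ)
    (hK : 0 < K) (hE : 0 ≤ E) (hε : ContinuousOn ε (Metric.ball c R))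
    (hε0 : ∀ z ∈ Metric.ball c R, 0 ≤ ε z)
    (hloc : ∀ z₁ t m, 0 < t → 0 < m → Metric.ball z₁ t ⊆ Metric.ball c R →
      (∀ z ∈ Metric.ball z₁ t, ε z ≤ 4 * m) → ε z₁ = m → t * √m ≤ δ →
      ENNReal.ofReal (m * t ^ 2 / K) ≤ ∫⁻ z in Metric.ball z₁ t, ENNReal.ofReal (ε z))
    (hint : ∫⁻ z in Metric.ball c R, ENNReal.ofReal (ε z) ≤ ENNReal.ofReal E)
    (hsmall : K * E < δ ^ 2) : ε c * R ^ 2 ≤ 16 * K * E := by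
  have hsub : Metric.closedBall c (R / 2) ⊆ Metric.ball c R :=
    Metric.closedBall_subset_ball (by linarith)
  -- The weight vanishes on the boundary of the half disk. At a maximum point z₁, with remaining
  -- distance d, it forces ε ≤ 4 ε(z₁) on the disk of radius d/2 about z₁, because the weight drops
  -- there by at most a factor 4.
  have hcont : ContinuousOn (fun z => (R / 2 - ‖z - c‖) ^ 2 * ε z) (Metric.closedBall c (R / 2)) :=
    (Continuous.continuousOn (by fun_prop)).mul (hε.mono hsub)
  obtain ⟨z₁, hz₁, hmax⟩ := (isCompact_closedBall c (R / 2)).exists_isMaxOn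
    ⟨c, Metric.mem_closedBall_self (by linarith)⟩ hcont
  have hz₁' : ‖z₁ - c‖ ≤ R / 2 := by rwa [Metric.mem_closedBall, Complex.dist_eq] at hz₁
  have hmaxc : (R / 2) ^ 2 * ε c ≤ (R / 2 - ‖z₁ - c‖) ^ 2 * ε z₁ := by
    simpa using hmax (Metric.mem_closedBall_self (by linarith : 0 ≤ R / 2))
  set d := R / 2 - ‖z₁ - c‖ with hd
  set m := ε z₁ with hm
  have hm0 : 0 ≤ m := hε0 _ (hsub hz₁)
  have hd0 : 0 ≤ d := by linarith
  -- Maximality compares with the centre: (R/2)² ε(c) ≤ d²m, whence the constant 16.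
  suffices d ^ 2 * m ≤ 4 * K * E by nlinarith
  rcases hm0.eq_or_lt with h | hmpos
  · rw [← h, mul_zero]; positivity
  rcases hd0.eq_or_lt with h | hdpos
  · rw [← h]; simp; positivity
  have hq0 : 0 < √m := Real.sqrt_pos.2 hmpos
  have hball : ∀ z ∈ Metric.ball z₁ (d / 2), ‖z - c‖ < R / 2 - d / 2 := fun z hz => by
    rw [Metric.mem_ball, Complex.dist_eq] at hz
    have := norm_add_le (z - z₁) (z₁ - c)
    rw [sub_add_sub_cancel] at this
    linarith
  have h4 : ∀ z ∈ Metric.ball z₁ (d / 2), ε z ≤ 4 * m := fun z hz => by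
    have h1 := hball z hz
    have hzc : z ∈ Metric.closedBall c (R / 2) := by
      rw [Metric.mem_closedBall, Complex.dist_eq]; linarith
    have h2 : (R / 2 - ‖z - c‖) ^ 2 * ε z ≤ d ^ 2 * m := hmax hzc
    have h3 : (d / 2) ^ 2 ≤ (R / 2 - ‖z - c‖) ^ 2 := by gcongr; linarith
    have h5 := mul_le_mul_of_nonneg_right h3 (hε0 z (hsub hzc))
    have h6 : (0 : ℝ) < d ^ 2 := by positivity
    have h7 : d ^ 2 * ε z ≤ d ^ 2 * (4 * m) := by nlinarith
    exact le_of_mul_le_mul_left h7 h6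
  have hsubR : Metric.ball z₁ (d / 2) ⊆ Metric.ball c R := fun z hz => by
    have := hball z hz
    rw [Metric.mem_ball, Complex.dist_eq]; linarith
  have hgen : ∀ t, 0 < t → t ≤ d / 2 → t * √m ≤ δ → m * t ^ 2 ≤ K * E := fun t ht htd htm => by
    have hs := Metric.ball_subset_ball (x := z₁) htd
    have h1 := hloc z₁ t m ht hmpos (hs.trans hsubR) (fun z hz => h4 z (hs hz)) rfl htm
    have h2 := h1.trans ((lintegral_mono_set (hs.trans hsubR)).trans hint)
    rw [ENNReal.ofReal_le_ofReal_iff hE, div_le_iff₀ hK] at h2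
    linarith
  -- Otherwise the radius t = δ/√m is admissible and gives δ² = mt² ≤ KE, against the smallness of
  -- the energy.
  have hdm : d / 2 * √m ≤ δ := by
    by_contra! hlt
    have h1 := hgen (δ / √m) (by positivity) (by rw [div_le_iff₀ hq0]; exact hlt.le)
      (by rw [div_mul_cancel₀ _ hq0.ne'])
    rw [div_pow, Real.sq_sqrt hm0, mul_div_cancel₀ _ hmpos.ne'] at h1
    linarith
  have := hgen (d / 2) (by linarith) le_rfl hdm
  nlinarith

end PointPicking

/-! ### Second-order chain rules, and second derivatives of holomorphic maps -/

section SecondDerivatives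

variable {E F H : Type*} [NormedAddCommGroup E] [NormedSpace ℝ E] [NormedAddCommGroup F]
  [NormedSpace ℝ F] [NormedAddCommGroup H] [NormedSpace ℝ H]

theorem eventually_differentiableAt {f : E → F} {x : E} (hf : ContDiffAt ℝ 2 f x) :
    ∀ᶠ y in 𝓝 x, DifferentiableAt ℝ f y := by
  filter_upwards [hf.eventually (by simp)] with y hy
  exact hy.differentiableAt (by norm_num)

theorem differentiableAt_fderiv {f : E → F} {x : E} (hf : ContDiffAt ℝ 2 f x) :
    DifferentiableAt ℝ (fderiv ℝ f) x :=
  (hf.fderiv_right (m := 1) (by norm_num)).differentiableAt (by norm_num)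

theorem fderiv_fderiv_comp {g : F → H} {f : E → F} {x : E} (hg : ContDiffAt ℝ 2 g (f x))
    (hf : ContDiffAt ℝ 2 f x) (a b : E) :
    fderiv ℝ (fderiv ℝ (g ∘ f)) x a b =
      fderiv ℝ (fderiv ℝ g) (f x) (fderiv ℝ f x a) (fderiv ℝ f x b) +
        fderiv ℝ g (f x) (fderiv ℝ (fderiv ℝ f) x a b) := by
  have h1 : fderiv ℝ (g ∘ f) =ᶠ[𝓝 x] fun y => (fderiv ℝ g (f y)).comp (fderiv ℝ f y) := by
    filter_upwards [eventually_differentiableAt hf,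
      hf.continuousAt.eventually (eventually_differentiableAt hg)] with y hy hy'
    exact fderiv_comp y hy' hy
  have h2 : HasFDerivAt (fun y => fderiv ℝ g (f y))
      ((fderiv ℝ (fderiv ℝ g) (f x)).comp (fderiv ℝ f x)) x :=
    (differentiableAt_fderiv hg).hasFDerivAt.comp x
      (hf.differentiableAt (by norm_num)).hasFDerivAt
  rw [h1.fderiv_eq, (h2.clm_comp (differentiableAt_fderiv hf).hasFDerivAt).fderiv]
  simp [add_comm]

/-- The derivative of `y ↦ L y (A y a) (A y b)`. -/
theorem fderiv_bilinear_pullback {L : E → F →L[ℝ] F →L[ℝ] H} {A : E → E →L[ℝ] F}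
    {x : E} (hL : DifferentiableAt ℝ L x) (hA : DifferentiableAt ℝ A x) (a b v : E) :
    fderiv ℝ (fun y => L y (A y a) (A y b)) x v =
      fderiv ℝ L x v (A x a) (A x b) + L x (fderiv ℝ A x v a) (A x b) +
        L x (A x a) (fderiv ℝ A x v b) := by
  have hAa : ∀ a, HasFDerivAt (fun y => A y a) ((fderiv ℝ A x).flip a) x := fun a => by
    have := hA.hasFDerivAt.clm_apply (hasFDerivAt_const a x)
    simpa using this
  have h1 := (hL.hasFDerivAt.clm_apply (hAa a)).clm_apply (hAa b)
  rw [h1.fderiv]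
  simp only [_root_.add_apply, ContinuousLinearMap.comp_apply,
    ContinuousLinearMap.flip_apply]
  abel

set_option synthInstance.maxHeartbeats 400000 in
set_option maxHeartbeats 1000000 in
theorem fderiv_pullback_bilinear {G : E → E →L[ℝ] E →L[ℝ] H} {K : F → F →L[ℝ] F →L[ℝ] H}
    {τ : E → F} {y : E} (hτ : ContDiffAt ℝ 2 τ y) (hG : DifferentiableAt ℝ G y)
    (hK : DifferentiableAt ℝ K (τ y))
    (hGK : ∀ᶠ y in 𝓝 y, ∀ a b, G y a b = K (τ y) (fderiv ℝ τ y a) (fderiv ℝ τ y b)) (a b v : E) :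
    fderiv ℝ G y v a b = fderiv ℝ K (τ y) (fderiv ℝ τ y v) (fderiv ℝ τ y a) (fderiv ℝ τ y b) +
      K (τ y) (fderiv ℝ (fderiv ℝ τ) y v a) (fderiv ℝ τ y b) +
      K (τ y) (fderiv ℝ τ y a) (fderiv ℝ (fderiv ℝ τ) y v b) := by
  have h1 : HasFDerivAt (fun y => G y a b) (((fderiv ℝ G y).flip a).flip b) y := by
    have := (hG.hasFDerivAt.clm_apply (hasFDerivAt_const a y)).clm_apply (hasFDerivAt_const b y)
    simpa using this
  have h2 : (fun y => G y a b) =ᶠ[𝓝 y] fun y => K (τ y) (fderiv ℝ τ y a) (fderiv ℝ τ y b) := by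
    filter_upwards [hGK] with y hy using hy a b
  have hKτ : HasFDerivAt (fun y => K (τ y)) (fderiv ℝ K (τ y) ∘L fderiv ℝ τ y) y :=
    HasFDerivAt.comp (g := K) (f := τ) y hK.hasFDerivAt (hτ.differentiableAt (by norm_num)).hasFDerivAt
  have h3 := fderiv_bilinear_pullback hKτ.differentiableAt (differentiableAt_fderiv hτ) a b v
  rw [← h2.fderiv_eq, h1.fderiv, hKτ.fderiv] at h3
  exact h3

end SecondDerivatives

section Holomorphic

variable {E F : Type*} [NormedAddCommGroup E] [NormedSpace ℂ E] [NormedSpace ℝ E]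
  [IsScalarTower ℝ ℂ E] [NormedAddCommGroup F] [NormedSpace ℂ F] [NormedSpace ℝ F]
  [IsScalarTower ℝ ℂ F]

-- The derivative of the Cauchy-Riemann equation. Together with the symmetry of second derivatives
-- it makes D²τ complex bilinear.
omit [IsScalarTower ℝ ℂ E] in
theorem fderiv_fderiv_I_right {τ : E → F} {x : E} (hτ : ContDiffAt ℝ 2 τ x)
    (hJ : ∀ᶠ y in 𝓝 x, ∀ v, fderiv ℝ τ y (Complex.I • v) = Complex.I • fderiv ℝ τ y v) (a b : E) :
    fderiv ℝ (fderiv ℝ τ) x a (Complex.I • b) = Complex.I • fderiv ℝ (fderiv ℝ τ) x a b := by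
  have hd : ∀ b, HasFDerivAt (fun y => fderiv ℝ τ y b) ((fderiv ℝ (fderiv ℝ τ) x).flip b) x :=
    fun b => by
      simpa using (differentiableAt_fderiv hτ).hasFDerivAt.clm_apply (hasFDerivAt_const b x)
  have h1 := hd (Complex.I • b)
  have h2 := (hd b).const_smul Complex.I
  have h3 : (fun y => fderiv ℝ τ y (Complex.I • b)) =ᶠ[𝓝 x] Complex.I • fun y => fderiv ℝ τ y b := by
    filter_upwards [hJ] with y hy
    exact hy b
  have h4 := h1.unique (h2.congr_of_eventuallyEq h3)
  exact congrArg (fun L : E →L[ℝ] F => L a) h4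

omit [IsScalarTower ℝ ℂ E] in
theorem fderiv_fderiv_I_left {τ : E → F} {x : E} (hτ : ContDiffAt ℝ 2 τ x)
    (hJ : ∀ᶠ y in 𝓝 x, ∀ v, fderiv ℝ τ y (Complex.I • v) = Complex.I • fderiv ℝ τ y v) (a b : E) :
    fderiv ℝ (fderiv ℝ τ) x (Complex.I • a) b = Complex.I • fderiv ℝ (fderiv ℝ τ) x a b := by
  have hs : IsSymmSndFDerivAt ℝ τ x := hτ.isSymmSndFDerivAt (by simp)
  rw [hs, fderiv_fderiv_I_right hτ hJ, hs b a]

/-- Holomorphic functions are harmonic. -/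
theorem flatLaplacian_eq_zero {σ : ℂ → F} {z : ℂ} (hσ : ContDiffAt ℝ 2 σ z)
    (hJ : ∀ᶠ y in 𝓝 z, ∀ v : ℂ, fderiv ℝ σ y (Complex.I • v) = Complex.I • fderiv ℝ σ y v) :
    flatLaplacian σ z = 0 := by
  have h1 := fderiv_fderiv_I_left hσ hJ 1 Complex.I
  have h2 := fderiv_fderiv_I_right hσ hJ 1 1
  rw [smul_eq_mul, mul_one] at h1 h2
  rw [flatLaplacian, h1, h2, smul_smul, Complex.I_mul_I]
  simp

end Holomorphic

/-! ### The Chern-harmonic equation in the plane and its covariance -/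

section Tension

variable {F : Type*} [NormedAddCommGroup F] [NormedSpace ℂ F] [NormedSpace ℝ F]
  [IsScalarTower ℝ ℂ F]

/-- The Christoffel symbols of the Chern connection in holomorphic coordinates, on the diagonal:
`⟪Γ(v, v), w⟫`, where `G` gives the metric coefficients. -/
def chernSymbol (G : F → F →L[ℝ] F →L[ℝ] ℝ) (y v w : F) : ℝ :=
  (1 / 2) * (fderiv ℝ G y v v w + fderiv ℝ G y (Complex.I • v) v (Complex.I • w))

/-- The tension field `tr ∇du` (without the conformal factor), paired with `w`, of a map from a
domain of the plane to a domain of `F` with metric coefficients `G`. -/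
def flatTension (G : F → F →L[ℝ] F →L[ℝ] ℝ) (u : ℂ → F) (z : ℂ) (w : F) : ℝ :=
  G (u z) (flatLaplacian u z) w + chernSymbol G (u z) (fderiv ℝ u z 1) w +
    chernSymbol G (u z) (fderiv ℝ u z Complex.I) w

omit [NormedSpace ℂ F] [IsScalarTower ℝ ℂ F] in
theorem flatLaplacian_comp {H : Type*} [NormedAddCommGroup H] [NormedSpace ℝ H]
    {τ : F → H} {u : ℂ → F} {z : ℂ} (hτ : ContDiffAt ℝ 2 τ (u z)) (hu : ContDiffAt ℝ 2 u z) :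
    flatLaplacian (τ ∘ u) z = fderiv ℝ τ (u z) (flatLaplacian u z) +
      fderiv ℝ (fderiv ℝ τ) (u z) (fderiv ℝ u z 1) (fderiv ℝ u z 1) +
      fderiv ℝ (fderiv ℝ τ) (u z) (fderiv ℝ u z Complex.I) (fderiv ℝ u z Complex.I) := by
  simp only [flatLaplacian, fderiv_fderiv_comp hτ hu, map_add]
  abel

-- When G is the pull-back of K by a holomorphic τ, the inhomogeneous term in the transformation of
-- `chernSymbol` is exactly K(τ''(v, v), τ'w), the term produced by Δ(τ∘u). Of the two halves of the
-- symbol, each contributes this term, the second one by the J-invariance of K. The other terms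
-- K(τ'v, τ''(v, w)) and K(τ'v, τ''(Jv, Jw)) cancel, since τ''(Jv, Jw) = −τ''(v, w).
set_option synthInstance.maxHeartbeats 400000 in
set_option maxHeartbeats 1000000 in
theorem flatTension_comp_left {G K : F → F →L[ℝ] F →L[ℝ] ℝ} {τ : F → F} {u : ℂ → F} {z : ℂ}
    (hu : ContDiffAt ℝ 2 u z) (hτ : ContDiffAt ℝ 2 τ (u z))
    (hJ : ∀ᶠ y in 𝓝 (u z), ∀ v, fderiv ℝ τ y (Complex.I • v) = Complex.I • fderiv ℝ τ y v)
    (hG : DifferentiableAt ℝ G (u z)) (hK : DifferentiableAt ℝ K (τ (u z)))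
    (hKJ : ∀ a b, K (τ (u z)) (Complex.I • a) (Complex.I • b) = K (τ (u z)) a b)
    (hGK : ∀ᶠ y in 𝓝 (u z), ∀ a b, G y a b = K (τ y) (fderiv ℝ τ y a) (fderiv ℝ τ y b)) (w : F) :
    flatTension K (τ ∘ u) z (fderiv ℝ τ (u z) w) = flatTension G u z w := by
  set y := u z with hy
  have hd := fun v a b => fderiv_pullback_bilinear hτ hG hK hGK a b v
  have hTJ : ∀ v, fderiv ℝ τ y (Complex.I • v) = Complex.I • fderiv ℝ τ y v := hJ.self_of_nhds
  have hneg : ∀ v w, fderiv ℝ (fderiv ℝ τ) y (Complex.I • v) (Complex.I • w) =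
      -fderiv ℝ (fderiv ℝ τ) y v w := fun v w => by
    rw [fderiv_fderiv_I_left hτ hJ, fderiv_fderiv_I_right hτ hJ, smul_smul, Complex.I_mul_I,
      neg_one_smul]
  have hc : ∀ v, chernSymbol G y v w = chernSymbol K (τ y) (fderiv ℝ τ y v) (fderiv ℝ τ y w) +
      K (τ y) (fderiv ℝ (fderiv ℝ τ) y v v) (fderiv ℝ τ y w) := by
    intro v
    simp only [chernSymbol, hd, hTJ, hneg, fderiv_fderiv_I_left hτ hJ, hKJ, map_neg]
    ring
  have hdu : ∀ e, fderiv ℝ (τ ∘ u) z e = fderiv ℝ τ y (fderiv ℝ u z e) := fun e => by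
    rw [fderiv_comp z (hτ.differentiableAt (by norm_num)) (hu.differentiableAt (by norm_num))]
    rfl
  simp only [flatTension, flatLaplacian_comp hτ hu, hdu, ← hy, hc, hGK.self_of_nhds,
    Function.comp_apply, map_add, _root_.add_apply]
  ring

-- A holomorphic σ is harmonic and conformal. It rotates the pair (u_x, u_y) and scales it by |σ'|,
-- so the mixed terms cancel in the sum of a quadratic expression over the pair, and likewise in the
-- Laplacian.
set_option synthInstance.maxHeartbeats 400000 in
set_option maxHeartbeats 1000000 in
theorem flatTension_comp_right {G : F → F →L[ℝ] F →L[ℝ] ℝ} {σ : ℂ → ℂ} {u : ℂ → F} {z : ℂ}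
    (hu : ContDiffAt ℝ 2 u (σ z)) (hσ : ContDiffAt ℝ 2 σ z)
    (hJ : ∀ᶠ y in 𝓝 z, ∀ v : ℂ, fderiv ℝ σ y (Complex.I • v) = Complex.I • fderiv ℝ σ y v) (w : F) :
    flatTension G (u ∘ σ) z w = ‖fderiv ℝ σ z 1‖ ^ 2 * flatTension G u (σ z) w := by
  set c := fderiv ℝ σ z 1 with hc
  have hcI : fderiv ℝ σ z Complex.I = Complex.I * c := by
    have := hJ.self_of_nhds 1
    simpa using this
  have hn : ‖c‖ ^ 2 = c.re ^ 2 + c.im ^ 2 := by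
    rw [← Complex.normSq_eq_norm_sq, Complex.normSq_apply]; ring
  set v₁ := fderiv ℝ u (σ z) 1 with hv₁
  set v₂ := fderiv ℝ u (σ z) Complex.I with hv₂
  have hdu : ∀ e, fderiv ℝ (u ∘ σ) z e = fderiv ℝ u (σ z) (fderiv ℝ σ z e) := fun e => by
    rw [fderiv_comp z (hu.differentiableAt (by norm_num)) (hσ.differentiableAt (by norm_num))]
    rfl
  have h1 : fderiv ℝ (u ∘ σ) z 1 = c.re • v₁ + c.im • v₂ := by
    rw [hdu, clm_complex_apply]
  have h2 : fderiv ℝ (u ∘ σ) z Complex.I = (-c.im) • v₁ + c.re • v₂ := by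
    rw [hdu, hcI, clm_complex_apply]
    simp [hv₁, hv₂]
  have hs : IsSymmSndFDerivAt ℝ u (σ z) := hu.isSymmSndFDerivAt (by simp)
  have hsecond : ∀ a b : ℂ, fderiv ℝ (fderiv ℝ u) (σ z) a b =
      a.re • b.re • fderiv ℝ (fderiv ℝ u) (σ z) 1 1 +
      a.re • b.im • fderiv ℝ (fderiv ℝ u) (σ z) 1 Complex.I +
      a.im • b.re • fderiv ℝ (fderiv ℝ u) (σ z) 1 Complex.I +
      a.im • b.im • fderiv ℝ (fderiv ℝ u) (σ z) Complex.I Complex.I := fun a b => by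
    rw [clm_complex_apply (fderiv ℝ (fderiv ℝ u) (σ z) a) b,
      clm_complex_apply (fderiv ℝ (fderiv ℝ u) (σ z)) a]
    simp only [_root_.add_apply, _root_.smul_apply, hs Complex.I 1]
    module
  have hΔ : flatLaplacian (u ∘ σ) z = ‖c‖ ^ 2 • flatLaplacian u (σ z) := by
    have h3 := flatLaplacian_comp (τ := u) (u := σ) hu hσ
    rw [flatLaplacian_eq_zero hσ hJ, map_zero, zero_add, ← hc, hcI, hsecond c c,
      hsecond (Complex.I * c)] at h3
    rw [h3, hn, flatLaplacian]
    simp only [Complex.mul_re, Complex.mul_im, Complex.I_re, Complex.I_im]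
    module
  have hI : ∀ (x : ℝ) (v : F), Complex.I • x • v = x • Complex.I • v := fun x v =>
    smul_comm _ _ _
  simp only [flatTension, hΔ, h1, h2, chernSymbol, Function.comp_apply, map_add, map_smul,
    smul_add, hI, _root_.add_apply, _root_.smul_apply, smul_eq_mul, hn]
  ring

omit [IsScalarTower ℝ ℂ F] in
/-- The equation `tr ∇du = 0` bounds the Laplacian by the square of the gradient. -/
theorem norm_flatLaplacian_le {G : F → F →L[ℝ] F →L[ℝ] ℝ} {u : ℂ → F} {z : ℂ} {C : ℝ} (hC : 0 ≤ C)
    (hu : ∀ w, flatTension G u z w = 0) (hG : ∀ w, ‖w‖ ^ 2 ≤ C * G (u z) w w)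
    (hD : ∀ v a b, |fderiv ℝ G (u z) v a b| ≤ C * ‖v‖ * ‖a‖ * ‖b‖) :
    ‖flatLaplacian u z‖ ≤ C ^ 2 * (‖fderiv ℝ u z 1‖ ^ 2 + ‖fderiv ℝ u z Complex.I‖ ^ 2) := by
  set w := flatLaplacian u z with hw
  have hn : ∀ v : F, ‖Complex.I • v‖ = ‖v‖ := fun v => by rw [norm_smul]; simp
  have hs : ∀ v, |chernSymbol G (u z) v w| ≤ C * ‖v‖ ^ 2 * ‖w‖ := fun v => by
    have h1 := hD v v w
    have h2 := hD (Complex.I • v) v (Complex.I • w)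
    rw [hn, hn] at h2
    rw [chernSymbol, abs_mul, abs_of_pos (by norm_num : (0 : ℝ) < 1 / 2)]
    have := abs_add_le (fderiv ℝ G (u z) v v w) (fderiv ℝ G (u z) (Complex.I • v) v (Complex.I • w))
    nlinarith
  -- The equation is tested with w = Δu, which gives |w|² ≤ C G(w, w) ≤ C²|du|²|w|.
  have h0 := hu w
  rw [flatTension, ← hw] at h0
  have h1 := (abs_le.1 (hs (fderiv ℝ u z 1))).1
  have h2 := (abs_le.1 (hs (fderiv ℝ u z Complex.I))).1
  have h3 : G (u z) w w ≤
      C * (‖fderiv ℝ u z 1‖ ^ 2 + ‖fderiv ℝ u z Complex.I‖ ^ 2) * ‖w‖ := by linarith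
  have h4 := (hG w).trans (mul_le_mul_of_nonneg_left h3 hC)
  rcases (norm_nonneg w).eq_or_lt with h | h
  · rw [← h]; positivity
  · refine le_of_mul_le_mul_right ?_ h
    nlinarith

-- With B the metric frozen at a point, this is the Laplacian of a squared distance. If |Δu| ≤
-- C|du|² and u is close to y, the first two terms dominate the third and the function is
-- subharmonic.
omit [NormedSpace ℂ F] [IsScalarTower ℝ ℂ F] in
theorem flatLaplacian_quadratic {B : F →L[ℝ] F →L[ℝ] ℝ} (hB : ∀ a b, B a b = B b a) {u : ℂ → F}
    {z : ℂ} (y : F) (hu : ContDiffAt ℝ 2 u z) :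
    flatLaplacian (fun z => B (u z - y) (u z - y)) z =
      2 * B (fderiv ℝ u z 1) (fderiv ℝ u z 1) +
      2 * B (fderiv ℝ u z Complex.I) (fderiv ℝ u z Complex.I) +
      2 * B (u z - y) (flatLaplacian u z) := by
  have hsub : ∀ x : F, HasFDerivAt (fun x : F => x - y) (ContinuousLinearMap.id ℝ F) x := fun x =>
    (hasFDerivAt_id x).sub_const y
  have h1 : ∀ x, HasFDerivAt (fun x => B (x - y) (x - y)) ((2 : ℝ) • B (x - y)) x := fun x => by
    have := (B.hasFDerivAt.comp x (hsub x)).clm_apply (hsub x)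
    refine this.congr_fderiv ?_
    ext v
    simp [hB v, two_mul]
  have h2 : fderiv ℝ (fun x => B (x - y) (x - y)) = fun x => (2 : ℝ) • B (x - y) :=
    funext fun x => (h1 x).fderiv
  have h3 : ∀ x, HasFDerivAt (fun x => (2 : ℝ) • B (x - y)) ((2 : ℝ) • B) x := fun x =>
    ((B.hasFDerivAt.comp x (hsub x)).const_smul (2 : ℝ))
  have hcd : ContDiffAt ℝ 2 (fun x => B (x - y) (x - y)) (u z) := by fun_prop
  have := flatLaplacian_comp hcd hu
  change flatLaplacian ((fun x => B (x - y) (x - y)) ∘ u) z = _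
  rw [this, h2, (h3 _).fderiv]
  simp only [_root_.smul_apply, smul_eq_mul]
  ring

end Tension

/-! ### Coordinate frames and transition maps -/

section Frames

variable {E : Type*} [NormedAddCommGroup E] [NormedSpace ℝ E]
  {M : Type*} [TopologicalSpace M] [ChartedSpace E M] [IsManifold 𝓘(ℝ, E) ∞ M]

variable (E) in
/-- The coordinate frame of the preferred chart at `p`. -/
def frame (p y : M) : E →L[ℝ] TangentSpace 𝓘(ℝ, E) y :=
  (trivializationAt E (fun y : M => TangentSpace 𝓘(ℝ, E) y) p).symmL ℝ y

theorem hasMFDerivAt_chart_symm (p : M) {z : E} (hz : z ∈ (chartAt E p).target) :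
    HasMFDerivAt 𝓘(ℝ, E) 𝓘(ℝ, E) (chartAt E p).symm z (frame E p ((chartAt E p).symm z)) := by
  have hz' : z ∈ (extChartAt 𝓘(ℝ, E) p).target := by simpa using hz
  have hy : (extChartAt 𝓘(ℝ, E) p).symm z ∈ (chartAt E p).source := by
    simpa using (extChartAt 𝓘(ℝ, E) p).map_target hz'
  have h := TangentBundle.symmL_trivializationAt (I := 𝓘(ℝ, E)) hy
  rw [(extChartAt 𝓘(ℝ, E) p).right_inv hz'] at h
  have h3 : MDifferentiableAt 𝓘(ℝ, E) 𝓘(ℝ, E) (extChartAt 𝓘(ℝ, E) p).symm z :=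
    mdifferentiableAt_atlas_symm (chart_mem_atlas _ _) hz
  have h4 := h3.hasMFDerivAt
  rw [← mfderivWithin_univ, ← range_id (α := E), ← modelWithCornersSelf_coe ℝ E, ← h] at h4
  exact h4

theorem hasMFDerivAt_chart (p : M) {y : M} (hy : y ∈ (chartAt E p).source) :
    HasMFDerivAt 𝓘(ℝ, E) 𝓘(ℝ, E) (chartAt E p) y
      ((trivializationAt E (fun y : M => TangentSpace 𝓘(ℝ, E) y) p).continuousLinearMapAt ℝ y) := by
  have h := TangentBundle.continuousLinearMapAt_trivializationAt (I := 𝓘(ℝ, E)) hy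
  have h2 : mfderiv 𝓘(ℝ, E) 𝓘(ℝ, E) (extChartAt 𝓘(ℝ, E) p) y =
      mfderiv 𝓘(ℝ, E) 𝓘(ℝ, E) (chartAt E p) y := by simp; rfl
  have h3 : MDifferentiableAt 𝓘(ℝ, E) 𝓘(ℝ, E) (chartAt E p) y :=
    mdifferentiableAt_atlas (chart_mem_atlas _ _) hy
  rw [h2] at h
  have h4 := h3.hasMFDerivAt
  rw [← h] at h4
  exact h4

/-- The tangent space at p is the model space read through the preferred chart at p, so the frame of
this chart is the identity there. -/
theorem frame_self_apply (p : M) (a : E) : frame E p p a = (show TangentSpace 𝓘(ℝ, E) p from a) := by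
  rw [frame, TangentBundle.symmL_trivializationAt_eq_core (mem_chart_source E p)]
  exact (tangentBundleCore 𝓘(ℝ, E) M).coordChange_self (achart E p) p (mem_chart_source E p) a

/-- Change of frames. -/
theorem frame_eq_frame_fderiv (p q : M) {z : E} (hz : z ∈ (chartAt E p).target)
    (hq : (chartAt E p).symm z ∈ (chartAt E q).source) :
    HasFDerivAt (chartAt E q ∘ (chartAt E p).symm)
      (fderiv ℝ (chartAt E q ∘ (chartAt E p).symm) z) z ∧
    ∀ a, frame E p ((chartAt E p).symm z) a =
      frame E q ((chartAt E p).symm z) (fderiv ℝ (chartAt E q ∘ (chartAt E p).symm) z a) := by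
  have h1 : HasMFDerivAt 𝓘(ℝ, E) 𝓘(ℝ, E) (chartAt E q ∘ (chartAt E p).symm) z _ :=
    (hasMFDerivAt_chart q hq).comp z (hasMFDerivAt_chart_symm p hz)
  let L : E →L[ℝ] E :=
    ((trivializationAt E (fun y : M => TangentSpace 𝓘(ℝ, E) y) q).continuousLinearMapAt ℝ
      ((chartAt E p).symm z)).comp (frame E p ((chartAt E p).symm z))
  have h2 : HasFDerivAt (chartAt E q ∘ (chartAt E p).symm) L z := h1.hasFDerivAt
  refine ⟨h2.differentiableAt.hasFDerivAt, fun a => ?_⟩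
  rw [h2.fderiv]
  exact ((trivializationAt E (fun y : M => TangentSpace 𝓘(ℝ, E) y) q).symmL_continuousLinearMapAt
    (R := ℝ) hq (frame E p ((chartAt E p).symm z) a)).symm

theorem contMDiffOn_frame (p : M) (a : E) :
    ContMDiffOn 𝓘(ℝ, E) (𝓘(ℝ, E).prod 𝓘(ℝ, E)) ∞
      (fun y => (⟨y, frame E p y a⟩ : TotalSpace E (fun y : M => TangentSpace 𝓘(ℝ, E) y)))
      (chartAt E p).source := by
  have : IsManifold 𝓘(ℝ, E) (∞ + 1) M := by simpa
  have h := Trivialization.contMDiffOn_section_baseSet_iff (IB := 𝓘(ℝ, E)) (n := ∞)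
    (e := trivializationAt E (fun y : M => TangentSpace 𝓘(ℝ, E) y) p) (s := fun y => frame E p y a)
  refine h.2 ?_
  refine contMDiffOn_const (c := a) |>.congr fun y hy => ?_
  have := Trivialization.continuousLinearMapAt_symmL (R := ℝ)
    (trivializationAt E (fun y : M => TangentSpace 𝓘(ℝ, E) y) p) hy a
  rw [Trivialization.continuousLinearMapAt_apply, Trivialization.coe_linearMapAt_of_mem _ hy] at this
  exact this

theorem contDiffOn_transition (p q : M) :
    ContDiffOn ℝ ∞ (chartAt E q ∘ (chartAt E p).symm)
      ((chartAt E p).target ∩ (chartAt E p).symm ⁻¹' (chartAt E q).source) := by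
  have h := (contMDiffOn_chart (I := 𝓘(ℝ, E)) (n := ∞) (x := q)).comp
    ((contMDiffOn_chart_symm (I := 𝓘(ℝ, E)) (n := ∞) (x := p)).mono
      (inter_subset_left (t := (chartAt E p).symm ⁻¹' (chartAt E q).source)))
    (fun z hz => hz.2)
  exact contMDiffOn_iff_contDiffOn.1 h

theorem extend_eq_frame (x : M) (u : TangentSpace 𝓘(ℝ, E) x) {y : M}
    (hy : y ∈ (chartAt E x).source) :
    (FiberBundle.extend E u : Π y : M, TangentSpace 𝓘(ℝ, E) y) y = frame E x y u := by
  rw [extend_eq x y hy]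
  have h1 := Trivialization.continuousLinearMapAt_symmL (R := ℝ)
    (trivializationAt E (fun y : M => TangentSpace 𝓘(ℝ, E) y) x)
    (FiberBundle.mem_baseSet_trivializationAt' x) u
  have h2 := frame_self_apply (E := E) x u
  rw [frame] at h2
  rw [h2] at h1
  exact congrArg _ h1

end Frames

/-! ### Metric coefficients in charts -/

section MetricCoefficients

variable {E : Type*} [NormedAddCommGroup E] [NormedSpace ℝ E]
  {M : Type*} [TopologicalSpace M] [ChartedSpace E M] [IsManifold 𝓘(ℝ, E) ∞ M]
  [RiemannianBundle (fun x : M => TangentSpace 𝓘(ℝ, E) x)]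

/-- The metric coefficients in the preferred chart at `p`. -/
def metricCoeff (p : M) (z : E) : E →L[ℝ] E →L[ℝ] ℝ :=
  (innerSL ℝ (E := TangentSpace 𝓘(ℝ, E) ((chartAt E p).symm z))).bilinearComp
    (frame E p ((chartAt E p).symm z)) (frame E p ((chartAt E p).symm z))

theorem metricCoeff_apply (p : M) (z a b : E) :
    metricCoeff p z a b = inner ℝ (frame E p ((chartAt E p).symm z) a)
      (frame E p ((chartAt E p).symm z) b) := rfl

theorem metricCoeff_symm (p : M) (z a b : E) : metricCoeff p z a b = metricCoeff p z b a := by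
  rw [metricCoeff_apply, metricCoeff_apply, real_inner_comm]

theorem metricCoeff_self (p : M) (z a : E) :
    metricCoeff p z a a = ‖frame E p ((chartAt E p).symm z) a‖ ^ 2 := by
  rw [metricCoeff_apply, real_inner_self_eq_norm_sq]

theorem metricCoeff_transition (p q : M) {z : E} (hz : z ∈ (chartAt E p).target)
    (hq : (chartAt E p).symm z ∈ (chartAt E q).source) (a b : E) :
    metricCoeff p z a b = metricCoeff q ((chartAt E q ∘ (chartAt E p).symm) z)
      (fderiv ℝ (chartAt E q ∘ (chartAt E p).symm) z a)
      (fderiv ℝ (chartAt E q ∘ (chartAt E p).symm) z b) := by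
  obtain ⟨-, h⟩ := frame_eq_frame_fderiv p q hz hq
  rw [metricCoeff_apply, metricCoeff_apply, h a, h b, Function.comp_apply,
    (chartAt E q).left_inv hq]

variable [FiniteDimensional ℝ E]
  [IsContMDiffRiemannianBundle 𝓘(ℝ, E) ∞ E (fun x : M => TangentSpace 𝓘(ℝ, E) x)]

theorem contDiffOn_metricCoeff (p : M) :
    ContDiffOn ℝ ∞ (metricCoeff (E := E) p) (chartAt E p).target := by
  rw [contDiffOn_clm_apply]
  intro a
  rw [contDiffOn_clm_apply]
  intro b
  have h : ContMDiffOn 𝓘(ℝ, E) 𝓘(ℝ, ℝ) ∞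
      (fun y : M => (inner ℝ (frame E p y a) (frame E p y b) : ℝ)) (chartAt E p).source :=
    ContMDiffOn.inner_bundle (F := E) (E := fun y : M => TangentSpace 𝓘(ℝ, E) y)
      (b := fun y => y) (contMDiffOn_frame p a) (contMDiffOn_frame p b)
  exact contMDiffOn_iff_contDiffOn.1 (h.comp (contMDiffOn_chart_symm (n := ∞) (x := p))
    fun z hz => (chartAt E p).map_target hz)

-- The link between the connections and calculus in coordinates. It concerns only the centre x of
-- the chart, so the equation is first obtained in the charts at x and f x
-- (`flatTension_eq_zero_self`) and then transported.
set_option synthInstance.maxHeartbeats 400000 in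
theorem metricDeriv_eq_fderiv (x : M) (u w v : TangentSpace 𝓘(ℝ, E) x) :
    metricDeriv x u w v =
      (fderiv ℝ (metricCoeff (E := E) x) (chartAt E x x) : E →L[ℝ] E →L[ℝ] E →L[ℝ] ℝ) v u w := by
  have h1 : writtenInExtChartAt 𝓘(ℝ, E) 𝓘(ℝ, ℝ) x (fun y : M => (inner ℝ (FiberBundle.extend E u y)
      (FiberBundle.extend E w y) : ℝ)) =ᶠ[𝓝 (chartAt E x x)]
      fun z => (metricCoeff x z : E →L[ℝ] E →L[ℝ] ℝ) u w := by
    filter_upwards [(chartAt E x).open_target.mem_nhds (mem_chart_target E x)] with z hz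
    have hy := (chartAt E x).map_target hz
    change (inner ℝ (FiberBundle.extend E u ((chartAt E x).symm z))
      (FiberBundle.extend E w ((chartAt E x).symm z)) : ℝ) = _
    rw [extend_eq_frame x u hy, extend_eq_frame x w hy]
    rfl
  have h2 : HasFDerivAt (fun z => (metricCoeff x z : E →L[ℝ] E →L[ℝ] ℝ) u w)
      (((fderiv ℝ (metricCoeff (E := E) x) (chartAt E x x)).flip u : E →L[ℝ] E →L[ℝ] ℝ).flip w)
      (chartAt E x x) := by
    have hd : DifferentiableAt ℝ (metricCoeff (E := E) x) (chartAt E x x) :=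
      ((contDiffOn_metricCoeff x).differentiableOn (by simp)).differentiableAt
        ((chartAt E x).open_target.mem_nhds (mem_chart_target E x))
    have := (hd.hasFDerivAt.clm_apply (hasFDerivAt_const (show E from u) _)).clm_apply
      (hasFDerivAt_const (show E from w) _)
    simpa using this
  have h4 := h2.congr_of_eventuallyEq h1
  have h3 := (mdifferentiableAt_inner_extend x u w).mfderiv
  have h5 : fderivWithin ℝ (writtenInExtChartAt 𝓘(ℝ, E) 𝓘(ℝ, ℝ) x (fun y : M =>
      (inner ℝ (FiberBundle.extend E u y) (FiberBundle.extend E w y) : ℝ))) (range 𝓘(ℝ, E))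
      (extChartAt 𝓘(ℝ, E) x x) =
      ((fderiv ℝ (metricCoeff (E := E) x) (chartAt E x x)).flip u : E →L[ℝ] E →L[ℝ] ℝ).flip w := by
    rw [modelWithCornersSelf_coe, range_id, fderivWithin_univ]
    exact h4.fderiv
  exact congrArg (fun L : E →L[ℝ] ℝ => L v) (h3.trans h5)

end MetricCoefficients

/-! ### Traces of bilinear maps -/

section Trace

variable {V W : Type*} [NormedAddCommGroup V] [InnerProductSpace ℝ V] [AddCommGroup W] [Module ℝ W]

/-- The trace of a bilinear map does not depend on the orthonormal basis. -/
theorem sum_orthonormalBasis_eq {ι κ : Type*} [Fintype ι] [Fintype κ] (B : V →ₗ[ℝ] V →ₗ[ℝ] W)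
    (e : OrthonormalBasis ι ℝ V) (c : OrthonormalBasis κ ℝ V) :
    ∑ i, B (e i) (e i) = ∑ j, B (c j) (c j) := by
  have h : ∀ i, B (e i) (e i) = ∑ j, ∑ k, (inner ℝ (c j) (e i) * inner ℝ (e i) (c k)) •
      B (c j) (c k) := by
    intro i
    conv_lhs => rw [← c.sum_repr' (e i)]
    simp only [map_sum, map_smul, LinearMap.sum_apply, LinearMap.smul_apply, Finset.smul_sum]
    rw [Finset.sum_comm]
    refine Finset.sum_congr rfl fun j _ => Finset.sum_congr rfl fun k _ => ?_
    rw [smul_smul, real_inner_comm (c k), mul_comm]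
  simp only [h]
  rw [Finset.sum_comm]
  refine Finset.sum_congr rfl fun j _ => ?_
  rw [Finset.sum_comm]
  simp only [← Finset.sum_smul, e.sum_inner_mul_inner]
  classical
  simp [orthonormal_iff_ite.1 c.orthonormal, ite_smul]

/-- After division by the common length, a and b form an orthonormal basis, in which the trace can
be computed. -/
theorem smul_sum_orthonormalBasis_eq {ι : Type*} [Fintype ι] (hV : Module.finrank ℝ V = 2)
    (B : V →ₗ[ℝ] V →ₗ[ℝ] W) (e : OrthonormalBasis ι ℝ V) {a b : V} (hab : ‖a‖ = ‖b‖)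
    (ha : a ≠ 0) (h0 : inner ℝ a b = (0 : ℝ)) :
    ‖a‖ ^ 2 • ∑ i, B (e i) (e i) = B a a + B b b := by
  have hn : ‖a‖ ≠ 0 := norm_ne_zero_iff.2 ha
  have : FiniteDimensional ℝ V := Module.finite_of_finrank_pos (by omega)
  have ho : Orthonormal ℝ ![‖a‖⁻¹ • a, ‖a‖⁻¹ • b] := by
    have hn2 : ‖b‖ ≠ 0 := hab ▸ hn
    refine ⟨fun i => ?_, fun i j hij => ?_⟩
    · fin_cases i
      · simp [norm_smul, hn]
      · simp [norm_smul, hab, hn2]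
    · fin_cases i <;> fin_cases j <;>
        simp [inner_smul_left, inner_smul_right, h0, real_inner_comm a b] at hij ⊢
  obtain ⟨c, hc⟩ := Orthonormal.exists_orthonormalBasis_extension_of_card_eq (𝕜 := ℝ)
    (ι := Fin 2) (by simp [hV]) (v := ![‖a‖⁻¹ • a, ‖a‖⁻¹ • b]) (s := univ)
    (ho.comp _ Subtype.val_injective)
  rw [sum_orthonormalBasis_eq B e c, Fin.sum_univ_two, hc 0 (mem_univ _), hc 1 (mem_univ _)]
  simp only [Matrix.cons_val_zero, Matrix.cons_val_one, map_smul, LinearMap.smul_apply, smul_add,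
    smul_smul]
  have e : ‖a‖ ^ 2 * (‖a‖⁻¹ * ‖a‖⁻¹) = 1 := by field_simp
  rw [e, one_smul, one_smul]

end Trace

theorem isOpen_transition_source {E M : Type*} [TopologicalSpace E] [TopologicalSpace M]
    [ChartedSpace E M] (p q : M) :
    IsOpen ((chartAt E p).target ∩ (chartAt E p).symm ⁻¹' (chartAt E q).source) :=
  (chartAt E p).isOpen_inter_preimage_symm (chartAt E q).open_source

theorem complex_eq_smul_add {v : ℂ} (hv : v ≠ 0) (w : ℂ) :
    w = (w / v).re • v + (w / v).im • (Complex.I • v) := by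
  rw [Complex.real_smul, Complex.real_smul, smul_eq_mul, ← mul_assoc, ← add_mul, Complex.re_add_im,
    div_mul_cancel₀ _ hv]

theorem finrank_tangentSpace_surface {S : Type*} [TopologicalSpace S] [ChartedSpace ℂ S] (x : S) :
    Module.finrank ℝ (TangentSpace 𝓘(ℝ, ℂ) x) = 2 :=
  Complex.finrank_real_complex

/-! ### Holomorphic charts -/

section ComplexCharts

variable {E : Type*} [NormedAddCommGroup E] [NormedSpace ℂ E] [NormedSpace ℝ E]
  [IsScalarTower ℝ ℂ E]
  {M : Type*} [TopologicalSpace M] [ChartedSpace E M] [IsManifold 𝓘(ℂ, E) ω M]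

theorem frame_I (p : M) {y : M} (hy : y ∈ (chartAt E p).source) (a : E) :
    frame E p y (Complex.I • a) = tangentJ y (frame E p y a) := by
  have hb : y ∈ (trivializationAt E (fun y : M => TangentSpace 𝓘(ℝ, E) y) p).baseSet := hy
  rw [← Trivialization.symmL_continuousLinearMapAt (R := ℝ) _ hb (tangentJ y _),
    coords_tangentJ p y hy, frame, Trivialization.continuousLinearMapAt_symmL _ hb]

theorem frame_injective (p : M) {y : M} (hy : y ∈ (chartAt E p).source) :
    Function.Injective (frame E p y) := by
  have hb : y ∈ (trivializationAt E (fun y : M => TangentSpace 𝓘(ℝ, E) y) p).baseSet := hy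
  exact Function.LeftInverse.injective
    (g := (trivializationAt E (fun y : M => TangentSpace 𝓘(ℝ, E) y) p).continuousLinearMapAt ℝ y)
    fun a => Trivialization.continuousLinearMapAt_symmL _ hb a

/-- Coordinate changes are holomorphic. -/
theorem fderiv_transition_I (p q : M) {z : E}
    (hz : z ∈ (chartAt E p).target ∩ (chartAt E p).symm ⁻¹' (chartAt E q).source) (v : E) :
    fderiv ℝ (chartAt E q ∘ (chartAt E p).symm) z (Complex.I • v) =
      Complex.I • fderiv ℝ (chartAt E q ∘ (chartAt E p).symm) z v := by
  have h := (contMDiffOn_chart (I := 𝓘(ℂ, E)) (n := ω) (x := q)).comp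
    ((contMDiffOn_chart_symm (I := 𝓘(ℂ, E)) (n := ω) (x := p)).mono
      (inter_subset_left (t := (chartAt E p).symm ⁻¹' (chartAt E q).source)))
    (fun z hz => hz.2)
  have h2 : DifferentiableAt ℂ (chartAt E q ∘ (chartAt E p).symm) z :=
    ((contMDiffOn_iff_contDiffOn.1 h).differentiableOn (by simp)).differentiableAt
      ((isOpen_transition_source p q).mem_nhds hz)
  have h3 := h2.hasFDerivAt.restrictScalars ℝ
  rw [h3.fderiv]
  simp

theorem eventually_fderiv_transition_I (p q : M) {z : E}
    (hz : z ∈ (chartAt E p).target ∩ (chartAt E p).symm ⁻¹' (chartAt E q).source) :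
    ∀ᶠ y in 𝓝 z, ∀ v : E, fderiv ℝ (chartAt E q ∘ (chartAt E p).symm) y (Complex.I • v) =
      Complex.I • fderiv ℝ (chartAt E q ∘ (chartAt E p).symm) y v := by
  filter_upwards [(isOpen_transition_source p q).mem_nhds hz] with y hy v
  exact fderiv_transition_I p q hy v

theorem contDiffAt_transition (p q : M) {z : E}
    (hz : z ∈ (chartAt E p).target ∩ (chartAt E p).symm ⁻¹' (chartAt E q).source) :
    ContDiffAt ℝ 2 (chartAt E q ∘ (chartAt E p).symm) z :=
  ((contDiffOn_transition p q).contDiffAt ((isOpen_transition_source p q).mem_nhds hz)).of_le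
    (WithTop.coe_le_coe.2 (le_top : (2 : ℕ∞) ≤ ⊤))

/-- Allows a test vector given in one chart to be pulled back to another. -/
theorem fderiv_transition_surjective (p q : M) {z : E}
    (hz : z ∈ (chartAt E p).target ∩ (chartAt E p).symm ⁻¹' (chartAt E q).source) :
    Function.Surjective (fderiv ℝ (chartAt E q ∘ (chartAt E p).symm) z) := by
  intro w
  have hb : (chartAt E p).symm z ∈ (chartAt E p).source := (chartAt E p).map_target hz.1
  have h1 := Trivialization.symmL_continuousLinearMapAt (R := ℝ)
    (trivializationAt E (fun y : M => TangentSpace 𝓘(ℝ, E) y) p) hb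
    (frame E q ((chartAt E p).symm z) w)
  exact ⟨_, frame_injective q hz.2 (((frame_eq_frame_fderiv p q hz.1 hz.2).2 _).symm.trans h1)⟩

section Hermitian

variable [RiemannianBundle (fun x : M => TangentSpace 𝓘(ℝ, E) x)]

theorem metricCoeff_I (h : IsHermitianMetric E M) (p : M) {z : E} (hz : z ∈ (chartAt E p).target)
    (a b : E) : metricCoeff p z (Complex.I • a) (Complex.I • b) = metricCoeff p z a b := by
  have hy := (chartAt E p).map_target hz
  rw [metricCoeff_apply, metricCoeff_apply, frame_I p hy, frame_I p hy]
  exact h _ _ _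

end Hermitian

end ComplexCharts

/-! ### Traces for a conformal metric on the surface -/

section DomainTrace

variable {S : Type*} [TopologicalSpace S] [ChartedSpace ℂ S] [IsManifold 𝓘(ℂ, ℂ) ω S]
  [RiemannianBundle (fun x : S => TangentSpace 𝓘(ℝ, ℂ) x)]

theorem inner_tangentJ_self (hS : IsHermitianMetric ℂ S) (x : S) (v : TangentSpace 𝓘(ℝ, ℂ) x) :
    inner ℝ v (tangentJ x v) = (0 : ℝ) := by
  have h1 := inner_tangentJ_left hS x v v
  rw [real_inner_comm] at h1
  linarith

theorem norm_tangentJ (hS : IsHermitianMetric ℂ S) (x : S) (v : TangentSpace 𝓘(ℝ, ℂ) x) :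
    ‖tangentJ x v‖ = ‖v‖ := by
  have h1 := hS x v v
  rw [real_inner_self_eq_norm_sq, real_inner_self_eq_norm_sq] at h1
  exact (sq_eq_sq₀ (norm_nonneg _) (norm_nonneg _)).1 h1

/-- For a Hermitian metric v and Jv are orthogonal and of equal length. With v = ∂/∂x and Jv = ∂/∂y
this turns the metric trace into the flat one. -/
theorem smul_trace_eq (hS : IsHermitianMetric ℂ S) (x : S) {W : Type*} [AddCommGroup W]
    [Module ℝ W]
    (B : TangentSpace 𝓘(ℝ, ℂ) x →ₗ[ℝ] TangentSpace 𝓘(ℝ, ℂ) x →ₗ[ℝ] W)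
    {v : TangentSpace 𝓘(ℝ, ℂ) x} (hv : v ≠ 0) :
    ‖v‖ ^ 2 • ∑ i, B (stdOrthonormalBasis ℝ (TangentSpace 𝓘(ℝ, ℂ) x) i)
      (stdOrthonormalBasis ℝ (TangentSpace 𝓘(ℝ, ℂ) x) i) =
      B v v + B (tangentJ x v) (tangentJ x v) :=
  smul_sum_orthonormalBasis_eq (finrank_tangentSpace_surface x) B _ (norm_tangentJ hS x v).symm hv
    (inner_tangentJ_self hS x v)

variable [IsContMDiffRiemannianBundle 𝓘(ℝ, ℂ) ∞ ℂ (fun x : S => TangentSpace 𝓘(ℝ, ℂ) x)]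

/-- The Christoffel symbols of a conformal metric on a surface have vanishing trace. -/
theorem leviCivitaForm_trace (hS : IsHermitianMetric ℂ S) (x : S) (v w : TangentSpace 𝓘(ℝ, ℂ) x) :
    leviCivitaForm x v v w + leviCivitaForm x (tangentJ x v) (tangentJ x v) w = 0 := by
  -- The coefficient ⟪a, Ja⟫ vanishes near x, so its derivatives do too. With w expanded in v and
  -- Jv, only derivatives of |v|² = |Jv|² remain, and they cancel.
  have h1 : ∀ a b : TangentSpace 𝓘(ℝ, ℂ) x, metricDeriv x a (tangentJ x a) b = 0 := fun a b => by
    have := metricDeriv_tangentJ_left hS x a a b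
    rw [metricDeriv_symm x (tangentJ x a)] at this
    linarith
  rcases eq_or_ne v 0 with rfl | hv
  · simp
  have hw : ∃ α β : ℝ, w = α • v + β • tangentJ x v := by
    exact ⟨_, _, complex_eq_smul_add (v := v) hv w⟩
  obtain ⟨α, β, rfl⟩ := hw
  have h2 := h1 v
  simp only [leviCivitaForm, LinearMap.coe_mk, AddHom.coe_mk, metricDeriv_add₂, metricDeriv_add₃,
    metricDeriv_smul₂, metricDeriv_smul₃, metricDeriv_tangentJ_tangentJ hS, h2,
    metricDeriv_symm x (tangentJ x v) v]
  ring

end DomainTrace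

/-! ### Maps in coordinates -/

section CoordinateMaps

theorem flatTension_congr {F : Type*} [NormedAddCommGroup F] [NormedSpace ℂ F] [NormedSpace ℝ F]
    (G : F → F →L[ℝ] F →L[ℝ] ℝ) {u v : ℂ → F} {z : ℂ} (h : u =ᶠ[𝓝 z] v) (w : F) :
    flatTension G u z w = flatTension G v z w := by
  have h1 : fderiv ℝ u =ᶠ[𝓝 z] fderiv ℝ v := h.fderiv
  simp only [flatTension, flatLaplacian, h1.fderiv_eq, h.fderiv_eq, h.eq_of_nhds]

variable {S : Type*} [TopologicalSpace S] [ChartedSpace ℂ S]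
  {F : Type*} [NormedAddCommGroup F]
  {M : Type*} [TopologicalSpace M] [ChartedSpace F M]

/-- A map in the preferred charts at `k` and `l`. -/
def coordMap (k : S) (l : M) (f : S → M) : ℂ → F :=
  chartAt F l ∘ f ∘ (chartAt ℂ k).symm

variable [NormedSpace ℝ F]

section Smooth

variable [IsManifold 𝓘(ℝ, ℂ) ∞ S] [IsManifold 𝓘(ℝ, F) ∞ M] {f : S → M}

theorem contDiffAt_coordMap (hf : ContMDiff 𝓘(ℝ, ℂ) 𝓘(ℝ, F) ∞ f) (k : S) (l : M) {z : ℂ}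
    (hz : z ∈ (chartAt ℂ k).target) (hl : f ((chartAt ℂ k).symm z) ∈ (chartAt F l).source) :
    ContDiffAt ℝ ∞ (coordMap k l f : ℂ → F) z := by
  have h1 : ContMDiffAt 𝓘(ℝ, ℂ) 𝓘(ℝ, ℂ) ∞ (chartAt ℂ k).symm z :=
    (contMDiffOn_chart_symm (I := 𝓘(ℝ, ℂ)) (n := ∞) (x := k)).contMDiffAt
      ((chartAt ℂ k).open_target.mem_nhds hz)
  have h2 : ContMDiffAt 𝓘(ℝ, F) 𝓘(ℝ, F) ∞ (chartAt F l) (f ((chartAt ℂ k).symm z)) :=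
    (contMDiffOn_chart (I := 𝓘(ℝ, F)) (n := ∞) (x := l)).contMDiffAt
      ((chartAt F l).open_source.mem_nhds hl)
  exact contMDiffAt_iff_contDiffAt.1 (h2.comp z ((hf _).comp z h1))

/-- The differential of a map in coordinates. -/
theorem frame_fderiv_coordMap (hf : ContMDiff 𝓘(ℝ, ℂ) 𝓘(ℝ, F) ∞ f) (k : S) (l : M) {z : ℂ}
    (hz : z ∈ (chartAt ℂ k).target) (hl : f ((chartAt ℂ k).symm z) ∈ (chartAt F l).source) (a : ℂ) :
    frame F l (f ((chartAt ℂ k).symm z)) (fderiv ℝ (coordMap k l f : ℂ → F) z a) =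
      mfderiv 𝓘(ℝ, ℂ) 𝓘(ℝ, F) f ((chartAt ℂ k).symm z) (frame ℂ k ((chartAt ℂ k).symm z) a) := by
  have h1 : HasMFDerivAt 𝓘(ℝ, ℂ) 𝓘(ℝ, F) (coordMap k l f : ℂ → F) z _ :=
    (hasMFDerivAt_chart l hl).comp z
      ((((hf _).mdifferentiableAt (by simp)).hasMFDerivAt).comp z (hasMFDerivAt_chart_symm k hz))
  let L : ℂ →L[ℝ] F :=
    ((trivializationAt F (fun y : M => TangentSpace 𝓘(ℝ, F) y) l).continuousLinearMapAt ℝ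
      (f ((chartAt ℂ k).symm z))).comp
      ((mfderiv 𝓘(ℝ, ℂ) 𝓘(ℝ, F) f ((chartAt ℂ k).symm z)).comp (frame ℂ k ((chartAt ℂ k).symm z)))
  have h2 : HasFDerivAt (coordMap k l f : ℂ → F) L z := h1.hasFDerivAt
  rw [h2.fderiv]
  exact (trivializationAt F (fun y : M => TangentSpace 𝓘(ℝ, F) y) l).symmL_continuousLinearMapAt
    (R := ℝ) hl _

variable [RiemannianBundle (fun y : M => TangentSpace 𝓘(ℝ, F) y)]

theorem metricCoeff_chart (l : M) {y : M} (hy : y ∈ (chartAt F l).source) (a b : F) :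
    metricCoeff l (chartAt F l y) a b = inner ℝ (frame F l y a) (frame F l y b) := by
  rw [metricCoeff_apply, (chartAt F l).left_inv hy]

theorem metricCoeff_coordMap (hf : ContMDiff 𝓘(ℝ, ℂ) 𝓘(ℝ, F) ∞ f) (k : S) (l : M) {z : ℂ}
    (hz : z ∈ (chartAt ℂ k).target) (hl : f ((chartAt ℂ k).symm z) ∈ (chartAt F l).source) (a : ℂ) :
    metricCoeff l (coordMap k l f z) (fderiv ℝ (coordMap k l f : ℂ → F) z a)
        (fderiv ℝ (coordMap k l f : ℂ → F) z a) =
      ‖mfderiv 𝓘(ℝ, ℂ) 𝓘(ℝ, F) f ((chartAt ℂ k).symm z)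
        (frame ℂ k ((chartAt ℂ k).symm z) a)‖ ^ 2 := by
  rw [coordMap, Function.comp_apply, Function.comp_apply, metricCoeff_chart l hl]
  change inner ℝ (frame F l _ (fderiv ℝ (coordMap k l f : ℂ → F) z a))
    (frame F l _ (fderiv ℝ (coordMap k l f : ℂ → F) z a)) = _
  rw [frame_fderiv_coordMap hf k l hz hl, real_inner_self_eq_norm_sq]

end Smooth

end CoordinateMaps

/-! ### The energy density in conformal coordinates -/

section Energy

variable {S : Type*} [TopologicalSpace S] [ChartedSpace ℂ S] [IsManifold 𝓘(ℂ, ℂ) ω S]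
  [RiemannianBundle (fun x : S => TangentSpace 𝓘(ℝ, ℂ) x)]
  {F : Type*} [NormedAddCommGroup F] [NormedSpace ℝ F]
  {M : Type*} [TopologicalSpace M] [ChartedSpace F M] [IsManifold 𝓘(ℝ, F) ∞ M]
  [RiemannianBundle (fun y : M => TangentSpace 𝓘(ℝ, F) y)]

omit [RiemannianBundle (fun x : S => TangentSpace 𝓘(ℝ, ℂ) x)] in
theorem frame_ne_zero (k : S) {x : S} (hx : x ∈ (chartAt ℂ k).source) : frame ℂ k x 1 ≠ 0 :=
  fun h => one_ne_zero (frame_injective k hx (h.trans (map_zero (frame ℂ k x)).symm))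

/-- The energy density in coordinates, multiplied by the conformal factor. -/
def conformalEnergy (F : Type*) [NormedAddCommGroup F] [NormedSpace ℝ F]
    {M : Type*} [TopologicalSpace M] [ChartedSpace F M] [IsManifold 𝓘(ℝ, F) ∞ M]
    [RiemannianBundle (fun y : M => TangentSpace 𝓘(ℝ, F) y)] (k : S) (f : S → M) (z : ℂ) : ℝ :=
  metricCoeff k z 1 1 * energyDensity ℂ F f ((chartAt ℂ k).symm z)

/-- The trace is computed with ∂/∂x and ∂/∂y, and the conformal factor cancels. This is the density
to which the estimates in the plane apply. -/
theorem conformalEnergy_eq_norm (hS : IsHermitianMetric ℂ S) (k : S) (f : S → M) {z : ℂ}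
    (hz : z ∈ (chartAt ℂ k).target) :
    conformalEnergy F k f z = (1 / 2) *
      (‖mfderiv 𝓘(ℝ, ℂ) 𝓘(ℝ, F) f ((chartAt ℂ k).symm z)
        (frame ℂ k ((chartAt ℂ k).symm z) 1)‖ ^ 2 +
      ‖mfderiv 𝓘(ℝ, ℂ) 𝓘(ℝ, F) f ((chartAt ℂ k).symm z)
        (frame ℂ k ((chartAt ℂ k).symm z) Complex.I)‖ ^ 2) := by
  set x := (chartAt ℂ k).symm z with hx
  have hxs : x ∈ (chartAt ℂ k).source := (chartAt ℂ k).map_target hz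
  set D : TangentSpace 𝓘(ℝ, ℂ) x →L[ℝ] TangentSpace 𝓘(ℝ, F) (f x) := mfderiv 𝓘(ℝ, ℂ) 𝓘(ℝ, F) f x
  let B : TangentSpace 𝓘(ℝ, ℂ) x →ₗ[ℝ] TangentSpace 𝓘(ℝ, ℂ) x →ₗ[ℝ] ℝ :=
    (innerₗ (TangentSpace 𝓘(ℝ, F) (f x))).compl₁₂ D.toLinearMap D.toLinearMap
  have h1 := smul_trace_eq hS x B (frame_ne_zero k hxs)
  have h2 : ∀ a, B a a = ‖D a‖ ^ 2 := fun a => real_inner_self_eq_norm_sq (D a)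
  have h3 : frame ℂ k x Complex.I = tangentJ x (frame ℂ k x 1) := by
    rw [← frame_I k hxs, smul_eq_mul, mul_one]
  simp only [h2] at h1
  rw [conformalEnergy, energyDensity, metricCoeff_self, ← hx, h3, ← h1, smul_eq_mul]
  ring

theorem conformalEnergy_eq_metricCoeff (hS : IsHermitianMetric ℂ S) {f : S → M}
    (hf : ContMDiff 𝓘(ℝ, ℂ) 𝓘(ℝ, F) ∞ f) (k : S) (l : M) {z : ℂ}
    (hz : z ∈ (chartAt ℂ k).target) (hl : f ((chartAt ℂ k).symm z) ∈ (chartAt F l).source) :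
    conformalEnergy F k f z = (1 / 2) *
      (metricCoeff l (coordMap k l f z) (fderiv ℝ (coordMap k l f : ℂ → F) z 1)
        (fderiv ℝ (coordMap k l f : ℂ → F) z 1) +
      metricCoeff l (coordMap k l f z) (fderiv ℝ (coordMap k l f : ℂ → F) z Complex.I)
        (fderiv ℝ (coordMap k l f : ℂ → F) z Complex.I)) := by
  rw [conformalEnergy_eq_norm hS k f hz, metricCoeff_coordMap hf k l hz hl,
    metricCoeff_coordMap hf k l hz hl]

theorem conformalEnergy_nonneg (hS : IsHermitianMetric ℂ S) (k : S) (f : S → M) {z : ℂ}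
    (hz : z ∈ (chartAt ℂ k).target) : 0 ≤ conformalEnergy F k f z := by
  rw [conformalEnergy_eq_norm hS k f hz]; positivity

/-- The length of the image of a vector is bounded by the energy. -/
theorem norm_mfderiv_sq_le (hS : IsHermitianMetric ℂ S) (k : S) (f : S → M) {z : ℂ}
    (hz : z ∈ (chartAt ℂ k).target) (a : ℂ) :
    ‖mfderiv 𝓘(ℝ, ℂ) 𝓘(ℝ, F) f ((chartAt ℂ k).symm z)
      (frame ℂ k ((chartAt ℂ k).symm z) a)‖ ^ 2 ≤ 2 * conformalEnergy F k f z * ‖a‖ ^ 2 := by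
  rw [conformalEnergy_eq_norm hS k f hz]
  set L : ℂ →L[ℝ] TangentSpace 𝓘(ℝ, F) (f ((chartAt ℂ k).symm z)) :=
    (mfderiv 𝓘(ℝ, ℂ) 𝓘(ℝ, F) f ((chartAt ℂ k).symm z)).comp (frame ℂ k ((chartAt ℂ k).symm z))
  change ‖L a‖ ^ 2 ≤ 2 * ((1 / 2) * (‖L 1‖ ^ 2 + ‖L Complex.I‖ ^ 2)) * ‖a‖ ^ 2
  have h1 : L a = a.re • L 1 + a.im • L Complex.I := by
    conv_lhs => rw [← Complex.re_add_im a]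
    rw [map_add, ← map_smul, ← map_smul]
    simp
  have h2 : ‖L a‖ ≤ |a.re| * ‖L 1‖ + |a.im| * ‖L Complex.I‖ := by
    rw [h1]
    refine (norm_add_le _ _).trans ?_
    rw [norm_smul, norm_smul, Real.norm_eq_abs, Real.norm_eq_abs]
  have h3 : ‖a‖ ^ 2 = |a.re| ^ 2 + |a.im| ^ 2 := by
    rw [← Complex.normSq_eq_norm_sq, Complex.normSq_apply, sq_abs, sq_abs]; ring
  rw [h3]
  have h4 := pow_le_pow_left₀ (norm_nonneg _) h2 2
  nlinarith [sq_nonneg (|a.re| * ‖L Complex.I‖ - |a.im| * ‖L 1‖)]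

end Energy

/-! ### The Chern-harmonic equation in arbitrary charts -/

section ChernHarmonicEquation

variable {S : Type*} [TopologicalSpace S] [ChartedSpace ℂ S] [IsManifold 𝓘(ℂ, ℂ) ω S]
  [RiemannianBundle (fun x : S => TangentSpace 𝓘(ℝ, ℂ) x)]
  [IsContMDiffRiemannianBundle 𝓘(ℝ, ℂ) ∞ ℂ (fun x : S => TangentSpace 𝓘(ℝ, ℂ) x)]
  {F : Type*} [NormedAddCommGroup F] [NormedSpace ℂ F] [NormedSpace ℝ F] [IsScalarTower ℝ ℂ F]
  [FiniteDimensional ℝ F]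
  {M : Type*} [TopologicalSpace M] [ChartedSpace F M] [IsManifold 𝓘(ℂ, F) ω M]
  [RiemannianBundle (fun y : M => TangentSpace 𝓘(ℝ, F) y)]
  [IsContMDiffRiemannianBundle 𝓘(ℝ, F) ∞ F (fun y : M => TangentSpace 𝓘(ℝ, F) y)]

omit [FiniteDimensional ℝ F]
  [IsContMDiffRiemannianBundle 𝓘(ℝ, F) ∞ F (fun y : M => TangentSpace 𝓘(ℝ, F) y)] in
theorem inner_frame_self (y : M) (a b : F) :
    metricCoeff y (chartAt F y y) a b =
      inner ℝ (show TangentSpace 𝓘(ℝ, F) y from a) (show TangentSpace 𝓘(ℝ, F) y from b) := by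
  rw [metricCoeff_chart y (mem_chart_source F y), frame_self_apply, frame_self_apply]

set_option synthInstance.maxHeartbeats 400000 in
theorem chernForm_eq_chernSymbol (y : M) (v w : TangentSpace 𝓘(ℝ, F) y) :
    chernForm y v v w = chernSymbol (metricCoeff (E := F) y) (chartAt F y y) v w := by
  simp only [chernForm, LinearMap.coe_mk, AddHom.coe_mk, chernSymbol, metricDeriv_eq_fderiv]
  rfl

theorem secondFundamentalForm_eq (f : S → M) (x : S) (a b : TangentSpace 𝓘(ℝ, ℂ) x) :
    secondFundamentalForm (leviCivita (E := ℂ) S) (chernConnection (E := F) M) f x a b =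
      (show TangentSpace 𝓘(ℝ, F) (f x) from
        fderiv ℝ (fderiv ℝ (coordMap x (f x) f : ℂ → F)) (chartAt ℂ x x) a b) +
      ofTrilinear (chernForm (f x)) (mfderiv 𝓘(ℝ, ℂ) 𝓘(ℝ, F) f x b)
        (mfderiv 𝓘(ℝ, ℂ) 𝓘(ℝ, F) f x a) -
      mfderiv 𝓘(ℝ, ℂ) 𝓘(ℝ, F) f x (ofTrilinear (leviCivitaForm x) b a) := by
  rw [secondFundamentalForm, chernConnection, leviCivita, connectionOfForm_extend,
    connectionOfForm_extend]
  rfl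

/-- A Chern-harmonic map satisfies the equation in the preferred charts at a point and its image. -/
theorem flatTension_eq_zero_self (hS : IsHermitianMetric ℂ S) {f : S → M}
    (hf : IsChernHarmonic F f) (x : S) (w : F) :
    flatTension (metricCoeff (f x)) (coordMap x (f x) f : ℂ → F) (chartAt ℂ x x) w = 0 := by
  have hz := mem_chart_target ℂ x
  have hx : (chartAt ℂ x).symm (chartAt ℂ x x) = x := (chartAt ℂ x).left_inv (mem_chart_source ℂ x)
  set u : ℂ → F := coordMap x (f x) f with hu
  have hu0 : u (chartAt ℂ x x) = chartAt F (f x) (f x) := by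
    simp only [hu, coordMap, Function.comp_apply, hx]
  let H : TangentSpace 𝓘(ℝ, ℂ) x →L[ℝ] TangentSpace 𝓘(ℝ, ℂ) x →L[ℝ] TangentSpace 𝓘(ℝ, F) (f x) :=
    (fderiv ℝ (fderiv ℝ u) (chartAt ℂ x x) : ℂ →L[ℝ] ℂ →L[ℝ] F)
  let D : TangentSpace 𝓘(ℝ, ℂ) x →L[ℝ] TangentSpace 𝓘(ℝ, F) (f x) := mfderiv 𝓘(ℝ, ℂ) 𝓘(ℝ, F) f x
  let Γ := ofTrilinear (chernForm (E := F) (f x))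
  let Λ := ofTrilinear (leviCivitaForm (E := ℂ) x)
  let B : TangentSpace 𝓘(ℝ, ℂ) x →ₗ[ℝ] TangentSpace 𝓘(ℝ, ℂ) x →ₗ[ℝ] TangentSpace 𝓘(ℝ, F) (f x) :=
    LinearMap.mk₂ ℝ (fun a b => H a b + Γ (D b) (D a) - D (Λ b a))
      (fun a a' b => by simp only [map_add, _root_.add_apply]; abel)
      (fun c a b => by simp only [map_smul, _root_.smul_apply]; module)
      (fun a b b' => by simp only [map_add, _root_.add_apply]; abel)
      (fun c a b => by simp only [map_smul, _root_.smul_apply]; module)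
  have hB : ∀ a b, secondFundamentalForm (leviCivita (E := ℂ) S) (chernConnection (E := F) M) f x a b
      = B a b := fun a b => secondFundamentalForm_eq f x a b
  let v : TangentSpace 𝓘(ℝ, ℂ) x := (1 : ℂ)
  have hv : v ≠ 0 := one_ne_zero (α := ℂ)
  have h0 := smul_trace_eq hS x B hv
  have h1 := hf.2 x
  simp only [hB] at h1
  rw [h1, smul_zero] at h0
  -- The connection of the surface drops out of the equation.
  have hΛ : Λ v v + Λ (tangentJ x v) (tangentJ x v) = 0 := by
    refine ext_inner_right ℝ fun w => ?_
    rw [inner_add_left, inner_ofTrilinear, inner_ofTrilinear, leviCivitaForm_trace hS, inner_zero_left]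
  have h2 : (H v v + H (tangentJ x v) (tangentJ x v)) + Γ (D v) (D v) +
      Γ (D (tangentJ x v)) (D (tangentJ x v)) = 0 := by
    have h3 : D (Λ v v) + D (Λ (tangentJ x v) (tangentJ x v)) = 0 := by
      rw [← map_add, hΛ, map_zero]
    have h4 : (H v v + Γ (D v) (D v) - D (Λ v v)) + (H (tangentJ x v) (tangentJ x v) +
        Γ (D (tangentJ x v)) (D (tangentJ x v)) - D (Λ (tangentJ x v) (tangentJ x v))) = 0 :=
      h0.symm
    calc _ = ((H v v + Γ (D v) (D v) - D (Λ v v)) + (H (tangentJ x v) (tangentJ x v) +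
        Γ (D (tangentJ x v)) (D (tangentJ x v)) - D (Λ (tangentJ x v) (tangentJ x v)))) +
        (D (Λ v v) + D (Λ (tangentJ x v) (tangentJ x v))) := by abel
      _ = 0 := by rw [h4, h3, add_zero]
  have h5 : ∀ w : TangentSpace 𝓘(ℝ, F) (f x),
      inner ℝ (H v v + H (tangentJ x v) (tangentJ x v)) w +
      chernSymbol (metricCoeff (E := F) (f x)) (chartAt F (f x) (f x)) (D v) w +
      chernSymbol (metricCoeff (E := F) (f x)) (chartAt F (f x) (f x)) (D (tangentJ x v)) w = 0 := by
    intro w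
    have h6 : ∀ a, (inner ℝ (Γ (D a) (D a)) w : ℝ) =
        chernSymbol (metricCoeff (E := F) (f x)) (chartAt F (f x) (f x)) (D a) w := fun a => by
      rw [inner_ofTrilinear, chernForm_eq_chernSymbol]
    rw [← h6, ← h6, ← inner_add_left, ← inner_add_left, h2, inner_zero_left]
  have hD : ∀ a : ℂ, (fderiv ℝ u (chartAt ℂ x x) a : F) = D a := fun a => by
    have h7 := ((hf.1 x).mdifferentiableAt (by simp)).mfderiv
    have h8 : fderivWithin ℝ (writtenInExtChartAt 𝓘(ℝ, ℂ) 𝓘(ℝ, F) x f) (range 𝓘(ℝ, ℂ))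
        (extChartAt 𝓘(ℝ, ℂ) x x) = fderiv ℝ u (chartAt ℂ x x) := by
      rw [modelWithCornersSelf_coe, range_id, fderivWithin_univ]
      rfl
    exact (congrArg (fun L : ℂ →L[ℝ] F => L a) (h7.trans h8)).symm
  rw [flatTension, hu0, hD, hD, inner_frame_self]
  have hI : D (tangentJ x v) = D (Complex.I : ℂ) := congrArg D (mul_one Complex.I)
  have hHI : H (tangentJ x v) (tangentJ x v) = H (Complex.I : ℂ) (Complex.I : ℂ) :=
    congrArg (fun e => H e e) (mul_one Complex.I)
  have h7 := h5 w
  rw [hI, hHI] at h7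
  exact h7

/-- A Chern-harmonic map satisfies the equation in all preferred charts. -/
theorem flatTension_eq_zero (hS : IsHermitianMetric ℂ S) (hM : IsHermitianMetric F M) {f : S → M}
    (hf : IsChernHarmonic F f) (k : S) (l : M) {z : ℂ}
    (hz : z ∈ (chartAt ℂ k).target) (hl : f ((chartAt ℂ k).symm z) ∈ (chartAt F l).source) (w : F) :
    flatTension (metricCoeff l) (coordMap k l f : ℂ → F) z w = 0 := by
  set x := (chartAt ℂ k).symm z with hx
  have hz1 : z ∈ (chartAt ℂ k).target ∩ (chartAt ℂ k).symm ⁻¹' (chartAt ℂ x).source :=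
    ⟨hz, mem_chart_source ℂ x⟩
  have hlf : (chartAt F (f x)).symm (chartAt F (f x) (f x)) = f x :=
    (chartAt F (f x)).left_inv (mem_chart_source F (f x))
  have hy1 : chartAt F (f x) (f x) ∈ (chartAt F (f x)).target ∩
      (chartAt F (f x)).symm ⁻¹' (chartAt F l).source :=
    ⟨mem_chart_target F (f x), by rw [mem_preimage, hlf]; exact hl⟩
  set σ := chartAt ℂ x ∘ (chartAt ℂ k).symm with hσ
  set τ := chartAt F l ∘ (chartAt F (f x)).symm with hτ
  set u : ℂ → F := coordMap x (f x) f with hu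
  have hσz : σ z = chartAt ℂ x x := rfl
  have hσd : ContDiffAt ℝ 2 σ z := contDiffAt_transition k x hz1
  have hxx : (chartAt ℂ x).symm (σ z) = x := by
    rw [hσz, (chartAt ℂ x).left_inv (mem_chart_source ℂ x)]
  have hud : ContDiffAt ℝ 2 u (σ z) := by
    refine (contDiffAt_coordMap hf.1 x (f x) (mem_chart_target ℂ x) ?_).of_le
      (WithTop.coe_le_coe.2 (le_top : (2 : ℕ∞) ≤ ⊤))
    rw [(chartAt ℂ x).left_inv (mem_chart_source ℂ x)]
    exact mem_chart_source F (f x)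
  have huz : (u ∘ σ) z = chartAt F (f x) (f x) := by
    simp only [hu, coordMap, Function.comp_apply, hxx]
  have hτd : ContDiffAt ℝ 2 τ ((u ∘ σ) z) := by
    rw [huz]; exact contDiffAt_transition (f x) l hy1
  -- Near z the map in the charts k and l is its expression u in the centred charts, composed with
  -- holomorphic transition maps on both sides; the covariance lemmas then apply.
  have hcongr : (coordMap k l f : ℂ → F) =ᶠ[𝓝 z] τ ∘ (u ∘ σ) := by
    have hfx : ContinuousAt (fun z => f ((chartAt ℂ k).symm z)) z :=
      (hf.1.continuous.continuousAt).comp ((chartAt ℂ k).symm.continuousAt hz)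
    filter_upwards [(isOpen_transition_source k x).mem_nhds hz1,
      hfx.preimage_mem_nhds ((chartAt F (f x)).open_source.mem_nhds (mem_chart_source F (f x)))]
      with z' hz' hz''
    have e1 : (chartAt ℂ x).symm (chartAt ℂ x ((chartAt ℂ k).symm z')) = (chartAt ℂ k).symm z' :=
      (chartAt ℂ x).left_inv hz'.2
    simp only [hτ, hu, hσ, coordMap, Function.comp_apply, e1]
    rw [(chartAt F (f x)).left_inv hz'']
  have hτy : τ ((u ∘ σ) z) = chartAt F l (f x) := by
    rw [huz, hτ, Function.comp_apply, hlf]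
  have hlt : chartAt F l (f x) ∈ (chartAt F l).target := (chartAt F l).map_source hl
  obtain ⟨w', rfl⟩ := fderiv_transition_surjective (f x) l hy1 w
  rw [flatTension_congr _ hcongr]
  have key := flatTension_comp_left (G := metricCoeff (f x)) (K := metricCoeff l) (τ := τ)
    (u := u ∘ σ) (z := z) (hud.comp z hσd) hτd
    (by rw [huz]; exact eventually_fderiv_transition_I (f x) l hy1)
    (by
      rw [huz]
      exact ((contDiffOn_metricCoeff (f x)).differentiableOn (by simp)).differentiableAt
        ((chartAt F (f x)).open_target.mem_nhds hy1.1))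
    (by
      rw [hτy]
      exact ((contDiffOn_metricCoeff l).differentiableOn (by simp)).differentiableAt
        ((chartAt F l).open_target.mem_nhds hlt))
    (by rw [hτy]; exact metricCoeff_I hM l hlt)
    (by
      rw [huz]
      filter_upwards [(isOpen_transition_source (f x) l).mem_nhds hy1] with y hy a b
      exact metricCoeff_transition (f x) l hy.1 hy.2 a b) w'
  rw [huz] at key
  rw [key, flatTension_comp_right hud hσd (eventually_fderiv_transition_I k x hz1),
    hσz, flatTension_eq_zero_self hS hf x w', mul_zero]

end ChernHarmonicEquation

/-! ### Lengths of curves and Riemannian distances -/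

section Distance

open Manifold

variable {V : Type*} [NormedAddCommGroup V] [NormedSpace ℝ V]
  {E : Type*} [NormedAddCommGroup E] [NormedSpace ℝ E]
  {M : Type*} [TopologicalSpace M] [ChartedSpace E M] [IsManifold 𝓘(ℝ, E) ∞ M]
  [RiemannianBundle (fun x : M => TangentSpace 𝓘(ℝ, E) x)]

omit [IsManifold 𝓘(ℝ, E) ∞ M] in
/-- The distance between the images of two points is bounded by the length of the image of the
segment which joins them. -/
theorem riemannianEDist_le_of_norm_mfderiv_le {γ : V → M} {U : Set V} (hU : IsOpen U)
    (hγ : ContMDiffOn 𝓘(ℝ, V) 𝓘(ℝ, E) 1 γ U) {a b : V} (hab : segment ℝ a b ⊆ U) {K : ℝ}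
    (hK : ∀ z ∈ segment ℝ a b,
      ‖mfderiv 𝓘(ℝ, V) 𝓘(ℝ, E) γ z (show TangentSpace 𝓘(ℝ, V) z from b - a)‖ ≤ K) :
    riemannianEDist 𝓘(ℝ, E) (γ a) (γ b) ≤ ENNReal.ofReal K := by
  let η : ℝ → V := fun t => a + t • (b - a)
  have hηd : ∀ t, HasDerivAt η (b - a) t := fun t => by
    have h := ((hasDerivAt_id t).smul_const (b - a)).const_add a
    rw [one_smul] at h
    exact h
  have hη : ContDiff ℝ 1 η := by fun_prop
  have hηs : ∀ t ∈ Icc (0 : ℝ) 1, η t ∈ segment ℝ a b := fun t ht => by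
    rw [segment_eq_image']; exact ⟨t, ht, rfl⟩
  have h1 : riemannianEDist 𝓘(ℝ, E) (γ a) (γ b) ≤ pathELength 𝓘(ℝ, E) (γ ∘ η) 0 1 := by
    refine riemannianEDist_le_pathELength ?_ ?_ ?_ zero_le_one
    · exact hγ.comp hη.contMDiff.contMDiffOn fun t ht => hab (hηs t ht)
    · simp [η]
    · simp [η]
  refine h1.trans ?_
  rw [pathELength_eq_lintegral_mfderiv_Icc]
  calc _ ≤ ∫⁻ _ in Icc (0 : ℝ) 1, ENNReal.ofReal K := by
        refine setLIntegral_mono' measurableSet_Icc fun t ht => ?_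
        have hd : HasMFDerivAt 𝓘(ℝ, ℝ) 𝓘(ℝ, E) (γ ∘ η) t _ :=
          HasMFDerivAt.comp t
            (((hγ.contMDiffAt (hU.mem_nhds (hab (hηs t ht)))).mdifferentiableAt
              one_ne_zero).hasMFDerivAt) (hηd t).hasFDerivAt.hasMFDerivAt
        rw [hd.mfderiv, ← ofReal_norm]
        refine ENNReal.ofReal_le_ofReal ((le_of_eq ?_).trans (hK (η t) (hηs t ht)))
        have h2 : (ContinuousLinearMap.toSpanSingleton ℝ (b - a) : ℝ →L[ℝ] V) 1 = b - a := by simp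
        exact congrArg (fun w : V => ‖mfderiv 𝓘(ℝ, V) 𝓘(ℝ, E) γ (η t) w‖) h2
    _ = ENNReal.ofReal K := by simp

theorem riemannianEDist_chart_symm_le (p : M) {a b : E}
    (hab : segment ℝ a b ⊆ (chartAt E p).target) {K : ℝ} (hK : 0 ≤ K)
    (h : ∀ z ∈ segment ℝ a b, metricCoeff p z (b - a) (b - a) ≤ K * ‖b - a‖ ^ 2) :
    riemannianEDist 𝓘(ℝ, E) ((chartAt E p).symm a) ((chartAt E p).symm b) ≤
      ENNReal.ofReal (√K * ‖b - a‖) := by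
  refine riemannianEDist_le_of_norm_mfderiv_le (chartAt E p).open_target
    (contMDiffOn_chart_symm (n := 1)) hab fun z hz => ?_
  rw [(hasMFDerivAt_chart_symm p (hab hz)).mfderiv]
  refine abs_le_of_sq_le_sq' ?_ (by positivity) |>.2
  rw [mul_pow, Real.sq_sqrt hK]
  exact (metricCoeff_self p z (b - a)).symm.trans_le (h z hz)

-- The strict bound provides a curve from x to y of length less than r, and f maps it to a curve of
-- length at most Kr.
omit [IsManifold 𝓘(ℝ, E) ∞ M] in
theorem riemannianEDist_map_le {N : Type*} [TopologicalSpace N] [ChartedSpace V N]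
    [IsManifold 𝓘(ℝ, V) ∞ N] [RiemannianBundle (fun x : N => TangentSpace 𝓘(ℝ, V) x)] {f : N → M}
    (hf : ContMDiff 𝓘(ℝ, V) 𝓘(ℝ, E) 1 f) {K : ℝ}
    (h : ∀ (x : N) (v : TangentSpace 𝓘(ℝ, V) x), ‖mfderiv 𝓘(ℝ, V) 𝓘(ℝ, E) f x v‖ ≤ K * ‖v‖)
    {x y : N} {r : ENNReal} (hr : riemannianEDist 𝓘(ℝ, V) x y < r) :
    riemannianEDist 𝓘(ℝ, E) (f x) (f y) ≤ ENNReal.ofReal K * r := by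
  obtain ⟨γ, h0, h1, hγ, hlen, -⟩ := exists_lt_locally_constant_of_riemannianEDist_lt hr zero_lt_one
  have h2 : riemannianEDist 𝓘(ℝ, E) (f x) (f y) ≤ pathELength 𝓘(ℝ, E) (f ∘ γ) 0 1 :=
    riemannianEDist_le_pathELength (hf.comp hγ).contMDiffOn (by simp [h0]) (by simp [h1]) zero_le_one
  refine (h2.trans ?_).trans (mul_le_mul_right hlen.le _)
  rw [pathELength_eq_lintegral_mfderiv_Icc, pathELength_eq_lintegral_mfderiv_Icc,
    ← lintegral_const_mul' _ _ ENNReal.ofReal_ne_top]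
  refine lintegral_mono fun t => ?_
  have hd : HasMFDerivAt 𝓘(ℝ, ℝ) 𝓘(ℝ, E) (f ∘ γ) t _ :=
    ((hf.mdifferentiableAt one_ne_zero).hasMFDerivAt).comp t
      ((hγ.mdifferentiableAt one_ne_zero).hasMFDerivAt)
  rw [hd.mfderiv, ← ofReal_norm, ← ofReal_norm, ← ENNReal.ofReal_mul' (norm_nonneg _)]
  exact ENNReal.ofReal_le_ofReal (h (γ t) _)

end Distance

section SurfaceDistance

open Manifold

variable {S : Type*} [TopologicalSpace S] [ChartedSpace ℂ S] [IsManifold 𝓘(ℂ, ℂ) ω S]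
  [RiemannianBundle (fun x : S => TangentSpace 𝓘(ℝ, ℂ) x)]
  {F : Type*} [NormedAddCommGroup F] [NormedSpace ℝ F]
  {M : Type*} [TopologicalSpace M] [ChartedSpace F M] [IsManifold 𝓘(ℝ, F) ∞ M]
  [RiemannianBundle (fun y : M => TangentSpace 𝓘(ℝ, F) y)]

/-- This confines the image of a small disk to one chart of the target, using only a bound for the
energy density. -/
theorem riemannianEDist_map_chart_symm_le (hS : IsHermitianMetric ℂ S) {f : S → M}
    (hf : ContMDiff 𝓘(ℝ, ℂ) 𝓘(ℝ, F) ∞ f) (k : S) {a b : ℂ}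
    (hab : segment ℝ a b ⊆ (chartAt ℂ k).target) {m : ℝ} (hm : 0 ≤ m)
    (h : ∀ z ∈ segment ℝ a b, conformalEnergy F k f z ≤ m) :
    riemannianEDist 𝓘(ℝ, F) (f ((chartAt ℂ k).symm a)) (f ((chartAt ℂ k).symm b)) ≤
      ENNReal.ofReal (√(2 * m) * ‖b - a‖) := by
  refine riemannianEDist_le_of_norm_mfderiv_le (γ := f ∘ (chartAt ℂ k).symm)
    (chartAt ℂ k).open_target
    ((hf.of_le (by simp)).comp_contMDiffOn (contMDiffOn_chart_symm (n := 1))) hab fun z hz => ?_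
  have hd := (((hf ((chartAt ℂ k).symm z)).mdifferentiableAt (by simp)).hasMFDerivAt).comp z
    (hasMFDerivAt_chart_symm k (hab hz))
  rw [hd.mfderiv]
  refine abs_le_of_sq_le_sq' ?_ (by positivity) |>.2
  rw [mul_pow, Real.sq_sqrt (by positivity)]
  refine (norm_mfderiv_sq_le hS k f (hab hz) (b - a)).trans ?_
  have := h z hz
  gcongr

end SurfaceDistance

/-! ### Quantitative bounds for metric coefficients -/

section FlatMetricBounds

variable {E : Type*} [NormedAddCommGroup E] [NormedSpace ℝ E]

/-- The metric coefficients `G` and their derivatives are bounded by `C` at `z`. -/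
structure MetricBound (G : E → E →L[ℝ] E →L[ℝ] ℝ) (C : ℝ) (z : E) : Prop where
  lower : ∀ v : E, ‖v‖ ^ 2 ≤ C * G z v v
  upper : ∀ v : E, G z v v ≤ C * ‖v‖ ^ 2
  deriv : ∀ v a b : E, |fderiv ℝ G z v a b| ≤ C * ‖v‖ * ‖a‖ * ‖b‖

theorem MetricBound.nonneg {G : E → E →L[ℝ] E →L[ℝ] ℝ} {C : ℝ} {z : E} (h : MetricBound G C z)
    (hC : 0 < C) (v : E) : 0 ≤ G z v v :=
  nonneg_of_mul_nonneg_right ((sq_nonneg _).trans (h.lower v)) hC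

theorem MetricBound.mono {G : E → E →L[ℝ] E →L[ℝ] ℝ} {C C' : ℝ} {z : E} (h : MetricBound G C z)
    (hC0 : 0 < C) (hC : C ≤ C') : MetricBound G C' z := by
  refine ⟨fun v => (h.lower v).trans ?_, fun v => (h.upper v).trans ?_, fun v a b =>
    (h.deriv v a b).trans ?_⟩
  · have := h.nonneg hC0 v; gcongr
  · gcongr
  · gcongr

-- Where G differs from G z₀ by less than 1/(2K), half of the lower bound survives, which accounts
-- for 2K in the constant; the other bounds are continuity of G and of its derivative.
set_option maxSynthPendingDepth 3 in
theorem exists_metricBound {G : E → E →L[ℝ] E →L[ℝ] ℝ} {z₀ : E} (hd : ContDiffAt ℝ 1 G z₀) {K : ℝ}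
    (hK0 : 0 < K) (hK : ∀ v : E, ‖v‖ ^ 2 ≤ K * G z₀ v v) :
    ∃ C : ℝ, 1 ≤ C ∧ ∀ᶠ z in 𝓝 z₀, MetricBound G C z := by
  set B := ‖G z₀‖
  set D := ‖fderiv ℝ G z₀‖
  have hB : 0 ≤ B := norm_nonneg _
  set C := 2 * K + B + D + 1 with hC
  have hD : 0 ≤ D := norm_nonneg _
  refine ⟨C, by linarith, ?_⟩
  have e2 : ContinuousAt (fderiv ℝ G) z₀ := (hd.fderiv_right (m := 0) (by simp)).continuousAt
  filter_upwards [Metric.continuousAt_iff'.1 hd.continuousAt (1 / (2 * K)) (by positivity),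
    e2.norm.eventually_lt_const (lt_add_one D),
    hd.continuousAt.norm.eventually_lt_const (lt_add_one B)] with z h1 h2 h3
  refine ⟨fun v => ?_, fun v => ?_, fun v a b => ?_⟩
  · have h4 : |G z v v - G z₀ v v| ≤ 1 / (2 * K) * ‖v‖ * ‖v‖ := by
      rw [← Real.norm_eq_abs]
      rw [dist_eq_norm] at h1
      refine ((G z - G z₀).le_opNorm₂ v v).trans ?_
      gcongr
    have h7 : K * (1 / (2 * K) * ‖v‖ * ‖v‖) = ‖v‖ ^ 2 / 2 := by
      field_simp
    have h8 : ‖v‖ ^ 2 ≤ 2 * K * G z v v := by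
      have := mul_le_mul_of_nonneg_left (abs_le.1 h4).1 hK0.le
      linarith [hK v]
    have h9 : 0 ≤ G z v v := nonneg_of_mul_nonneg_right ((sq_nonneg _).trans h8) (by positivity)
    exact h8.trans (mul_le_mul_of_nonneg_right (by linarith) h9)
  · refine (le_abs_self _).trans (((G z).le_opNorm₂ v v).trans ?_)
    rw [mul_assoc, ← sq]
    have : ‖G z‖ ≤ C := by linarith
    gcongr
  · refine ((fderiv ℝ G z v).le_opNorm₂ a b).trans ?_
    have : ‖fderiv ℝ G z‖ ≤ C := by linarith
    gcongr
    exact ((fderiv ℝ G z).le_opNorm v).trans (by gcongr)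

end FlatMetricBounds

/-! ### Uniform charts on compact manifolds -/

section Uniformity

open Manifold

variable {E : Type*} [NormedAddCommGroup E] [NormedSpace ℝ E] [FiniteDimensional ℝ E]
  {M : Type*} [TopologicalSpace M] [ChartedSpace E M] [IsManifold 𝓘(ℝ, E) ∞ M]
  [RiemannianBundle (fun x : M => TangentSpace 𝓘(ℝ, E) x)]
  [IsContMDiffRiemannianBundle 𝓘(ℝ, E) ∞ E (fun x : M => TangentSpace 𝓘(ℝ, E) x)]

variable (E M) in
omit [FiniteDimensional ℝ E] in
theorem isContinuousRiemannianBundle_tangentSpace :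
    IsContinuousRiemannianBundle E (fun x : M => TangentSpace 𝓘(ℝ, E) x) := by
  obtain ⟨g, hg, h⟩ := IsContMDiffRiemannianBundle.exists_contMDiff (IB := 𝓘(ℝ, E)) (n := ∞) (F := E)
    (E := fun x : M => TangentSpace 𝓘(ℝ, E) x)
  exact ⟨⟨g, hg.continuous, h⟩⟩

-- The Riemannian distance induces the given topology, so the Lebesgue number lemma applies to it.
omit [FiniteDimensional ℝ E] in
theorem exists_lebesgue_number [RegularSpace M] [CompactSpace M] {ι : Sort*} {c : ι → Set M}
    (hc : ∀ i, IsOpen (c i)) (hcov : ∀ y, ∃ i, y ∈ c i) :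
    ∃ δ > (0 : ℝ), ∀ y, ∃ i, ∀ y', riemannianEDist 𝓘(ℝ, E) y y' < ENNReal.ofReal δ → y' ∈ c i := by
  have : IsManifold 𝓘(ℝ, E) 1 M := IsManifold.of_le (n := ∞) (by simp)
  have := isContinuousRiemannianBundle_tangentSpace E M
  let : PseudoEMetricSpace M := PseudoEMetricSpace.ofRiemannianMetric 𝓘(ℝ, E) M
  obtain ⟨δ, hδ, h⟩ := lebesgue_number_lemma_of_emetric (isCompact_univ (X := M)) hc
    (fun y _ => mem_iUnion.2 (hcov y))
  obtain ⟨d, hd0, hd⟩ := ENNReal.lt_iff_exists_real_btwn.1 hδ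
  refine ⟨d, by simpa using hd.1, fun y => ?_⟩
  obtain ⟨i, hi⟩ := h y (mem_univ y)
  refine ⟨i, fun y' hy' => hi ?_⟩
  rw [Metric.mem_eball, edist_comm]
  exact hy'.trans hd.2

/-- The frame at p is an injective linear map between finite-dimensional spaces, hence bounded
below. This is the lower bound that `exists_metricBound` asks for. -/
theorem exists_metricBound_chart (p : M) :
    ∃ C : ℝ, 1 ≤ C ∧ ∀ᶠ z in 𝓝 (chartAt E p p), MetricBound (metricCoeff (E := E) p) C z := by
  obtain ⟨K, hK0, hK⟩ := LinearMap.exists_antilipschitzWith (frame E p p).toLinearMap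
    (LinearMap.ker_eq_bot.2 (by
      intro a b hab
      have : frame E p p a = frame E p p b := hab
      rwa [frame_self_apply, frame_self_apply] at this))
  have hK1 : (0 : ℝ) < K := hK0
  refine exists_metricBound (K := (K : ℝ) ^ 2) (((contDiffOn_metricCoeff p).contDiffAt
    ((chartAt E p).open_target.mem_nhds (mem_chart_target E p))).of_le (by simp)) (by positivity)
    fun v => ?_
  have h1 := hK.le_mul_dist v 0
  rw [dist_zero_right, map_zero, dist_zero_right] at h1
  rw [metricCoeff_self, (chartAt E p).left_inv (mem_chart_source E p), ← mul_pow]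
  exact pow_le_pow_left₀ (norm_nonneg _) h1 2

variable (E M) in
/-- Finitely many coordinate balls cover `M`, with uniform bounds on the balls with twice the
radius. -/
theorem exists_finite_charts [CompactSpace M] : ∃ (t : Finset M) (ρ : M → ℝ) (C : ℝ), 1 ≤ C ∧
    (∀ y, ∃ p ∈ t, y ∈ (chartAt E p).source ∧
      chartAt E p y ∈ Metric.ball (chartAt E p p) (ρ p)) ∧
    ∀ p ∈ t, 1 / C ≤ ρ p ∧ Metric.closedBall (chartAt E p p) (2 * ρ p) ⊆ (chartAt E p).target ∧
      ∀ z ∈ Metric.ball (chartAt E p p) (2 * ρ p), MetricBound (metricCoeff (E := E) p) C z := by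
  have h : ∀ p : M, ∃ (C : ℝ) (r : ℝ), 1 ≤ C ∧ 0 < r ∧
      Metric.closedBall (chartAt E p p) (2 * r) ⊆ (chartAt E p).target ∧
      ∀ z ∈ Metric.ball (chartAt E p p) (2 * r), MetricBound (metricCoeff (E := E) p) C z := by
    intro p
    obtain ⟨C, hC1, hC⟩ := exists_metricBound_chart (E := E) p
    obtain ⟨r, hr, hr'⟩ := Metric.eventually_nhds_iff_ball.1
      (hC.and ((chartAt E p).open_target.mem_nhds (mem_chart_target E p)))
    -- With r/4 even the closed ball of twice the radius stays inside the ball of radius r.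
    refine ⟨C, r / 4, hC1, by positivity, fun z hz => (hr' z ?_).2, fun z hz => (hr' z ?_).1⟩
    · exact Metric.closedBall_subset_ball (by linarith) hz
    · exact Metric.ball_subset_ball (by linarith) hz
  choose C ρ hC1 hρ hsub hbd using h
  obtain ⟨t, ht⟩ := (isCompact_univ (X := M)).elim_finite_subcover
    (fun p : M => (chartAt E p).source ∩ chartAt E p ⁻¹' Metric.ball (chartAt E p p) (ρ p))
    (fun p => (chartAt E p).isOpen_inter_preimage Metric.isOpen_ball)
    (fun y _ => mem_iUnion.2 ⟨y, mem_chart_source E y, Metric.mem_ball_self (hρ y)⟩)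
  obtain ⟨C₁, hC₁⟩ := (t.image C).exists_le
  obtain ⟨C₂, hC₂⟩ := (t.image fun p => 1 / ρ p).exists_le
  refine ⟨t, ρ, max 1 (max C₁ C₂), le_max_left _ _, fun y => ?_,
    fun p hp => ⟨?_, hsub p, fun z hz => ?_⟩⟩
  · obtain ⟨p, hp, hy⟩ := mem_iUnion₂.1 (ht (mem_univ y))
    exact ⟨p, hp, hy⟩
  · have h1 := (hC₂ _ (Finset.mem_image_of_mem _ hp)).trans
      ((le_max_right C₁ C₂).trans (le_max_right 1 _))
    exact (one_div_le (by positivity) (hρ p)).2 h1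
  · exact (hbd p z hz).mono (zero_lt_one.trans_le (hC1 p))
      ((hC₁ _ (Finset.mem_image_of_mem _ hp)).trans ((le_max_left C₁ C₂).trans (le_max_right 1 _)))

variable (E M) in
/-- Uniform coordinates on the balls of a fixed radius. -/
theorem exists_uniform_charts [RegularSpace M] [CompactSpace M] :
    ∃ C : ℝ, 1 ≤ C ∧ ∀ η > 0, ∃ δ > (0 : ℝ), ∀ y : M, ∃ l : M, ∀ y', riemannianEDist 𝓘(ℝ, E) y y' < ENNReal.ofReal δ →
      y' ∈ (chartAt E l).source ∧ MetricBound (metricCoeff (E := E) l) C (chartAt E l y') ∧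
      ‖chartAt E l y' - chartAt E l y‖ ≤ η := by
  obtain ⟨t, ρ, C, hC, hcov, ht⟩ := exists_finite_charts E M
  refine ⟨C, hC, fun η hη => ?_⟩
  have hpos : ∀ p ∈ t, 0 < ρ p := fun p hp => lt_of_lt_of_le (by positivity) (ht p hp).1
  -- The second index is the centre of a coordinate ball of radius η/2, so two points in one set of
  -- the cover have coordinates at distance at most η. The constant C does not involve η, which the
  -- gap theorem chooses in terms of C.
  obtain ⟨δ, hδ, h⟩ := exists_lebesgue_number (E := E) (M := M) (ι := t × E)
    (c := fun i => (chartAt E i.1.1).source ∩ chartAt E i.1.1 ⁻¹'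
      (Metric.ball (chartAt E i.1.1 i.1.1) (2 * ρ i.1) ∩ Metric.ball i.2 (η / 2)))
    (fun i => (chartAt E i.1.1).isOpen_inter_preimage (Metric.isOpen_ball.inter Metric.isOpen_ball))
    (fun y => by
      obtain ⟨p, hp, hy, hy'⟩ := hcov y
      refine ⟨(⟨p, hp⟩, chartAt E p y), hy, Metric.ball_subset_ball ?_ hy',
        Metric.mem_ball_self (by positivity)⟩
      linarith [hpos p hp])
  refine ⟨δ, hδ, fun y => ?_⟩
  obtain ⟨⟨⟨p, hp⟩, w⟩, hi⟩ := h y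
  have hy := hi y (by rw [riemannianEDist_self]; simpa using hδ)
  refine ⟨p, fun y' hy' => ?_⟩
  have h' := hi y' hy'
  refine ⟨h'.1, (ht p hp).2.2 _ h'.2.1, ?_⟩
  rw [← dist_eq_norm]
  have h1 : dist (chartAt E p y') w < η / 2 := h'.2.2
  have h2 : dist (chartAt E p y) w < η / 2 := hy.2.2
  linarith [dist_triangle_right (chartAt E p y') (chartAt E p y) w]

end Uniformity

/-! ### The area measure -/

theorem det_of_map_I {L : ℂ →L[ℝ] ℂ} (hL : ∀ v, L (Complex.I • v) = Complex.I • L v) :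
    L.det = ‖L 1‖ ^ 2 := by
  have h1 : (L : ℂ →ₗ[ℝ] ℂ) = LinearMap.mul ℝ ℂ (L 1) := by
    ext1 v
    have hv : v = v.re • (1 : ℂ) + v.im • (Complex.I • (1 : ℂ)) := by
      simp
    conv_lhs => rw [hv]
    have h2 : L (v.re • (1 : ℂ) + v.im • (Complex.I • (1 : ℂ))) =
        v.re • L 1 + v.im • (Complex.I • L 1) := by rw [map_add, map_smul, map_smul, hL]
    refine h2.trans ?_
    rw [LinearMap.mul_apply', Complex.real_smul, Complex.real_smul, smul_eq_mul, ← mul_assoc,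
      ← add_mul, Complex.re_add_im, mul_comm]
  rw [ContinuousLinearMap.det, h1, ← Complex.normSq_eq_norm_sq, ← Algebra.norm_complex_apply]
  rfl

section Area

variable {S : Type*} [TopologicalSpace S] [ChartedSpace ℂ S] [IsManifold 𝓘(ℂ, ℂ) ω S]
  [RiemannianBundle (fun x : S => TangentSpace 𝓘(ℝ, ℂ) x)]

theorem inner_frame_one_I (hS : IsHermitianMetric ℂ S) (k : S) {z : ℂ}
    (hz : z ∈ (chartAt ℂ k).target) : metricCoeff k z 1 Complex.I = 0 := by
  have h := frame_I k ((chartAt ℂ k).map_target hz) 1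
  rw [smul_eq_mul, mul_one] at h
  rw [metricCoeff_apply, h, inner_tangentJ_self hS]

/-- A Hermitian metric on a surface is conformal. -/
theorem metricCoeff_eq_mul_norm_sq (hS : IsHermitianMetric ℂ S) (k : S) {z : ℂ}
    (hz : z ∈ (chartAt ℂ k).target) (a : ℂ) :
    metricCoeff k z a a = metricCoeff k z 1 1 * ‖a‖ ^ 2 := by
  have h0 := inner_frame_one_I hS k hz
  have h1 := metricCoeff_I hS k hz 1 1
  rw [smul_eq_mul, mul_one] at h1
  set G : ℂ →L[ℝ] ℂ →L[ℝ] ℝ := metricCoeff k z with hG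
  have h2 : G Complex.I 1 = 0 := by rw [← h0]; exact metricCoeff_symm k z _ _
  have ha : a = a.re • (1 : ℂ) + a.im • Complex.I := by simp
  have h3 : ‖a‖ ^ 2 = a.re ^ 2 + a.im ^ 2 := by
    rw [← Complex.normSq_eq_norm_sq, Complex.normSq_apply]; ring
  rw [h3]
  conv_lhs => rw [ha]
  simp only [map_add, map_smul, _root_.add_apply, _root_.smul_apply, smul_eq_mul]
  rw [h0, h1, h2]
  ring

theorem areaDensity_eq (hS : IsHermitianMetric ℂ S) (k : S) {z : ℂ}
    (hz : z ∈ (chartAt ℂ k).target) : areaDensity k z = metricCoeff k z 1 1 := by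
  have hy := (chartAt ℂ k).map_target hz
  have h : ∀ u : ℂ, coordField k u ((chartAt ℂ k).symm z) = frame ℂ k ((chartAt ℂ k).symm z) u :=
    fun u => extend_eq_frame k _ hy
  have h1 := metricCoeff_I hS k hz 1 1
  rw [smul_eq_mul, mul_one] at h1
  have h2 : areaDensity k z = √(metricCoeff k z 1 1 * metricCoeff k z Complex.I Complex.I -
      metricCoeff k z 1 Complex.I ^ 2) := by
    simp only [areaDensity, h]
    rfl
  rw [h2, h1, inner_frame_one_I hS k hz, zero_pow two_ne_zero, sub_zero, Real.sqrt_mul_self]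
  rw [metricCoeff_self]; positivity

theorem continuousOn_conformalFactor
    [IsContMDiffRiemannianBundle 𝓘(ℝ, ℂ) ∞ ℂ (fun x : S => TangentSpace 𝓘(ℝ, ℂ) x)] (p : S) :
    ContinuousOn (fun z => metricCoeff p z 1 1) (chartAt ℂ p).target :=
  ((contDiffOn_metricCoeff p).continuousOn.clm_apply continuousOn_const).clm_apply continuousOn_const

variable [MeasurableSpace S]

/-- The area measure of the domain of a chart. -/
def chartArea (p : S) : Measure S :=
  (((volume : Measure ℂ).restrict (chartAt ℂ p).target).withDensity
    fun z => ENNReal.ofReal (areaDensity p z)).map (chartAt ℂ p).symm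

theorem chartArea_le (p : S) : chartArea p ≤ areaMeasure S := le_iSup (fun p : S => chartArea p) p

variable [BorelSpace S]

omit [IsManifold 𝓘(ℂ, ℂ) ω S] [RiemannianBundle (fun x : S => TangentSpace 𝓘(ℝ, ℂ) x)] in
theorem measurableSet_target_inter_preimage (p : S) {A : Set S} (hA : MeasurableSet A) :
    MeasurableSet ((chartAt ℂ p).target ∩ (chartAt ℂ p).symm ⁻¹' A) := by
  have h1 := (continuousOn_iff_continuous_domRestrict.1 (chartAt ℂ p).continuousOn_symm).measurable hA
  have h2 := (chartAt ℂ p).open_target.measurableSet.subtype_image h1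
  convert h2 using 1
  ext z
  simp [and_comm]

omit [IsManifold 𝓘(ℂ, ℂ) ω S] [RiemannianBundle (fun x : S => TangentSpace 𝓘(ℝ, ℂ) x)] in
theorem aemeasurable_chart_symm (p : S) : AEMeasurable (chartAt ℂ p).symm
    ((volume : Measure ℂ).restrict (chartAt ℂ p).target) :=
  (chartAt ℂ p).continuousOn_symm.aemeasurable (chartAt ℂ p).open_target.measurableSet

variable [IsContMDiffRiemannianBundle 𝓘(ℝ, ℂ) ∞ ℂ (fun x : S => TangentSpace 𝓘(ℝ, ℂ) x)]

omit [MeasurableSpace S] [BorelSpace S] in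
theorem aemeasurable_areaDensity (hS : IsHermitianMetric ℂ S) (p : S) :
    AEMeasurable (fun z => ENNReal.ofReal (areaDensity p z))
      ((volume : Measure ℂ).restrict (chartAt ℂ p).target) := by
  have h := (continuousOn_conformalFactor p).aemeasurable (μ := volume)
    (chartAt ℂ p).open_target.measurableSet
  refine (h.congr ?_).ennreal_ofReal
  filter_upwards [self_mem_ae_restrict (chartAt ℂ p).open_target.measurableSet] with z hz
  rw [areaDensity_eq hS p hz]

theorem lintegral_chartArea (hS : IsHermitianMetric ℂ S) (p : S) {g : S → ENNReal}
    (hg : Measurable g) :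
    ∫⁻ y, g y ∂(chartArea p) = ∫⁻ z in (chartAt ℂ p).target,
      ENNReal.ofReal (metricCoeff p z 1 1) * g ((chartAt ℂ p).symm z) := by
  have h1 := (aemeasurable_chart_symm p).mono_ac (withDensity_absolutelyContinuous _
    fun z => ENNReal.ofReal (areaDensity p z))
  rw [chartArea, lintegral_map' hg.aemeasurable h1,
    lintegral_withDensity_eq_lintegral_mul₀ (g := fun z => g ((chartAt ℂ p).symm z))
      (aemeasurable_areaDensity hS p)
      (hg.comp_aemeasurable (aemeasurable_chart_symm p))]
  refine setLIntegral_congr_fun (chartAt ℂ p).open_target.measurableSet fun z hz => ?_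
  simp only [Pi.mul_apply, areaDensity_eq hS p hz]

theorem chartArea_apply (hS : IsHermitianMetric ℂ S) (p : S) {A : Set S} (hA : MeasurableSet A) :
    chartArea p A = ∫⁻ z in (chartAt ℂ p).target ∩ (chartAt ℂ p).symm ⁻¹' A,
      ENNReal.ofReal (metricCoeff p z 1 1) := by
  have h1 := lintegral_chartArea hS p (g := A.indicator 1) (measurable_one.indicator hA)
  rw [lintegral_indicator_one hA] at h1
  have hm : MeasurableSet ((chartAt ℂ p).target ∩ (chartAt ℂ p).symm ⁻¹' A) :=
    measurableSet_target_inter_preimage p hA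
  rw [h1, ← lintegral_indicator (chartAt ℂ p).open_target.measurableSet, ← lintegral_indicator hm]
  congr 1
  ext z
  by_cases h2 : z ∈ (chartAt ℂ p).target <;> by_cases h3 : (chartAt ℂ p).symm z ∈ A <;>
    simp [indicator, h2, h3]

/-- Change of variables by the transition map: its Jacobian |τ'|² is the ratio of the two conformal
factors. The inequality suffices for bounding the supremum of the chart measures. -/
theorem chartArea_le_of_subset (hS : IsHermitianMetric ℂ S) (p q : S) {A : Set S}
    (hA : MeasurableSet A) (hq : A ⊆ (chartAt ℂ q).source) : chartArea p A ≤ chartArea q A := by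
  rw [chartArea_apply hS p hA, chartArea_apply hS q hA]
  set T := (chartAt ℂ p).target ∩ (chartAt ℂ p).symm ⁻¹' A with hT
  have hTm : MeasurableSet T := measurableSet_target_inter_preimage p hA
  set τ := chartAt ℂ q ∘ (chartAt ℂ p).symm with hτ
  have hTs : ∀ z ∈ T, z ∈ (chartAt ℂ p).target ∩ (chartAt ℂ p).symm ⁻¹' (chartAt ℂ q).source :=
    fun z hz => ⟨hz.1, hq hz.2⟩
  have himg : τ '' T ⊆ (chartAt ℂ q).target ∩ (chartAt ℂ q).symm ⁻¹' A := by
    rintro _ ⟨z, hz, rfl⟩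
    refine ⟨(chartAt ℂ q).map_source (hTs z hz).2, ?_⟩
    rw [mem_preimage, hτ, Function.comp_apply, (chartAt ℂ q).left_inv (hTs z hz).2]
    exact hz.2
  have hinj : InjOn τ T := fun z hz w hw h =>
    (chartAt ℂ p).symm.injOn hz.1 hw.1 ((chartAt ℂ q).injOn (hTs z hz).2 (hTs w hw).2 h)
  refine le_trans (le_of_eq ?_) (lintegral_mono_set himg)
  rw [lintegral_image_eq_lintegral_abs_det_fderiv_mul volume hTm
    (fun z hz => (frame_eq_frame_fderiv p q hz.1 (hTs z hz).2).1.hasFDerivWithinAt) hinj]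
  refine setLIntegral_congr_fun hTm fun z hz => ?_
  have hz' := hTs z hz
  have h1 := metricCoeff_eq_mul_norm_sq hS q ((chartAt ℂ q).map_source hz'.2)
    (fderiv ℝ (chartAt ℂ q ∘ (chartAt ℂ p).symm) z 1)
  rw [metricCoeff_transition p q hz'.1 hz'.2, Function.comp_apply, h1,
    det_of_map_I (fderiv_transition_I p q hz'), abs_of_nonneg (by positivity),
    ← ENNReal.ofReal_mul (by positivity), mul_comm]

/-- Finiteness is needed because `energy` is a Bochner integral, which is 0 by convention for a
density that is not integrable. Every chart measure is bounded by the sum of the finitely many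
measures of a cover, restricted to coordinate balls on which the conformal factor is bounded. -/
theorem isFiniteMeasure_areaMeasure [CompactSpace S] (hS : IsHermitianMetric ℂ S) :
    IsFiniteMeasure (areaMeasure S) := by
  obtain ⟨t, ρ, C, hC, hcov, ht⟩ := exists_finite_charts ℂ S
  let U : S → Set S := fun q => (chartAt ℂ q).source ∩
    chartAt ℂ q ⁻¹' Metric.ball (chartAt ℂ q q) (ρ q)
  have hU : ∀ q, MeasurableSet (U q) := fun q =>
    ((chartAt ℂ q).isOpen_inter_preimage Metric.isOpen_ball).measurableSet
  have hle : areaMeasure S ≤ ∑ q ∈ t, (chartArea q).restrict (U q) := by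
    refine iSup_le fun p => Measure.le_iff.2 fun A hA => ?_
    change chartArea p A ≤ _
    have hA' : A ⊆ ⋃ q ∈ t, A ∩ U q := fun y hy => by
      obtain ⟨q, hq, h⟩ := hcov y
      exact mem_iUnion₂.2 ⟨q, hq, hy, h⟩
    rw [Measure.finsetSum_apply]
    refine (measure_mono hA').trans ((measure_biUnion_finset_le t _).trans ?_)
    refine Finset.sum_le_sum fun q _ => ?_
    rw [Measure.restrict_apply hA]
    exact chartArea_le_of_subset hS p q (hA.inter (hU q)) (inter_subset_right.trans inter_subset_left)
  refine ⟨(hle univ).trans_lt ?_⟩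
  rw [Measure.finsetSum_apply, ENNReal.sum_lt_top]
  intro q hq
  rw [Measure.restrict_apply MeasurableSet.univ, univ_inter, chartArea_apply hS q (hU q)]
  have hρ : 0 < ρ q := lt_of_lt_of_le (by positivity) (ht q hq).1
  have hsub : (chartAt ℂ q).target ∩ (chartAt ℂ q).symm ⁻¹' U q ⊆
      Metric.ball (chartAt ℂ q q) (ρ q) := fun z hz => by
    have := hz.2.2
    rwa [mem_preimage, (chartAt ℂ q).right_inv hz.1] at this
  calc _ ≤ ∫⁻ z in Metric.ball (chartAt ℂ q q) (ρ q), ENNReal.ofReal (metricCoeff q z 1 1) :=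
        lintegral_mono_set hsub
    _ ≤ ∫⁻ _ in Metric.ball (chartAt ℂ q q) (ρ q), ENNReal.ofReal C := by
        refine setLIntegral_mono' Metric.isOpen_ball.measurableSet fun z hz =>
          ENNReal.ofReal_le_ofReal ?_
        have := ((ht q hq).2.2 z (Metric.ball_subset_ball (by linarith) hz)).upper 1
        simpa using this
    _ < ⊤ := by
        rw [setLIntegral_const]
        exact ENNReal.mul_lt_top ENNReal.ofReal_lt_top measure_ball_lt_top

end Area

/-! ### Comparison of the energy with integrals in coordinates -/

section Energy

variable {S : Type*} [TopologicalSpace S] [ChartedSpace ℂ S] [IsManifold 𝓘(ℂ, ℂ) ω S]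
  [RiemannianBundle (fun x : S => TangentSpace 𝓘(ℝ, ℂ) x)]
  [IsContMDiffRiemannianBundle 𝓘(ℝ, ℂ) ∞ ℂ (fun x : S => TangentSpace 𝓘(ℝ, ℂ) x)]
  {F : Type*} [NormedAddCommGroup F] [NormedSpace ℝ F] [FiniteDimensional ℝ F]
  {M : Type*} [TopologicalSpace M] [ChartedSpace F M] [IsManifold 𝓘(ℝ, F) ∞ M]
  [RiemannianBundle (fun y : M => TangentSpace 𝓘(ℝ, F) y)]
  [IsContMDiffRiemannianBundle 𝓘(ℝ, F) ∞ F (fun y : M => TangentSpace 𝓘(ℝ, F) y)]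

set_option maxSynthPendingDepth 3 in
omit [IsContMDiffRiemannianBundle 𝓘(ℝ, ℂ) ∞ ℂ (fun x : S => TangentSpace 𝓘(ℝ, ℂ) x)] in
theorem continuousAt_conformalEnergy (hS : IsHermitianMetric ℂ S) {f : S → M}
    (hf : ContMDiff 𝓘(ℝ, ℂ) 𝓘(ℝ, F) ∞ f) (k : S) {z : ℂ} (hz : z ∈ (chartAt ℂ k).target) :
    ContinuousAt (conformalEnergy F k f) z := by
  set l := f ((chartAt ℂ k).symm z) with hl
  have hfc : ContinuousAt (fun z => f ((chartAt ℂ k).symm z)) z :=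
    hf.continuous.continuousAt.comp ((chartAt ℂ k).symm.continuousAt hz)
  have h1 : conformalEnergy F k f =ᶠ[𝓝 z] fun z => (1 / 2) *
      (metricCoeff l (coordMap k l f z) (fderiv ℝ (coordMap k l f : ℂ → F) z 1)
        (fderiv ℝ (coordMap k l f : ℂ → F) z 1) +
      metricCoeff l (coordMap k l f z) (fderiv ℝ (coordMap k l f : ℂ → F) z Complex.I)
        (fderiv ℝ (coordMap k l f : ℂ → F) z Complex.I)) := by
    filter_upwards [(chartAt ℂ k).open_target.mem_nhds hz,
      hfc.preimage_mem_nhds ((chartAt F l).open_source.mem_nhds (mem_chart_source F l))] with z' h h'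
    exact conformalEnergy_eq_metricCoeff hS hf k l h h'
  refine ContinuousAt.congr ?_ h1.symm
  have hu : ContDiffAt ℝ ∞ (coordMap k l f : ℂ → F) z :=
    contDiffAt_coordMap hf k l hz (mem_chart_source F l)
  have hG : ContinuousAt (fun z => metricCoeff (E := F) l (coordMap k l f z)) z :=
    ContinuousAt.comp (f := (coordMap k l f : ℂ → F)) (g := metricCoeff (E := F) l)
      ((contDiffOn_metricCoeff l).contDiffAt
        ((chartAt F l).open_target.mem_nhds (mem_chart_target F l))).continuousAt hu.continuousAt
  have hD : ∀ a, ContinuousAt (fun z => fderiv ℝ (coordMap k l f : ℂ → F) z a) z := fun a =>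
    (hu.fderiv_right (m := 0) (by simp)).continuousAt.clm_apply continuousAt_const
  exact ((hG.clm_apply (hD 1)).clm_apply (hD 1)).add
    ((hG.clm_apply (hD Complex.I)).clm_apply (hD Complex.I)) |>.const_mul _

omit [IsContMDiffRiemannianBundle 𝓘(ℝ, ℂ) ∞ ℂ (fun x : S => TangentSpace 𝓘(ℝ, ℂ) x)] in
theorem conformalFactor_pos (k : S) {z : ℂ} (hz : z ∈ (chartAt ℂ k).target) :
    0 < metricCoeff k z 1 1 := by
  rw [metricCoeff_self]
  exact pow_pos (norm_pos_iff.2 (frame_ne_zero k ((chartAt ℂ k).map_target hz))) 2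

omit [IsContMDiffRiemannianBundle 𝓘(ℝ, ℂ) ∞ ℂ (fun x : S => TangentSpace 𝓘(ℝ, ℂ) x)]
  [FiniteDimensional ℝ F]
  [IsContMDiffRiemannianBundle 𝓘(ℝ, F) ∞ F (fun y : M => TangentSpace 𝓘(ℝ, F) y)] in
theorem energyDensity_eq (f : S → M) (k : S) {x : S} (hx : x ∈ (chartAt ℂ k).source) :
    energyDensity ℂ F f x =
      conformalEnergy F k f (chartAt ℂ k x) / metricCoeff k (chartAt ℂ k x) 1 1 := by
  rw [conformalEnergy, (chartAt ℂ k).left_inv hx,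
    mul_div_cancel_left₀ _ (conformalFactor_pos k ((chartAt ℂ k).map_source hx)).ne']

omit [IsManifold 𝓘(ℂ, ℂ) ω S]
  [IsContMDiffRiemannianBundle 𝓘(ℝ, ℂ) ∞ ℂ (fun x : S => TangentSpace 𝓘(ℝ, ℂ) x)]
  [FiniteDimensional ℝ F] [IsManifold 𝓘(ℝ, F) ∞ M]
  [IsContMDiffRiemannianBundle 𝓘(ℝ, F) ∞ F (fun y : M => TangentSpace 𝓘(ℝ, F) y)] in
theorem energyDensity_nonneg (f : S → M) (x : S) : 0 ≤ energyDensity ℂ F f x := by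
  unfold energyDensity; positivity

theorem continuous_energyDensity (hS : IsHermitianMetric ℂ S) {f : S → M}
    (hf : ContMDiff 𝓘(ℝ, ℂ) 𝓘(ℝ, F) ∞ f) : Continuous (energyDensity ℂ F f) := by
  refine continuous_iff_continuousAt.2 fun x => ?_
  have h1 : energyDensity ℂ F f =ᶠ[𝓝 x] fun y =>
      conformalEnergy F x f (chartAt ℂ x y) / metricCoeff x (chartAt ℂ x y) 1 1 := by
    filter_upwards [(chartAt ℂ x).open_source.mem_nhds (mem_chart_source ℂ x)] with y hy
    exact energyDensity_eq f x hy
  refine ContinuousAt.congr ?_ h1.symm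
  have hc := (chartAt ℂ x).continuousAt (mem_chart_source ℂ x)
  have ht := mem_chart_target ℂ x
  refine ContinuousAt.div
    (ContinuousAt.comp (f := chartAt ℂ x) (continuousAt_conformalEnergy hS hf x ht) hc)
    (ContinuousAt.comp (f := chartAt ℂ x) (g := fun z => metricCoeff x z 1 1)
      ((continuousOn_conformalFactor x).continuousAt ((chartAt ℂ x).open_target.mem_nhds ht)) hc)
    (conformalFactor_pos x ht).ne'

variable [MeasurableSpace S] [BorelSpace S] [CompactSpace S]

theorem ofReal_energy_eq (hS : IsHermitianMetric ℂ S) {f : S → M}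
    (hf : ContMDiff 𝓘(ℝ, ℂ) 𝓘(ℝ, F) ∞ f) (D : Set S) :
    ENNReal.ofReal (energy F f D) =
      ∫⁻ x in D, ENNReal.ofReal (energyDensity ℂ F f x) ∂(areaMeasure S) := by
  have := isFiniteMeasure_areaMeasure hS
  obtain ⟨C, hC⟩ := (isCompact_range (continuous_energyDensity hS hf)).isBounded.exists_norm_le
  refine ofReal_integral_eq_lintegral_ofReal ?_
    (Filter.Eventually.of_forall fun x => energyDensity_nonneg f x)
  exact Integrable.of_bound (continuous_energyDensity hS hf).measurable.aestronglyMeasurable C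
    (Filter.Eventually.of_forall fun x => hC _ (mem_range_self x))

omit [BorelSpace S] [CompactSpace S]
  [IsContMDiffRiemannianBundle 𝓘(ℝ, ℂ) ∞ ℂ (fun x : S => TangentSpace 𝓘(ℝ, ℂ) x)]
  [FiniteDimensional ℝ F]
  [IsContMDiffRiemannianBundle 𝓘(ℝ, F) ∞ F (fun y : M => TangentSpace 𝓘(ℝ, F) y)] in
theorem energy_nonneg (f : S → M) (D : Set S) : 0 ≤ energy F f D :=
  integral_nonneg fun x => energyDensity_nonneg f x

theorem lintegral_conformalEnergy_le (hS : IsHermitianMetric ℂ S) {f : S → M}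
    (hf : ContMDiff 𝓘(ℝ, ℂ) 𝓘(ℝ, F) ∞ f) (k : S) {B : Set ℂ} (hB : IsOpen B)
    (hBk : B ⊆ (chartAt ℂ k).target) {D : Set S} (hD : ∀ z ∈ B, (chartAt ℂ k).symm z ∈ D) :
    ∫⁻ z in B, ENNReal.ofReal (conformalEnergy F k f z) ≤ ENNReal.ofReal (energy F f D) := by
  rw [ofReal_energy_eq hS hf]
  -- The image A of B is open and replaces D, which need not be measurable.
  set A : Set S := (chartAt ℂ k).source ∩ chartAt ℂ k ⁻¹' B with hA
  have hAm : MeasurableSet A := ((chartAt ℂ k).isOpen_inter_preimage hB).measurableSet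
  have hAD : A ⊆ D := fun x hx => by
    have := hD _ hx.2
    rwa [(chartAt ℂ k).left_inv hx.1] at this
  set e : S → ENNReal := fun x => ENNReal.ofReal (energyDensity ℂ F f x) with he
  have hem : Measurable e := (continuous_energyDensity hS hf).measurable.ennreal_ofReal
  calc _ = ∫⁻ z in B, ENNReal.ofReal (metricCoeff k z 1 1) *
          A.indicator e ((chartAt ℂ k).symm z) := by
        refine setLIntegral_congr_fun hB.measurableSet fun z hz => ?_
        have hzA : (chartAt ℂ k).symm z ∈ A := ⟨(chartAt ℂ k).map_target (hBk hz), by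
          rw [mem_preimage, (chartAt ℂ k).right_inv (hBk hz)]; exact hz⟩
        rw [indicator_of_mem hzA, he, conformalEnergy,
          ENNReal.ofReal_mul (conformalFactor_pos k (hBk hz)).le]
    _ ≤ ∫⁻ z in (chartAt ℂ k).target, ENNReal.ofReal (metricCoeff k z 1 1) *
          A.indicator e ((chartAt ℂ k).symm z) := lintegral_mono_set hBk
    _ = ∫⁻ x, A.indicator e x ∂(chartArea k) :=
        (lintegral_chartArea hS k (hem.indicator hAm)).symm
    _ ≤ ∫⁻ x, A.indicator e x ∂(areaMeasure S) := lintegral_mono' (chartArea_le k) le_rfl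
    _ = ∫⁻ x in A, e x ∂(areaMeasure S) := lintegral_indicator hAm _
    _ ≤ ∫⁻ x in D, e x ∂(areaMeasure S) := lintegral_mono_set hAD

end Energy

/-! ### Boundedness of the distance -/

section Diameter

open Manifold

variable (E M : Type*) [NormedAddCommGroup E] [NormedSpace ℝ E]
  [TopologicalSpace M] [ChartedSpace E M] [IsManifold 𝓘(ℝ, E) ∞ M]
  [RiemannianBundle (fun x : M => TangentSpace 𝓘(ℝ, E) x)]
  [IsContMDiffRiemannianBundle 𝓘(ℝ, E) ∞ E (fun x : M => TangentSpace 𝓘(ℝ, E) x)]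

/-- A compact connected Riemannian manifold is bounded. -/
theorem exists_riemannianEDist_lt [RegularSpace M] [CompactSpace M] [ConnectedSpace M] :
    ∃ D > (0 : ℝ), ∀ x y : M, riemannianEDist 𝓘(ℝ, E) x y < ENNReal.ofReal D := by
  have : IsManifold 𝓘(ℝ, E) 1 M := IsManifold.of_le (n := ∞) (by simp)
  have := isContinuousRiemannianBundle_tangentSpace E M
  let : PseudoEMetricSpace M := PseudoEMetricSpace.ofRiemannianMetric 𝓘(ℝ, E) M
  obtain ⟨p⟩ : Nonempty M := inferInstance
  -- The distance may a priori be infinite. By the triangle inequality the unit ball about a point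
  -- at infinite distance from p consists of such points, so connectedness applies.
  have hclopen : IsClopen {y : M | edist y p < ⊤} := by
    refine ⟨⟨?_⟩, isOpen_lt (continuous_id.edist continuous_const) continuous_const⟩
    refine EMetric.isOpen_iff.2 fun y hy => ⟨1, one_pos, fun y' hy' h => hy ?_⟩
    rw [Metric.mem_eball, edist_comm] at hy'
    exact (edist_triangle y y' p).trans_lt (ENNReal.add_lt_top.2 ⟨hy'.trans ENNReal.one_lt_top, h⟩)
  have huniv := hclopen.eq_univ ⟨p, by simp⟩
  obtain ⟨q, -, hq⟩ := isCompact_univ.exists_isMaxOn ⟨p, mem_univ p⟩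
    (continuous_id.edist (continuous_const (y := p))).continuousOn
  have hq' : edist q p < ⊤ := by have := mem_univ q; rwa [← huniv] at this
  set d := (edist q p).toReal with hd
  have hd0 : 0 ≤ d := ENNReal.toReal_nonneg
  have h1 : ∀ y, edist y p ≤ ENNReal.ofReal d := fun y => by
    rw [hd, ENNReal.ofReal_toReal hq'.ne]; exact hq (mem_univ y)
  refine ⟨d + d + 1, by positivity, fun x y => ?_⟩
  change edist x y < _
  refine (edist_triangle_right x y p).trans_lt ((add_le_add (h1 x) (h1 y)).trans_lt ?_)
  rw [← ENNReal.ofReal_add hd0 hd0, ENNReal.ofReal_lt_ofReal_iff (by positivity)]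
  linarith

end Diameter

/-! ### The estimate on coordinate disks -/

section LocalEstimate

open Manifold

variable {S : Type*} [TopologicalSpace S] [ChartedSpace ℂ S] [IsManifold 𝓘(ℂ, ℂ) ω S]
  [RiemannianBundle (fun x : S => TangentSpace 𝓘(ℝ, ℂ) x)]
  [IsContMDiffRiemannianBundle 𝓘(ℝ, ℂ) ∞ ℂ (fun x : S => TangentSpace 𝓘(ℝ, ℂ) x)]
  {F : Type*} [NormedAddCommGroup F] [NormedSpace ℂ F] [NormedSpace ℝ F] [IsScalarTower ℝ ℂ F]
  [FiniteDimensional ℝ F]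
  {M : Type*} [TopologicalSpace M] [ChartedSpace F M] [IsManifold 𝓘(ℂ, F) ω M]
  [RiemannianBundle (fun y : M => TangentSpace 𝓘(ℝ, F) y)]
  [IsContMDiffRiemannianBundle 𝓘(ℝ, F) ∞ F (fun y : M => TangentSpace 𝓘(ℝ, F) y)]

theorem norm_flatLaplacian_coordMap_le (hS : IsHermitianMetric ℂ S) (hM : IsHermitianMetric F M)
    {f : S → M} (hf : IsChernHarmonic F f) (k : S) (l : M) {z : ℂ} (hz : z ∈ (chartAt ℂ k).target)
    (hl : f ((chartAt ℂ k).symm z) ∈ (chartAt F l).source) {C : ℝ} (hC : 1 ≤ C)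
    (hb : MetricBound (metricCoeff (E := F) l) C (coordMap k l f z)) :
    ‖flatLaplacian (coordMap k l f : ℂ → F) z‖ ≤ C ^ 2 *
      (‖fderiv ℝ (coordMap k l f : ℂ → F) z 1‖ ^ 2 +
        ‖fderiv ℝ (coordMap k l f : ℂ → F) z Complex.I‖ ^ 2) :=
  norm_flatLaplacian_le (G := metricCoeff (E := F) l) (by linarith)
    (flatTension_eq_zero hS hM hf k l hz hl) hb.lower hb.deriv

/-- On a coordinate disk on which the image of a Chern-harmonic map is small, the energy is bounded
from below in terms of the energy density at the center. -/
theorem ofReal_le_lintegral_conformalEnergy (hS : IsHermitianMetric ℂ S)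
    (hM : IsHermitianMetric F M) {C δ : ℝ} (hC : 1 ≤ C)
    (hδ : ∀ y : M, ∃ l : M, ∀ y', riemannianEDist 𝓘(ℝ, F) y y' < ENNReal.ofReal δ →
      y' ∈ (chartAt F l).source ∧ MetricBound (metricCoeff (E := F) l) C (chartAt F l y'))
    {f : S → M} (hf : IsChernHarmonic F f) (k : S) {c : ℂ} {t m : ℝ} (ht : 0 < t) (hm : 0 < m)
    (hk : Metric.ball c t ⊆ (chartAt ℂ k).target)
    (h4 : ∀ z ∈ Metric.ball c t, conformalEnergy F k f z ≤ 4 * m)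
    (hc : conformalEnergy F k f c = m)
    (htm : t * √m ≤ 1 / (64 * (2 * C ^ 2) ^ 3)) (htδ : 3 * (t * √m) < δ) :
    ENNReal.ofReal (m * t ^ 2 / (8 * (2 * C ^ 2) ^ 3)) ≤
      ∫⁻ z in Metric.ball c t, ENNReal.ofReal (conformalEnergy F k f z) := by
  have hcomplete : CompleteSpace F := FiniteDimensional.complete ℝ F
  obtain ⟨l, hl⟩ := hδ (f ((chartAt ℂ k).symm c))
  have hcc : c ∈ Metric.ball c t := Metric.mem_ball_self ht
  -- Along radii of the disk the energy density is at most 4m, so the image moves by at most √(8m)·t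
  -- ≤ 3t√m < δ and stays in the chart l.
  have hnear : ∀ z ∈ Metric.ball c t, f ((chartAt ℂ k).symm z) ∈ (chartAt F l).source ∧
      MetricBound (metricCoeff (E := F) l) C (coordMap k l f z) := by
    intro z hz
    have hseg : segment ℝ c z ⊆ Metric.ball c t := (convex_ball c t).segment_subset hcc hz
    refine hl _ ((riemannianEDist_map_chart_symm_le hS hf.1 k (hseg.trans hk) (by positivity)
      fun z' hz' => h4 z' (hseg hz')).trans_lt ?_)
    rw [ENNReal.ofReal_lt_ofReal_iff (lt_of_le_of_lt (by positivity) htδ)]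
    refine lt_of_le_of_lt ?_ htδ
    have h1 : √(2 * (4 * m)) ≤ 3 * √m := by
      rw [Real.sqrt_le_left (by positivity), mul_pow, Real.sq_sqrt hm.le]
      linarith
    have h2 : ‖z - c‖ ≤ t := (mem_ball_iff_norm.1 hz).le
    calc _ ≤ 3 * √m * t := by gcongr
      _ = _ := by ring
  have hcoord : ∀ z ∈ Metric.ball c t, ContDiffAt ℝ ∞ (coordMap k l f : ℂ → F) z := fun z hz =>
    contDiffAt_coordMap hf.1 k l (hk hz) (hnear z hz).1
  have heq : ∀ z ∈ Metric.ball c t, _ := fun z hz =>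
    conformalEnergy_eq_metricCoeff hS hf.1 k l (hk hz) (hnear z hz).1
  have hCC : C ≤ C ^ 2 := le_self_pow₀ hC two_ne_zero
  -- The constant 2C² serves all three comparisons: |du|² ≤ 2Cε, m ≤ (C/2)|du|² and |Δu| ≤ C²|du|².
  refine ofReal_le_lintegral_of_laplacian_le (u := (coordMap k l f : ℂ → F)) ht hm (by linarith)
    (fun z hz => ((hcoord z hz).of_le (WithTop.coe_le_coe.2 (le_top : (2 : ℕ∞) ≤ ⊤))).contDiffWithinAt)
    (fun z hz => (continuousAt_conformalEnergy hS hf.1 k (hk hz)).continuousWithinAt)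
    (fun z hz => ?_) ?_ (fun z hz => ?_) h4 htm
  · have hb := (hnear z hz).2
    have h1 := hb.lower (fderiv ℝ (coordMap k l f : ℂ → F) z 1)
    have h2 := hb.lower (fderiv ℝ (coordMap k l f : ℂ → F) z Complex.I)
    have h3 := conformalEnergy_nonneg (F := F) hS k f (hk hz)
    have h5 := heq z hz
    calc _ ≤ 2 * C * conformalEnergy F k f z := by rw [h5]; linarith
      _ ≤ _ := by gcongr
  · have hb := (hnear c hcc).2
    have h1 := hb.upper (fderiv ℝ (coordMap k l f : ℂ → F) c 1)
    have h2 := hb.upper (fderiv ℝ (coordMap k l f : ℂ → F) c Complex.I)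
    rw [← hc, heq c hcc]
    calc _ ≤ (1 / 2) * C * (‖fderiv ℝ (coordMap k l f : ℂ → F) c 1‖ ^ 2 +
          ‖fderiv ℝ (coordMap k l f : ℂ → F) c Complex.I‖ ^ 2) := by linarith
      _ ≤ _ := by gcongr; linarith
  · refine (norm_flatLaplacian_coordMap_le hS hM hf k l (hk hz) (hnear z hz).1 hC
      (hnear z hz).2).trans ?_
    gcongr
    linarith [sq_nonneg C]

variable (S M F) in
/-- The energy estimate in coordinates. -/
theorem exists_conformalEnergy_mul_sq_le [RegularSpace M] [CompactSpace M]
    (hS : IsHermitianMetric ℂ S) (hM : IsHermitianMetric F M) :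
    ∃ K > (0 : ℝ), ∃ δ > (0 : ℝ), ∀ f : S → M, IsChernHarmonic F f → ∀ (k : S) (c : ℂ) (R E : ℝ),
      0 < R → Metric.ball c R ⊆ (chartAt ℂ k).target → 0 ≤ E →
      ∫⁻ z in Metric.ball c R, ENNReal.ofReal (conformalEnergy F k f z) ≤ ENNReal.ofReal E →
      K * E < δ ^ 2 → conformalEnergy F k f c * R ^ 2 ≤ 16 * K * E := by
  obtain ⟨C, hC, hunif⟩ := exists_uniform_charts F M
  -- The coordinate size of the image plays no role here, so any η would do.
  obtain ⟨δ, hδ, hcharts⟩ := hunif 1 one_pos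
  have hC0 : 0 < C := by linarith
  -- The first entry of the minimum is the smallness of t√m in the mean value inequality. The second
  -- gives 3t√m ≤ 3δ/4 < δ, which keeps the image in one chart.
  refine ⟨8 * (2 * C ^ 2) ^ 3, by positivity, min (1 / (64 * (2 * C ^ 2) ^ 3)) (δ / 4),
    lt_min (by positivity) (by positivity), fun f hf k c R E hR hk hE hint hsmall => ?_⟩
  refine mul_sq_le_of_small_energy hR (lt_min (by positivity) (by positivity)) (by positivity) hE
    (fun z hz => (continuousAt_conformalEnergy hS hf.1 k (hk hz)).continuousWithinAt)
    (fun z hz => conformalEnergy_nonneg hS k f (hk hz))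
    (fun z₁ t m ht hm hsub h4 h1 htm => ?_) hint hsmall
  refine ofReal_le_lintegral_conformalEnergy hS hM hC (δ := δ) (fun y => ?_) hf k ht hm
    (hsub.trans hk) h4 h1 (htm.trans (min_le_left _ _)) ?_
  · obtain ⟨l, hl⟩ := hcharts y
    exact ⟨l, fun y' hy' => ⟨(hl y' hy').1, (hl y' hy').2.1⟩⟩
  · have := htm.trans (min_le_right _ _)
    linarith

end LocalEstimate

/-! ### Small geodesic disks, the gap theorem and the conclusion -/

section Estimates

open Manifold

variable {S : Type*} [TopologicalSpace S] [ChartedSpace ℂ S] [IsManifold 𝓘(ℂ, ℂ) ω S]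
  [RiemannianBundle (fun x : S => TangentSpace 𝓘(ℝ, ℂ) x)]
  [IsContMDiffRiemannianBundle 𝓘(ℝ, ℂ) ∞ ℂ (fun x : S => TangentSpace 𝓘(ℝ, ℂ) x)]
  {F : Type*} [NormedAddCommGroup F] [NormedSpace ℂ F] [NormedSpace ℝ F] [IsScalarTower ℝ ℂ F]
  [FiniteDimensional ℝ F]
  {M : Type*} [TopologicalSpace M] [ChartedSpace F M] [IsManifold 𝓘(ℂ, F) ω M]
  [RiemannianBundle (fun y : M => TangentSpace 𝓘(ℝ, F) y)]
  [IsContMDiffRiemannianBundle 𝓘(ℝ, F) ∞ F (fun y : M => TangentSpace 𝓘(ℝ, F) y)]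

variable (S M F) in
/-- The energy estimate at the center of small geodesic disks. -/
theorem exists_energyDensity_le [CompactSpace S] [MeasurableSpace S] [BorelSpace S]
    [RegularSpace M] [CompactSpace M] (hS : IsHermitianMetric ℂ S) (hM : IsHermitianMetric F M) :
    ∃ C > (0 : ℝ), ∃ ε > (0 : ℝ), ∃ ρ₀ > (0 : ℝ), ∀ f : S → M, IsChernHarmonic F f →
      ∀ (x : S) (ρ : ℝ) (D : Set S), 0 < ρ → ρ ≤ ρ₀ → geodesicDisk x ρ ⊆ D → energy F f D ≤ ε →
      energyDensity ℂ F f x ≤ C * energy F f D / ρ ^ 2 := by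
  obtain ⟨K, hK, δ, hδ, hest⟩ := exists_conformalEnergy_mul_sq_le S F M hS hM
  obtain ⟨t, σ, C, hC, hcov, ht⟩ := exists_finite_charts ℂ S
  have hC0 : 0 < C := by linarith
  have hsC : 1 ≤ √C := Real.one_le_sqrt.2 hC
  -- The energy threshold δ²/(2K) ensures KE < δ². The radius bound 1/C is at most each σ k, which
  -- keeps the coordinate disk inside the ball with twice the radius, where the metric bounds hold.
  refine ⟨C * (16 * K) * C, by positivity, δ ^ 2 / (2 * K), by positivity, 1 / C, by positivity,
    fun f hf x ρ D hρ hρ₀ hD hE => ?_⟩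
  obtain ⟨k, hk, hx, hxk⟩ := hcov x
  obtain ⟨hσ, hsub, hbd⟩ := ht k hk
  set c := chartAt ℂ k x with hc
  -- The chart stretches lengths by at most √C, so the coordinate disk of radius R lies in the
  -- geodesic disk of radius ρ.
  set R := ρ / √C with hR
  have hR0 : 0 < R := by positivity
  have hRρ : R ≤ ρ := div_le_self hρ.le hsC
  have hball : Metric.ball c R ⊆ Metric.ball (chartAt ℂ k k) (2 * σ k) := fun z hz => by
    have h1 : dist z c < R := hz
    have h2 : dist c (chartAt ℂ k k) < σ k := hxk
    have h3 := dist_triangle z c (chartAt ℂ k k)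
    rw [Metric.mem_ball]
    linarith
  have hballk : Metric.ball c R ⊆ (chartAt ℂ k).target :=
    hball.trans (Metric.ball_subset_closedBall.trans hsub)
  have hcx : (chartAt ℂ k).symm c = x := (chartAt ℂ k).left_inv hx
  have hcc : c ∈ Metric.ball c R := Metric.mem_ball_self hR0
  have hint := lintegral_conformalEnergy_le hS hf.1 k Metric.isOpen_ball hballk (D := D)
    fun z hz => hD (by
      have hseg : segment ℝ c z ⊆ Metric.ball c R := (convex_ball c R).segment_subset hcc hz
      have h1 := riemannianEDist_chart_symm_le k (hseg.trans hballk) hC0.le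
        fun z' hz' => (hbd z' (hball (hseg hz'))).upper (z - c)
      rw [hcx] at h1
      refine h1.trans_lt ((ENNReal.ofReal_lt_ofReal_iff hρ).2 ?_)
      have h2 : ‖z - c‖ < R := mem_ball_iff_norm.1 hz
      calc _ < √C * R := by gcongr
        _ = ρ := by rw [hR]; field_simp)
  have hE0 := energy_nonneg (F := F) f D
  have h1 := hest f hf k c R (energy F f D) hR0 hballk hE0 hint (by
    have h3 : K * (δ ^ 2 / (2 * K)) = δ ^ 2 / 2 := by field_simp
    have h4 := mul_le_mul_of_nonneg_left hE hK.le
    have : 0 < δ ^ 2 := by positivity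
    linarith)
  have hR2 : R ^ 2 = ρ ^ 2 / C := by rw [hR, div_pow, Real.sq_sqrt hC0.le]
  have hlow := (hbd c (hball hcc)).lower 1
  rw [norm_one, one_pow] at hlow
  have he := energyDensity_nonneg (F := F) f x
  rw [conformalEnergy, hcx, hR2] at h1
  rw [le_div_iff₀ (by positivity)]
  set lam : ℝ := metricCoeff k c 1 1
  calc energyDensity ℂ F f x * ρ ^ 2 = 1 * energyDensity ℂ F f x * ρ ^ 2 := by ring
    _ ≤ (C * lam) * energyDensity ℂ F f x * ρ ^ 2 := by gcongr
    _ = C * (lam * energyDensity ℂ F f x * (ρ ^ 2 / C)) * C := by field_simp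
    _ ≤ C * (16 * K * energy F f D) * C := by gcongr
    _ = _ := by ring

-- The operator norm of df is at most its Hilbert-Schmidt norm √(2e(f)).
omit [IsContMDiffRiemannianBundle 𝓘(ℝ, ℂ) ∞ ℂ (fun x : S => TangentSpace 𝓘(ℝ, ℂ) x)]
  [FiniteDimensional ℝ F]
  [IsContMDiffRiemannianBundle 𝓘(ℝ, F) ∞ F (fun y : M => TangentSpace 𝓘(ℝ, F) y)] in
theorem norm_mfderiv_le (hS : IsHermitianMetric ℂ S) (f : S → M) (x : S)
    (v : TangentSpace 𝓘(ℝ, ℂ) x) :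
    ‖mfderiv 𝓘(ℝ, ℂ) 𝓘(ℝ, F) f x v‖ ≤ √(2 * energyDensity ℂ F f x) * ‖v‖ := by
  have hz := mem_chart_target ℂ x
  have key : ∀ a : ℂ, ‖mfderiv 𝓘(ℝ, ℂ) 𝓘(ℝ, F) f ((chartAt ℂ x).symm (chartAt ℂ x x))
      (frame ℂ x ((chartAt ℂ x).symm (chartAt ℂ x x)) a)‖ ^ 2 ≤
      2 * energyDensity ℂ F f ((chartAt ℂ x).symm (chartAt ℂ x x)) *
        ‖frame ℂ x ((chartAt ℂ x).symm (chartAt ℂ x x)) a‖ ^ 2 := fun a => by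
    refine (norm_mfderiv_sq_le (F := F) hS x f hz a).trans_eq ?_
    rw [← metricCoeff_self, metricCoeff_eq_mul_norm_sq hS x hz a, conformalEnergy]
    ring
  rw [(chartAt ℂ x).left_inv (mem_chart_source ℂ x)] at key
  obtain ⟨a, rfl⟩ : ∃ a : ℂ, frame ℂ x x a = v := ⟨v, frame_self_apply (E := ℂ) x v⟩
  refine abs_le_of_sq_le_sq' ?_ (by positivity) |>.2
  rw [mul_pow, Real.sq_sqrt (mul_nonneg zero_le_two (energyDensity_nonneg f x))]
  exact key a

/-- A Chern-harmonic map of a closed surface with small image is constant. -/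
theorem eq_of_forall_near [CompactSpace S] [ConnectedSpace S]
    (hS : IsHermitianMetric ℂ S) (hM : IsHermitianMetric F M) {C : ℝ} (hC : 1 ≤ C) {f : S → M}
    (hf : IsChernHarmonic F f) (x₀ : S) (l : M)
    (hl : ∀ x, f x ∈ (chartAt F l).source ∧
      MetricBound (metricCoeff (E := F) l) C (chartAt F l (f x)) ∧
      ‖chartAt F l (f x) - chartAt F l (f x₀)‖ ≤ 1 / C ^ 4) (x : S) : f x = f x₀ := by
  have hC0 : 0 < C := by linarith
  set w₀ := chartAt F l (f x₀) with hw₀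
  set B : F →L[ℝ] F →L[ℝ] ℝ := metricCoeff l w₀ with hB
  have hBb := (hl x₀).2.1
  have hBsymm : ∀ a b, B a b = B b a := metricCoeff_symm l w₀
  have hBle : ∀ a b, |B a b| ≤ C * ‖a‖ * ‖b‖ := fun a b => by
    have h1 : ∀ a, ‖frame F l ((chartAt F l).symm w₀) a‖ ≤ √C * ‖a‖ := fun a => by
      refine abs_le_of_sq_le_sq' ?_ (by positivity) |>.2
      rw [mul_pow, Real.sq_sqrt hC0.le]
      exact (metricCoeff_self l w₀ a).symm.trans_le (hBb.upper a)
    calc |B a b| ≤ ‖frame F l ((chartAt F l).symm w₀) a‖ * ‖frame F l ((chartAt F l).symm w₀) b‖ :=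
          (congrArg abs (metricCoeff_apply l w₀ a b)).trans_le (abs_real_inner_le_norm _ _)
      _ ≤ (√C * ‖a‖) * (√C * ‖b‖) := by gcongr <;> exact h1 _
      _ = √C ^ 2 * ‖a‖ * ‖b‖ := by ring
      _ = _ := by rw [Real.sq_sqrt hC0.le]
  -- The squared distance to w₀ in the metric frozen at w₀; along f it turns out to be subharmonic.
  let q : F → ℝ := fun w => B (w - w₀) (w - w₀)
  have hq : ContDiff ℝ ∞ q := by
    have : ContDiff ℝ ∞ fun w : F => w - w₀ := by fun_prop
    exact (contDiff_const.clm_apply this).clm_apply this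
  let h : S → ℝ := fun x => q (chartAt F l (f x))
  have hcont : Continuous h := hq.continuous.comp (continuous_iff_continuousAt.2 fun x =>
    ((chartAt F l).continuousAt (hl x).1).comp hf.1.continuous.continuousAt)
  obtain ⟨x₁, -, hx₁⟩ := isCompact_univ.exists_isMaxOn ⟨x₀, mem_univ x₀⟩ hcont.continuousOn
  -- The maximum principle in charts makes the set where h is maximal open. By connectedness h is
  -- constant, and it vanishes at x₀.
  have hclopen : IsClopen {x | h x = h x₁} := by
    refine ⟨isClosed_eq hcont continuous_const, isOpen_iff_mem_nhds.2 fun k hk => ?_⟩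
    obtain ⟨t, ht, hsub⟩ := Metric.isOpen_iff.1 (chartAt ℂ k).open_target _ (mem_chart_target ℂ k)
    set c := chartAt ℂ k k
    have hcoord : ∀ z ∈ Metric.ball c t, ContDiffAt ℝ 2 (coordMap k l f : ℂ → F) z := fun z hz =>
      (contDiffAt_coordMap hf.1 k l (hsub hz) (hl _).1).of_le
        (WithTop.coe_le_coe.2 (le_top : (2 : ℕ∞) ≤ ⊤))
    have hconst : ∀ z ∈ Metric.ball c t, q (coordMap k l f z) = q (coordMap k l f c) := by
      intro z hz
      refine eq_of_laplacian_nonneg_of_max (h := fun z => q (coordMap k l f z)) (c := c) (t := t)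
        (fun z hz => ((hq.contDiffAt.of_le (WithTop.coe_le_coe.2 (le_top : (2 : ℕ∞) ≤ ⊤))).comp z
          (hcoord z hz)).contDiffWithinAt) (fun z hz => ?_) (fun z hz => ?_) hz
      · have h1 := flatLaplacian_quadratic hBsymm w₀ (hcoord z hz)
        have h2 := norm_flatLaplacian_coordMap_le hS hM hf k l (hsub hz) (hl _).1 hC (hl _).2.1
        have h3 := (hl ((chartAt ℂ k).symm z)).2.2
        have h4 := hBb.lower (fderiv ℝ (coordMap k l f : ℂ → F) z 1)
        have h5 := hBb.lower (fderiv ℝ (coordMap k l f : ℂ → F) z Complex.I)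
        have h6 := hBle (coordMap k l f z - w₀) (flatLaplacian (coordMap k l f : ℂ → F) z)
        set N := ‖fderiv ℝ (coordMap k l f : ℂ → F) z 1‖ ^ 2 +
          ‖fderiv ℝ (coordMap k l f : ℂ → F) z Complex.I‖ ^ 2 with hN
        -- This is where the bound 1/C⁴ is needed: C · C⁻⁴ · C²N = N/C, which the lower metric bound
        -- makes at most the positive gradient term of the Laplacian.
        have h7 : |B (coordMap k l f z - w₀) (flatLaplacian (coordMap k l f : ℂ → F) z)| ≤ N / C :=
          calc _ ≤ _ := h6
            _ ≤ C * (1 / C ^ 4) * (C ^ 2 * N) := by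
              gcongr
              exact h3
            _ = N / C := by field_simp
        have h8 : N / C ≤ B (fderiv ℝ (coordMap k l f : ℂ → F) z 1)
            (fderiv ℝ (coordMap k l f : ℂ → F) z 1) + B (fderiv ℝ (coordMap k l f : ℂ → F) z Complex.I)
            (fderiv ℝ (coordMap k l f : ℂ → F) z Complex.I) := by
          rw [div_le_iff₀ hC0]
          linarith
        have h9 : (0 : ℝ) ≤ flatLaplacian (fun z => q (coordMap k l f z)) z := by
          refine le_of_le_of_eq ?_ h1.symm
          linarith [(abs_le.1 h7).1]
        exact h9
      · have e : ∀ z, q (coordMap k l f z) = h ((chartAt ℂ k).symm z) := fun z => rfl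
        have e2 : h ((chartAt ℂ k).symm c) = h x₁ := by
          rw [(chartAt ℂ k).left_inv (mem_chart_source ℂ k)]; exact hk
        simp only [e, e2]
        exact hx₁ (mem_univ _)
    filter_upwards [(chartAt ℂ k).open_source.mem_nhds (mem_chart_source ℂ k),
      ((chartAt ℂ k).continuousAt (mem_chart_source ℂ k)).preimage_mem_nhds
        (Metric.ball_mem_nhds c ht)] with y hy hyc
    have h1 := hconst _ hyc
    simp only [coordMap, Function.comp_apply, (chartAt ℂ k).left_inv hy,
      (chartAt ℂ k).left_inv (mem_chart_source ℂ k), c] at h1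
    exact h1.trans hk
  have huniv := hclopen.eq_univ ⟨x₁, rfl⟩
  have hall : ∀ y, h y = h x₁ := fun y => by
    have := mem_univ y
    rwa [← huniv] at this
  have h0 : h x = 0 := by
    rw [hall x, ← hall x₀]
    simp [h, q, ← hw₀]
  have h1 := hBb.lower (chartAt F l (f x) - w₀)
  have h2 : ‖chartAt F l (f x) - w₀‖ ^ 2 ≤ 0 := by
    refine h1.trans_eq ?_
    have : B (chartAt F l (f x) - w₀) (chartAt F l (f x) - w₀) = 0 := h0
    rw [← hw₀, ← hB, this, mul_zero]
  have h3 : chartAt F l (f x) = chartAt F l (f x₀) := by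
    rw [← sub_eq_zero, ← norm_eq_zero]
    exact pow_eq_zero_iff two_ne_zero |>.1 (le_antisymm h2 (sq_nonneg _))
  exact (chartAt F l).injOn (hl x).1 (hl x₀).1 h3

variable (S M F) in
/-- Chern-harmonic maps of a closed surface with small energy are constant. -/
theorem exists_energyDensity_eq_zero [T2Space S] [CompactSpace S] [ConnectedSpace S]
    [MeasurableSpace S] [BorelSpace S] [RegularSpace M] [CompactSpace M]
    (hS : IsHermitianMetric ℂ S) (hM : IsHermitianMetric F M) :
    ∃ ε > (0 : ℝ), ∀ f : S → M, IsChernHarmonic F f → energy F f univ ≤ ε →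
      ∀ x, energyDensity ℂ F f x = 0 := by
  obtain ⟨C₀, hC₀, ε₀, hε₀, ρ₀, hρ₀, hest⟩ := exists_energyDensity_le S F M hS hM
  obtain ⟨C, hC, hunif⟩ := exists_uniform_charts F M
  obtain ⟨δ, hδ, hcharts⟩ := hunif (1 / C ^ 4) (by positivity)
  obtain ⟨D, hD, hdiam⟩ := exists_riemannianEDist_lt ℂ S
  obtain ⟨x₀⟩ : Nonempty S := inferInstance
  -- If |df| ≤ κ, the image lies within κD = δ/2 of f x₀. The energy threshold κ²ρ₀²/(2C₀) is what
  -- the estimate on disks of radius ρ₀ needs for 2e(f) ≤ κ².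
  set κ := δ / (2 * D) with hκ
  have hκ0 : 0 < κ := by positivity
  refine ⟨min ε₀ (κ ^ 2 * ρ₀ ^ 2 / (2 * C₀)), lt_min hε₀ (by positivity), fun f hf hE x => ?_⟩
  have h1 : ∀ y, 2 * energyDensity ℂ F f y ≤ κ ^ 2 := fun y => by
    have h2 := hest f hf y ρ₀ univ hρ₀ le_rfl (subset_univ _) (hE.trans (min_le_left _ _))
    have h3 := hE.trans (min_le_right _ _)
    rw [le_div_iff₀ (by positivity)] at h2 h3
    have h4 : (2 * energyDensity ℂ F f y) * ρ₀ ^ 2 ≤ κ ^ 2 * ρ₀ ^ 2 := by linarith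
    exact le_of_mul_le_mul_right h4 (by positivity)
  have h2 : ∀ y (v : TangentSpace 𝓘(ℝ, ℂ) y), ‖mfderiv 𝓘(ℝ, ℂ) 𝓘(ℝ, F) f y v‖ ≤ κ * ‖v‖ :=
    fun y v => (norm_mfderiv_le hS f y v).trans (by
      gcongr
      exact (Real.sqrt_le_left hκ0.le).2 (h1 y))
  obtain ⟨l, hl⟩ := hcharts (f x₀)
  have h3 := eq_of_forall_near hS hM hC hf x₀ l fun y => hl (f y) (by
    refine (riemannianEDist_map_le (hf.1.of_le (by simp)) h2 (hdiam x₀ y)).trans_lt ?_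
    rw [← ENNReal.ofReal_mul hκ0.le, ENNReal.ofReal_lt_ofReal_iff hδ, hκ]
    have : δ / (2 * D) * D = δ / 2 := by field_simp
    linarith)
  have h4 : f = fun _ => f x₀ := funext h3
  rw [h4]
  unfold energyDensity
  rw [mfderiv_const]
  simp

omit [IsManifold 𝓘(ℂ, ℂ) ω S]
  [IsContMDiffRiemannianBundle 𝓘(ℝ, ℂ) ∞ ℂ (fun x : S => TangentSpace 𝓘(ℝ, ℂ) x)] in
theorem geodesicDisk_subset {p x : S} {r : ℝ} (hr : 0 < r) (hx : x ∈ geodesicDisk p r) :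
    geodesicDisk x r ⊆ geodesicDisk p (2 * r) := fun y hy => by
  have h1 : riemannianEDist 𝓘(ℝ, ℂ) p y ≤ riemannianEDist 𝓘(ℝ, ℂ) p x + riemannianEDist 𝓘(ℝ, ℂ) x y :=
    riemannianEDist_triangle
  refine h1.trans_lt ((ENNReal.add_lt_add hx hy).trans_eq ?_)
  rw [← ENNReal.ofReal_add hr.le hr.le, two_mul]

omit [IsManifold 𝓘(ℂ, ℂ) ω S]
  [IsContMDiffRiemannianBundle 𝓘(ℝ, ℂ) ∞ ℂ (fun x : S => TangentSpace 𝓘(ℝ, ℂ) x)] in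
theorem geodesicDisk_mono {x : S} {r s : ℝ} (h : r ≤ s) : geodesicDisk x r ⊆ geodesicDisk x s :=
  fun _ hy => lt_of_lt_of_le hy (ENNReal.ofReal_le_ofReal h)

variable (S M F) in
theorem exists_energyDensity_le_energy_div [T2Space S] [CompactSpace S] [ConnectedSpace S]
    [MeasurableSpace S] [BorelSpace S] [RegularSpace M] [CompactSpace M]
    (hS : IsHermitianMetric ℂ S) (hM : IsHermitianMetric F M) :
    ∃ C₃ > (0 : ℝ), ∃ ε₁ > (0 : ℝ), ∀ f : S → M, IsChernHarmonic F f → ∀ (p : S) (r : ℝ), 0 < r →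
      energy F f (geodesicDisk p (2 * r)) ≤ ε₁ → ∀ x ∈ geodesicDisk p r,
        energyDensity ℂ F f x ≤ C₃ * (energy F f (geodesicDisk p (2 * r)) / r ^ 2) := by
  obtain ⟨C₀, hC₀, ε₀, hε₀, ρ₀, hρ₀, hest⟩ := exists_energyDensity_le S F M hS hM
  obtain ⟨ε₂, hε₂, hgap⟩ := exists_energyDensity_eq_zero S F M hS hM
  obtain ⟨D, hD, hdiam⟩ := exists_riemannianEDist_lt ℂ S
  -- For r ≤ D one has r ≤ A min(r, ρ₀), so shrinking the radius to at most ρ₀ costs a factor A².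
  set A := max 1 (D / ρ₀) with hA
  have hA1 : 1 ≤ A := le_max_left _ _
  refine ⟨C₀ * A ^ 2, by positivity, min ε₀ ε₂, lt_min hε₀ hε₂, fun f hf p r hr hE x hx => ?_⟩
  have hE0 := energy_nonneg (F := F) f (geodesicDisk p (2 * r))
  rcases le_or_gt r D with hrD | hrD
  · have hρr : min r ρ₀ ≤ r := min_le_left _ _
    have hρ : 0 < min r ρ₀ := lt_min hr hρ₀
    have h1 := hest f hf x (min r ρ₀) (geodesicDisk p (2 * r)) hρ (min_le_right _ _)
      ((geodesicDisk_mono hρr).trans (geodesicDisk_subset hr hx)) (hE.trans (min_le_left _ _))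
    have h2 : r ≤ A * min r ρ₀ := by
      rcases min_choice r ρ₀ with h | h <;> rw [h]
      · nlinarith
      · refine hrD.trans ((div_le_iff₀ hρ₀).1 (le_max_right _ _))
    refine h1.trans ?_
    rw [← mul_div_assoc, div_le_div_iff₀ (by positivity) (by positivity)]
    calc C₀ * energy F f (geodesicDisk p (2 * r)) * r ^ 2
        ≤ C₀ * energy F f (geodesicDisk p (2 * r)) * (A * min r ρ₀) ^ 2 := by gcongr
      _ = _ := by ring
  -- The disk is the whole surface and r is arbitrarily large, so no bound by the total energy would
  -- suffice; the gap theorem gives e(f) = 0.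
  · have h1 : geodesicDisk p (2 * r) = univ := eq_univ_of_forall fun y =>
      (hdiam p y).trans_le (ENNReal.ofReal_le_ofReal (by linarith))
    rw [hgap f hf (h1 ▸ hE.trans (min_le_right _ _)) x]
    positivity

end Estimates

end ChernHarmonic

end

theorem theorem2p4
    -- the closed Riemann surface with its conformal metric
    {S : Type*} [TopologicalSpace S] [T2Space S] [CompactSpace S] [ConnectedSpace S]
    [MeasurableSpace S] [BorelSpace S]
    [ChartedSpace ℂ S] [IsManifold 𝓘(ℂ, ℂ) ω S]
    [RiemannianBundle (fun x : S => TangentSpace 𝓘(ℝ, ℂ) x)]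
    [IsContMDiffRiemannianBundle 𝓘(ℝ, ℂ) ∞ ℂ (fun x : S => TangentSpace 𝓘(ℝ, ℂ) x)]
    (hS : ChernHarmonic.IsHermitianMetric ℂ S)
    -- the compact Hermitian surface
    {M : Type*} [TopologicalSpace M] [T2Space M] [CompactSpace M]
    [ChartedSpace (EuclideanSpace ℂ (Fin 2)) M]
    [IsManifold 𝓘(ℂ, EuclideanSpace ℂ (Fin 2)) ω M]
    [RiemannianBundle (fun y : M => TangentSpace 𝓘(ℝ, EuclideanSpace ℂ (Fin 2)) y)]
    [IsContMDiffRiemannianBundle 𝓘(ℝ, EuclideanSpace ℂ (Fin 2)) ∞ (EuclideanSpace ℂ (Fin 2))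
      (fun y : M => TangentSpace 𝓘(ℝ, EuclideanSpace ℂ (Fin 2)) y)]
    (hM : ChernHarmonic.IsHermitianMetric (EuclideanSpace ℂ (Fin 2)) M) :
    ∃ C₃ > (0 : ℝ), ∃ ε₁ > (0 : ℝ),
      ∀ f : S → M, ChernHarmonic.IsChernHarmonic (EuclideanSpace ℂ (Fin 2)) f →
        ∀ (p : S) (r : ℝ), 0 < r →
          ChernHarmonic.energy (EuclideanSpace ℂ (Fin 2)) f
              (ChernHarmonic.geodesicDisk p (2 * r)) ≤ ε₁ →
          ∀ x ∈ ChernHarmonic.geodesicDisk p r,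
            ChernHarmonic.energyDensity ℂ (EuclideanSpace ℂ (Fin 2)) f x ≤
              C₃ * (ChernHarmonic.energy (EuclideanSpace ℂ (Fin 2)) f
              (ChernHarmonic.geodesicDisk p (2 * r)) / r ^ 2) := by
  exact ChernHarmonic.exists_energyDensity_le_energy_div S (EuclideanSpace ℂ (Fin 2)) M hS hM
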